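/- Let $p$ be a prime, let $K$ be a finite extension of $\mathbb{Q}_p$ with the absolute value extending the $p$-adic one, and let $\mathcal{G}$ be a $K$-Lie group, i.e. a locally analytic manifold over $K$ (modelled on $K^m$) with a group structure whose multiplication and inversion are locally analytic. For a $K$-Lie group $\mathcal{U}$ with identity $e$: - $H^n_{la}(\mathcal{U},K)$ is the $n$-th cohomology of the complex of locally analytic functions $\mathcal{O}^{la}(\mathcal{U}^n,K)$, $n\ge 0$, with differential $$(\partial f)(g_1,\dots,g_{n+1})=f(g_2,\dots,g_{n+1})+\sum_{i=1}^{n}(-1)^i f(g_1,\dots,g_ig_{i+1},\dots,g_{n+1})+(-1)^{n+1}f(g_1,\dots,g_n).$$ - $H^n(\mathrm{Lie}(\mathcal{U}),K)$ is the $n$-th cohomology of the complex $\mathrm{Hom}_K(\bigwedge^n \mathrm{Lie}(\mathcal{U}),K)$, $n\ge 0$, with differential $$(d\omega)(x_1\wedge\dots\wedge x_{n+1})=\sum_{r<s}(-1)^{r+s}\omega([x_r,x_s]\wedge x_1\wedge\dots\widehat{x_r}\dots\widehat{x_s}\dots\wedge x_{n+1}),$$ where $\mathrm{Lie}(\mathcal{U})=T_e\,\mathcal{U}$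 carries the bracket of left-invariant vector fields. - For $f\in\mathcal{O}^{la}(\mathcal{U}^n,K)$, let $\phi(f)\in\mathrm{Hom}_K(\bigwedge^n \mathrm{Lie}(\mathcal{U}),K)$ be the form $$\phi(f)(v_1\wedge\dots\wedge v_n)=\sum_{\sigma\in S_n}\mathrm{sgn}(\sigma)\,\bigl(\partial^{(1)}_{v_{\sigma(1)}}\cdots\partial^{(n)}_{v_{\sigma(n)}}f\bigr)(e,\dots,e),$$ where $\partial^{(i)}_v$ is the derivative in direction $v$ in the $i$-th variable; thus $\phi(f_1\otimes\dots\otimes f_n)=df_1\wedge\dots\wedge df_n$ (differentials at $e$) for $n\ge1$, and $\phi$ is the identity of $K$ for $n=0$. Then there is an open subgroup $\mathcal{U}$ of $\mathcal{G}$ such that for every $n\ge 0$ the map $\phi$ sends locally analytic cocycles on $\mathcal{U}^n$ to Lie algebra cocycles and induces an isomorphism of $K$-vector spaces (the Lazard morphism) $$\Phi_L\colon H^n_{la}(\mathcal{U},K)\xrightarrow{\ \sim\ }H^n(\mathrm{Lie}(\mathcal{U}),K),\qquad [f]\mapsto[\phi(f)].$$ -/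

import Mathlib

open scoped Manifold ContDiff

noncomputable section

namespace LazardComparison

/-! ### Open subgroups of Lie groups are Lie groups -/

section OpenSubgroup

variable {K : Type*} [NontriviallyNormedField K]
  {E : Type*} [NormedAddCommGroup E] [NormedSpace K E]
  {G : Type*} [TopologicalSpace G] [ChartedSpace E G] [Group G]

/-- An open subgroup is a manifold, as an open subset of the ambient manifold. -/
instance openSubgroupChartedSpace (U : OpenSubgroup G) : ChartedSpace E U :=
  inferInstanceAs (ChartedSpace E U.toOpens)

/-- An open subgroup of an analytic Lie group is an analytic Lie group. -/
instance openSubgroupLieGroup [LieGroup 𝓘(K, E) ω G] (U : OpenSubgroup G) :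
    LieGroup 𝓘(K, E) ω U where
  toIsManifold := inferInstanceAs (IsManifold 𝓘(K, E) ω U.toOpens)
  contMDiff_mul := by
    have hv : ContMDiff 𝓘(K, E) 𝓘(K, E) ω (Subtype.val : U.toOpens → G) := contMDiff_subtype_val
    have h : ContMDiff (𝓘(K, E).prod 𝓘(K, E)) 𝓘(K, E) ω
        fun q : U.toOpens × U.toOpens => (q.1 : G) * (q.2 : G) :=
      (hv.comp contMDiff_fst).mul (hv.comp contMDiff_snd)
    exact fun q => (ChartedSpace.liftPropWithinAt_subtypeVal_comp_iff (U := U.toOpens) _ _ _).1 (h q)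
  contMDiff_inv := by
    have hv : ContMDiff 𝓘(K, E) 𝓘(K, E) ω (Subtype.val : U.toOpens → G) := contMDiff_subtype_val
    have h : ContMDiff 𝓘(K, E) 𝓘(K, E) ω fun q : U.toOpens => (q : G)⁻¹ := hv.inv
    exact fun q => (ChartedSpace.liftPropWithinAt_subtypeVal_comp_iff (U := U.toOpens) _ _ _).1 (h q)

end OpenSubgroup

/-! ### Locally analytic group cohomology with trivial coefficients -/

section GroupCohomology

variable (K : Type*) [NontriviallyNormedField K]

/-- The inhomogeneous (cobar) differential, for trivial coefficients:
`(∂f)(g₁, …, gₙ₊₁) = f(g₂, …, gₙ₊₁) + ∑_{i=1}^{n} (-1)ⁱ f(g₁, …, gᵢgᵢ₊₁, …, gₙ₊₁)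
  + (-1)ⁿ⁺¹ f(g₁, …, gₙ)`. -/
def groupDifferential (G : Type*) [Group G] (n : ℕ) :
    ((Fin n → G) → K) →ₗ[K] ((Fin (n + 1) → G) → K) where
  toFun f g := f (Fin.tail g)
    + ∑ i : Fin n, (-1) ^ ((i : ℕ) + 1) * f (Fin.contractNth i.castSucc (· * ·) g)
    + (-1) ^ (n + 1) * f (Fin.init g)
  map_add' f f' := by
    funext g
    simp only [Pi.add_apply, mul_add, Finset.sum_add_distrib]
    ring
  map_smul' a f := by
    funext g
    simp only [Pi.smul_apply, smul_eq_mul, RingHom.id_apply, mul_add, Finset.mul_sum,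
      mul_left_comm a]

variable (E : Type*) [NormedAddCommGroup E] [NormedSpace K E]
  (G : Type*) [TopologicalSpace G] [ChartedSpace E G]

/-- The locally analytic functions `Gⁿ → K` on the product manifold `Gⁿ`. -/
def laCochains (n : ℕ) : Submodule K ((Fin n → G) → K) where
  carrier := {f | ContMDiff (ModelWithCorners.pi fun _ : Fin n => 𝓘(K, E)) 𝓘(K, K) ω f}
  add_mem' hf hf' := ContMDiff.add hf hf'
  zero_mem' := contMDiff_const
  smul_mem' a _ hf := (contMDiff_const (c := a) : ContMDiff _ 𝓘(K, K) ω _).smul hf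

variable [Group G]

/-- Locally analytic `n`-cocycles. -/
def laCocycles (n : ℕ) : Submodule K ((Fin n → G) → K) :=
  laCochains K E G n ⊓ LinearMap.ker (groupDifferential K G n)

/-- Locally analytic `n`-coboundaries. -/
def laCoboundaries : (n : ℕ) → Submodule K ((Fin n → G) → K)
  | 0 => ⊥
  | n + 1 => (laCochains K E G n).map (groupDifferential K G n)

/-- Locally analytic group cohomology `Hⁿ_la(G, K)`. -/
abbrev LaCohomology (n : ℕ) : Type _ :=
  laCocycles K E G n ⧸ (laCoboundaries K E G n).submoduleOf (laCocycles K E G n)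

/-- The class of a locally analytic cocycle. -/
def laClass (n : ℕ) : laCocycles K E G n →ₗ[K] LaCohomology K E G n :=
  Submodule.mkQ _

end GroupCohomology

/-! ### Lie algebra cohomology with trivial coefficients -/

section LieCohomology

variable (K : Type*) [Field K] (L : Type*) [LieRing L] [LieAlgebra K L]

/-- The `n`-cochains of a Lie algebra `L`, i.e. the linear maps `⋀ⁿ L → K`, as alternating maps. -/
def LieCochain (n : ℕ) : Type _ := L [⋀^Fin n]→ₗ[K] K

instance (n : ℕ) : AddCommGroup (LieCochain K L n) :=
  inferInstanceAs (AddCommGroup (L [⋀^Fin n]→ₗ[K] K))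

instance (n : ℕ) : Module K (LieCochain K L n) :=
  inferInstanceAs (Module K (L [⋀^Fin n]→ₗ[K] K))

/-- The values of a Lie algebra cochain. -/
def lieEval (n : ℕ) : LieCochain K L n →ₗ[K] ((Fin n → L) → K) where
  toFun η := (η : L [⋀^Fin n]→ₗ[K] K).toFun
  map_add' _ _ := rfl
  map_smul' _ _ := rfl

/-- The Chevalley–Eilenberg differential, for trivial coefficients:
`(dη)(x₀, …, xₙ) = ∑_{i<j} (-1)ⁱ⁺ʲ η([xᵢ, xⱼ], x₀, …, x̂ᵢ, …, x̂ⱼ, …, xₙ)`.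
Here `i : Fin (n + 1)` with `i.castSucc < j`, so that `l ↦ j.succAbove (i.succAbove l)` enumerates
increasingly the indices different from `i` and `j`. -/
def lieDifferential : (n : ℕ) → LieCochain K L n →ₗ[K] ((Fin (n + 1) → L) → K)
  | 0 => 0
  | n + 1 =>
    { toFun := fun η x => ∑ j : Fin (n + 2), ∑ i : Fin (n + 1),
        if i.castSucc < j then
          (-1) ^ ((i : ℕ) + (j : ℕ)) * lieEval K L (n + 1) η
            (Fin.cons ⁅x i.castSucc, x j⁆ fun l : Fin n => x (j.succAbove (i.succAbove l)))
        else 0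
      map_add' := fun η η' => by
        funext x
        simp only [map_add, Pi.add_apply, ← Finset.sum_add_distrib]
        refine Finset.sum_congr rfl fun j _ => Finset.sum_congr rfl fun i _ => ?_
        split_ifs <;> ring
      map_smul' := fun a η => by
        funext x
        simp only [map_smul, Pi.smul_apply, smul_eq_mul, RingHom.id_apply, Finset.mul_sum]
        refine Finset.sum_congr rfl fun j _ => Finset.sum_congr rfl fun i _ => ?_
        split_ifs <;> ring }

/-- Lie algebra `n`-cocycles. -/
def lieCocycles (n : ℕ) : Submodule K (LieCochain K L n) :=
  LinearMap.ker (lieDifferential K L n)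

/-- Lie algebra `n`-coboundaries: the cochains `θ` such that `θ = dη` for some cochain `η`. -/
def lieCoboundaries : (n : ℕ) → Submodule K (LieCochain K L n)
  | 0 => ⊥
  | n + 1 => (LinearMap.range (lieDifferential K L n)).comap (lieEval K L (n + 1))

/-- Lie algebra cohomology `Hⁿ(L, K)` with trivial coefficients. -/
abbrev LieCohomology (n : ℕ) : Type _ :=
  lieCocycles K L n ⧸ (lieCoboundaries K L n).submoduleOf (lieCocycles K L n)

/-- The class of a Lie algebra cocycle. -/
def lieClass (n : ℕ) : lieCocycles K L n →ₗ[K] LieCohomology K L n :=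
  Submodule.mkQ _

end LieCohomology

/-! ### Differentiating cochains -/

section Lazard

variable (K : Type*) [NontriviallyNormedField K]
  (E : Type*) [NormedAddCommGroup E] [NormedSpace K E]
  (G : Type*) [TopologicalSpace G] [ChartedSpace E G] [Group G]

/-- The identification of the Lie algebra `T₁G` with the model space `E` given by the preferred
chart at `1` (this is how the tangent space is defined). -/
def lieCoord : GroupLieAlgebra 𝓘(K, E) G →ₗ[K] E where
  toFun v := v
  map_add' _ _ := rfl
  map_smul' _ _ := rfl

/-- A function on `Gⁿ`, read in the `n`-th power of the preferred chart of `G` at `1`. -/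
def inChart {n : ℕ} (f : (Fin n → G) → K) (y : Fin n → E) : K :=
  f fun i => (chartAt E (1 : G)).symm (y i)

/-- The multilinear form `(v₁, …, vₙ) ↦ (∂_{v₁}^{(1)} ⋯ ∂_{vₙ}^{(n)} f)(1, …, 1)` on the Lie
algebra, where `∂_v^{(i)}` is the derivative in the direction `v` in the `i`-th variable. It sends
`f₁ ⊗ ⋯ ⊗ fₙ` to `df₁ ⊗ ⋯ ⊗ dfₙ`. -/
def mixedDerivative {n : ℕ} (f : (Fin n → G) → K) :
    MultilinearMap K (fun _ : Fin n => GroupLieAlgebra 𝓘(K, E) G) K :=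
  (iteratedFDeriv K n (inChart K E G f)
      (fun _ => chartAt E (1 : G) (1 : G))).toMultilinearMap.compLinearMap
    fun i => LinearMap.single K (fun _ : Fin n => E) i ∘ₗ lieCoord K E G

/-- Differentiating cochains: the alternating form
`(v₁, …, vₙ) ↦ ∑_σ sgn(σ) (∂_{v_{σ(1)}}^{(1)} ⋯ ∂_{v_{σ(n)}}^{(n)} f)(1, …, 1)`.
It sends `f₁ ⊗ ⋯ ⊗ fₙ` to `df₁ ∧ ⋯ ∧ dfₙ`, and is the identity of `K` for `n = 0`. -/
def lazardCochain [CompleteSpace E] [LieGroup 𝓘(K, E) ω G] {n : ℕ} (f : (Fin n → G) → K) :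
    LieCochain K (GroupLieAlgebra 𝓘(K, E) G) n :=
  MultilinearMap.alternatization (mixedDerivative K E G f)

end Lazard

end LazardComparison

end

open scoped Manifold ContDiff

noncomputable section

set_option maxSynthPendingDepth 3
set_option linter.unusedSectionVars false

namespace LazardComparison

/-! ### Exterior calculus of alternating forms on a finite-dimensional space -/

section Forms

variable {K : Type*} [NontriviallyNormedField K] [CompleteSpace K]
  {E : Type*} [NormedAddCommGroup E] [NormedSpace K E] [FiniteDimensional K E]

/-! The comparison runs through a double complex on a compact group V covered by one analytic chart.
In bidegree (p, q) stand the analytic functions on V^(p+1) with values in alternating q-forms on the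
Lie algebra: the first p variables are group cochain variables, and the last one is the argument of
a differential q-form on V written in the left invariant frame. The row differential `cobar` is the
group differential with coefficients in functions of the last variable; the column differential
`extDeriv` is the de Rham differential in that variable. They commute (`cobar_extDeriv`) because the
faces multiply the last variable on the left, while left invariant fields act through right
translations.

Rows are contracted by evaluating the last variable at 1 (`evalLast_cobar`). What remains at p = 0
are the constant functions, i.e. the left invariant forms, and they make up the Chevalley–Eilenberg
complex. Columns are exact for q > 0 (`exists_extDeriv_eq`): the Poincaré lemma with parameters
holds for analytic germs, since dividing Taylor terms by positive integers keeps the radius positive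
when |1/n| ≤ n (`InvNatBounded`), and germs glue over a compact set with clopen neighbourhoods. At q
= 0 a closed element is locally constant in the last variable, hence by compactness invariant under
right multiplication of that variable by an open subgroup W.

The explicit map φ enters through `restrict`: set the last variable to 1, differentiate in all
others at the identity and antisymmetrize. By `restrict_cobar` this is, up to signs, a chain map
from the double complex to the Chevalley–Eilenberg complex, so a zigzag does not change the Lie
algebra class.

Injectivity: if φ(f) is a coboundary, a zigzag (`exists_cobar_eq`) writes f, extended constantly in
the last variable, as the cobar of some b locally constant in that variable; averaging b over the
finite set V/W gives a cochain with coboundary f. Surjectivity: the reverse zigzag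
(`exists_restrict_sub_mem`) takes a Lie cocycle to an element F of bidegree (n, 0), and F at last
variable 1 satisfies the cocycle identity on W. Cocycle spaces are finite-dimensional and vanish
above the dimension of the group, so one W serves all degrees. The required subgroup is this W, on
which injectivity is applied afresh. -/

variable (K E) in
/-- Alternating `q`-forms on `E`. -/
abbrev Form (q : ℕ) : Type _ := E [⋀^Fin q]→L[K] K

/-- The product of covectors with forms: `wedge L = ∑ eᵢ* ∧ L eᵢ` in terms of a basis. -/
def wedge {n : ℕ} : (E →ₗ[K] Form K E n) →ₗ[K] Form K E (n + 1) :=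
  (ContinuousAlternatingMap.alternatizeUncurryFinCLM K E K).toLinearMap ∘ₗ
    (LinearMap.toContinuousLinearMap : (E →ₗ[K] Form K E n) ≃ₗ[K] (E →L[K] Form K E n)).toLinearMap

theorem wedge_apply {n : ℕ} (L : E →ₗ[K] Form K E n) (v : Fin (n + 1) → E) :
    wedge L v = ∑ i : Fin (n + 1), (-1) ^ (i : ℕ) * L (v i) (i.removeNth v) := by
  simp only [wedge, LinearMap.comp_apply, LinearEquiv.coe_coe, ContinuousLinearMap.coe_coe,
    ContinuousAlternatingMap.alternatizeUncurryFinCLM_apply,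
    ContinuousAlternatingMap.alternatizeUncurryFin_apply]
  refine Finset.sum_congr rfl fun i _ => ?_
  rw [zsmul_eq_mul]
  simp

theorem wedge_sub {n : ℕ} (L L' : E →ₗ[K] Form K E n) : wedge (L - L') = wedge L - wedge L' := by
  ext v
  rw [ContinuousAlternatingMap.sub_apply]
  simp only [wedge_apply, ← Finset.sum_sub_distrib, ← mul_sub]
  rfl

theorem wedge_neg {n : ℕ} (L : E →ₗ[K] Form K E n) : wedge (-L) = -wedge L := by
  ext v
  rw [ContinuousAlternatingMap.neg_apply]
  simp only [wedge_apply, ← Finset.sum_neg_distrib, ← mul_neg]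
  rfl

theorem wedge_coe {n : ℕ} (L : E →L[K] Form K E n) :
    wedge (L : E →ₗ[K] Form K E n) = ContinuousAlternatingMap.alternatizeUncurryFin L := by
  ext v
  rw [wedge_apply, ContinuousAlternatingMap.alternatizeUncurryFin_apply]
  refine Finset.sum_congr rfl fun i _ => ?_
  rw [zsmul_eq_mul]
  simp

theorem toAlternatingMap_wedge {n : ℕ} (L : E →ₗ[K] Form K E n) :
    (wedge L).toAlternatingMap = AlternatingMap.alternatizeUncurryFin
      (ContinuousAlternatingMap.toAlternatingMapLinear (R := K) ∘ₗ L) := by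
  ext v
  rw [AlternatingMap.alternatizeUncurryFin_apply, ContinuousAlternatingMap.coe_toAlternatingMap,
    wedge_apply]
  refine Finset.sum_congr rfl fun i _ => ?_
  rw [zsmul_eq_mul]
  simp

/-- Each pair of positions a < b is encoded as (`i.castSucc`, `j.succ`) with i ≤ j. The same
indexing reappears when the Chevalley–Eilenberg sums are compared in `lieDifferential_formEquiv`. -/
theorem wedge_wedge_apply {n : ℕ} (N : E →ₗ[K] E →ₗ[K] Form K E n) (v : Fin (n + 2) → E) :
    wedge (wedge ∘ₗ N) v = ∑ i : Fin (n + 1), ∑ j ∈ Finset.Ici i, (-1) ^ (i + j : ℕ) *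
      (N (v i.castSucc) (v j.succ) (j.removeNth <| i.castSucc.removeNth v) -
        N (v j.succ) (v i.castSucc) (j.removeNth <| i.castSucc.removeNth v)) := by
  have h : (wedge (wedge ∘ₗ N)).toAlternatingMap = AlternatingMap.alternatizeUncurryFin
      (AlternatingMap.alternatizeUncurryFinLM ∘ₗ
        N.compr₂ (ContinuousAlternatingMap.toAlternatingMapLinear (R := K))) := by
    rw [toAlternatingMap_wedge]
    congr 1
    ext u : 1
    exact toAlternatingMap_wedge _
  have h' := congrArg (fun η => η v) h
  simp only [AlternatingMap.alternatizeUncurryFin_alternatizeUncurryFinLM_comp_apply] at h'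
  refine h'.trans (Finset.sum_congr rfl fun i _ => Finset.sum_congr rfl fun j _ => ?_)
  rw [zsmul_eq_mul]
  simp

/-- Antisymmetrization kills symmetric bilinear maps. This is how second derivatives drop out
everywhere below, both in d² = 0 and in the appearance of the bracket. -/
theorem wedge_wedge_eq_zero {n : ℕ} {N : E →ₗ[K] E →ₗ[K] Form K E n}
    (hN : ∀ v w, N v w = N w v) : wedge (wedge ∘ₗ N) = 0 := by
  ext v
  rw [wedge_wedge_apply]
  refine Finset.sum_eq_zero fun i _ => Finset.sum_eq_zero fun j _ => ?_
  rw [hN (v i.castSucc), sub_self, mul_zero]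

theorem wedge_wedge_flip {n : ℕ} (N : E →ₗ[K] E →ₗ[K] Form K E n) :
    wedge (wedge ∘ₗ N.flip) = -wedge (wedge ∘ₗ N) := by
  have h := wedge_wedge_eq_zero (N := N + N.flip) fun v w => by simp [add_comm]
  rw [LinearMap.comp_add, LinearMap.map_add] at h
  exact eq_neg_of_add_eq_zero_right h

/-- Currying the first argument of a form. -/
def curryForm {n : ℕ} : Form K E (n + 1) →ₗ[K] E →ₗ[K] Form K E n where
  toFun η := η.curryLeft.toLinearMap
  map_add' _ _ := rfl
  map_smul' _ _ := rfl

@[simp] theorem curryForm_apply {n : ℕ} (η : Form K E (n + 1)) (u : E) (v : Fin n → E) :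
    curryForm η u v = η (Fin.cons u v) := rfl

theorem wedge_curryForm {n : ℕ} (η : Form K E (n + 1)) :
    wedge (curryForm η) = (n + 1 : K) • η := by
  have h := ContinuousAlternatingMap.alternatizeUncurryFin_curryLeft η
  rw [← wedge_coe] at h
  refine h.trans ?_
  rw [← Nat.cast_smul_eq_nsmul K]
  simp

/-- Contraction is an antiderivation. This is the algebra behind Cartan's formula and behind the
Leibniz rule for the Chevalley–Eilenberg differential. -/
theorem curryForm_wedge {n : ℕ} (L : E →ₗ[K] Form K E (n + 1)) (u : E) :
    curryForm (wedge L) u = L u - wedge ((curryForm.flip u) ∘ₗ L) := by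
  ext v
  rw [curryForm_apply, wedge_apply, Fin.sum_univ_succ]
  simp only [Fin.cons_zero, Fin.val_zero, pow_zero, one_mul, Fin.cons_succ, Fin.val_succ]
  rw [ContinuousAlternatingMap.sub_apply, wedge_apply, sub_eq_add_neg, ← Finset.sum_neg_distrib]
  congr 1
  refine Finset.sum_congr rfl fun i _ => ?_
  simp only [LinearMap.comp_apply, LinearMap.flip_apply, curryForm_apply]
  have : i.succ.removeNth (Fin.cons u v : Fin (n + 2) → E) = Fin.cons u (i.removeNth v) := by
    funext k
    refine Fin.cases ?_ (fun k => ?_) k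
    · simp [Fin.removeNth]
    · simp [Fin.removeNth]
  rw [this, pow_succ]
  ring

theorem curryForm_wedge_zero (L : E →ₗ[K] Form K E 0) (u : E) :
    curryForm (wedge L) u = L u := by
  ext v
  rw [curryForm_apply, wedge_apply, Fin.sum_univ_succ]
  simp [Subsingleton.elim (Fin.removeNth 0 (Fin.cons u v : Fin 1 → E)) v]

/-! ### The Chevalley–Eilenberg differential of a bracket -/

variable (br : E →ₗ[K] E →ₗ[K] E)

/-- The product of `L` with the differential of covectors defined by the bracket `br`. -/
def wedgeBracket {n : ℕ} (L : E →ₗ[K] Form K E n) : Form K E (n + 2) :=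
  -- For antisymmetric `br` the double wedge produces every term twice; the factor 1/2 and the sign
  -- give the convention dω(x, y) = -ω([x, y]).
  -((1 / 2 : K) • wedge (wedge ∘ₗ br.compr₂ L))

theorem wedgeBracket_add {n : ℕ} (L L' : E →ₗ[K] Form K E n) :
    wedgeBracket br (L + L') = wedgeBracket br L + wedgeBracket br L' := by
  have : br.compr₂ (L + L') = br.compr₂ L + br.compr₂ L' := by ext; simp
  simp only [wedgeBracket]
  rw [this, LinearMap.comp_add, map_add, smul_add, neg_add]

theorem wedgeBracket_smul {n : ℕ} (a : K) (L : E →ₗ[K] Form K E n) :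
    wedgeBracket br (a • L) = a • wedgeBracket br L := by
  have : br.compr₂ (a • L) = a • br.compr₂ L := by ext; simp
  simp only [wedgeBracket]
  rw [this, LinearMap.comp_smul, map_smul, smul_neg, smul_comm a]

/-- The Chevalley–Eilenberg differential of the bracket `br`. -/
def ceDifferential : (n : ℕ) → Form K E n →ₗ[K] Form K E (n + 1)
  | 0 => 0
  | _ + 1 =>
    { toFun := fun η => wedgeBracket br (curryForm η)
      map_add' := fun η η' => by rw [map_add, wedgeBracket_add]
      map_smul' := fun a η => by rw [map_smul, wedgeBracket_smul, RingHom.id_apply] }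

theorem ceDifferential_succ {n : ℕ} (η : Form K E (n + 1)) :
    ceDifferential br (n + 1) η = wedgeBracket br (curryForm η) := rfl

/-- A cyclic rotation of three covectors is a product of two transpositions, each costing a sign by
`wedge_wedge_flip`. -/
theorem wedge_wedge_wedge_rotate {n : ℕ} (A : E →ₗ[K] E →ₗ[K] E →ₗ[K] Form K E n) :
    wedge (wedge ∘ₗ (A.compr₂ wedge)) =
      wedge (wedge ∘ₗ (((LinearMap.lflip (R₀ := K)).toLinearMap ∘ₗ A.flip).compr₂ wedge)) := by
  have h₁ : A.flip.compr₂ wedge = (A.compr₂ wedge).flip := by ext; rfl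
  have h₂ : wedge ∘ₗ (((LinearMap.lflip (R₀ := K)).toLinearMap ∘ₗ A.flip).compr₂ wedge) =
      -(wedge ∘ₗ A.flip.compr₂ wedge) := by
    ext u : 1
    exact wedge_wedge_flip (A.flip u)
  rw [h₂, h₁, wedge_neg, wedge_wedge_flip, neg_neg]

/-- Leibniz rule d(e ∧ η) = de ∧ η - e ∧ dη, summed over a basis. Degree zero is separate because a
form of degree zero has no argument to contract. -/
theorem ceDifferential_wedge : {n : ℕ} → (L : E →ₗ[K] Form K E n) →
    ceDifferential br (n + 1) (wedge L) = wedgeBracket br L - wedge (ceDifferential br n ∘ₗ L)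
  | 0, L => by
    rw [ceDifferential_succ]
    have h₁ : curryForm (wedge L) = L := by
      ext u : 1
      exact curryForm_wedge_zero L u
    have h₂ : ceDifferential br 0 ∘ₗ L = 0 := by
      ext u : 1
      rfl
    rw [h₁, h₂, map_zero, sub_zero]
  | n + 1, L => by
    rw [ceDifferential_succ]
    -- `A v w u = ι_{[v, w]} (L u)`
    let A : E →ₗ[K] E →ₗ[K] E →ₗ[K] Form K E n := br.compr₂ ((curryForm ∘ₗ L).flip)
    have h₁ : wedge ∘ₗ br.compr₂ (curryForm (wedge L)) =
        wedge ∘ₗ br.compr₂ L - wedge ∘ₗ A.compr₂ wedge := by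
      ext v : 1
      rw [LinearMap.sub_apply, LinearMap.comp_apply, LinearMap.comp_apply, LinearMap.comp_apply,
        ← map_sub]
      congr 1
      ext w : 1
      exact curryForm_wedge L (br v w)
    -- Two rotations carry the covector slot of L from the last place of A to the first, past the
    -- two slots of the bracket.
    have h₂ : wedge (ceDifferential br (n + 1) ∘ₗ L) =
        -((1 / 2 : K) • wedge (wedge ∘ₗ (A.compr₂ wedge))) := by
      rw [wedge_wedge_wedge_rotate, wedge_wedge_wedge_rotate, ← map_smul, ← map_neg]
      congr 1
    rw [h₂, wedgeBracket, wedgeBracket, h₁, wedge_sub, smul_sub]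
    abel

/-- Forms of equal degrees. -/
def castForm {a b : ℕ} (h : a = b) : Form K E a →ₗ[K] Form K E b where
  toFun η := h ▸ η
  map_add' η η' := by subst h; rfl
  map_smul' r η := by subst h; rfl

@[simp] theorem castForm_rfl {a : ℕ} (h : a = a) (η : Form K E a) : castForm h η = η := rfl

theorem wedge_castForm {a b : ℕ} (h : a = b) (L : E →ₗ[K] Form K E a) :
    wedge (castForm h ∘ₗ L) = castForm (by rw [h]) (wedge L) := by subst h; rfl

theorem ceDifferential_castForm {a b : ℕ} (h : a = b) (η : Form K E a) :
    ceDifferential br b (castForm h η) = castForm (by rw [h]) (ceDifferential br a η) := by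
  subst h; rfl

end Forms

/-! ### The Euler operator on germs of analytic functions -/

section Euler

open Filter Topology FormalMultilinearSeries
open scoped ENNReal NNReal

variable {K : Type*} [NontriviallyNormedField K]
  {Z : Type*} [NormedAddCommGroup Z] [NormedSpace K Z]
  {A : Type*} [NormedAddCommGroup A] [NormedSpace K A]

/-- Since n + 1 ≤ 2^n, shrinking a radius r to r/(2M) absorbs both the linear and the exponential
loss. -/
theorem radius_pos_of_norm_le {p q : FormalMultilinearSeries K Z A} {C M : ℝ} (hC : 0 ≤ C)
    (hM : 1 ≤ M) (h : ∀ n, ‖q n‖ ≤ C * (n + 1) * M ^ n * ‖p n‖) (hp : 0 < p.radius) :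
    0 < q.radius := by
  obtain ⟨r, hr0, hr⟩ := ENNReal.lt_iff_exists_nnreal_btwn.1 hp
  obtain ⟨B, hB0, hB⟩ := p.norm_mul_pow_le_of_lt_radius hr
  have hr0' : (0 : ℝ) < r := by exact_mod_cast hr0
  have hM0 : 0 < M := lt_of_lt_of_le one_pos hM
  let r' : ℝ≥0 := ⟨r / (2 * M), by positivity⟩
  have hr' : 0 < r' := by
    rw [← NNReal.coe_pos]
    change (0 : ℝ) < r / (2 * M)
    positivity
  refine lt_of_lt_of_le (ENNReal.coe_pos.2 hr') (q.le_radius_of_bound (C * B) fun n => ?_)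
  have hn : ((n : ℝ) + 1) ≤ 2 ^ n := by
    have := one_add_mul_le_pow (a := (1 : ℝ)) (by norm_num) n
    norm_num at this
    linarith
  change ‖q n‖ * (r / (2 * M)) ^ n ≤ _
  calc ‖q n‖ * (r / (2 * M)) ^ n ≤ (C * (n + 1) * M ^ n * ‖p n‖) * (r / (2 * M)) ^ n := by
        gcongr; exact h n
    _ = C * ((n + 1) / 2 ^ n) * (‖p n‖ * r ^ n) := by
        rw [div_pow, mul_pow]; field_simp
    _ ≤ C * 1 * B := by
        gcongr
        · rw [div_le_one (by positivity)]; exact hn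
        · exact hB n
    _ = C * B := by ring

/-- The coefficient is defined as a sum over n-element subsets of 1 + n slots; such a subset is
determined by the single slot it misses, which receives v. -/
theorem derivSeries_apply_const (q : FormalMultilinearSeries K Z A) (n : ℕ) (y v : Z) :
    q.derivSeries n (fun _ => y) v =
      ∑ i : Fin (1 + n), q (1 + n) (Function.update (fun _ => y) i v) := by
  have h : q.derivSeries n (fun _ => y) v = ∑ s : {s : Finset (Fin (1 + n)) // s.card = n},
      q (1 + n) (s.1.piecewise (fun _ => y) fun _ => v) := by
    simp only [derivSeries, ContinuousLinearMap.compFormalMultilinearSeries_apply,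
      changeOriginSeries, ContinuousLinearMap.compContinuousMultilinearMap_coe,
      ContinuousLinearEquiv.coe_coe, LinearIsometryEquiv.coe_coe,
      Function.comp_apply, map_sum, _root_.sum_apply, continuousMultilinearCurryFin1_apply]
    refine Finset.sum_congr rfl fun s _ => ?_
    rw [Fin.snoc_zero, changeOriginSeriesTerm_apply]
  rw [h]
  symm
  refine Fintype.sum_bijective
    (fun i : Fin (1 + n) => (⟨Finset.univ.erase i, by simp⟩ :
      {s : Finset (Fin (1 + n)) // s.card = n})) ⟨fun i j hij => ?_, fun s => ?_⟩ _ _ fun i => ?_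
  · have := congrArg Subtype.val hij
    by_contra hne
    have hmem : i ∈ Finset.univ.erase j := by simp [hne]
    simp only at this
    rw [← this] at hmem
    simp at hmem
  · obtain ⟨s, hs⟩ := s
    have : sᶜ.card = 1 := by rw [Finset.card_compl, hs, Fintype.card_fin]; omega
    obtain ⟨i, hi⟩ := Finset.card_eq_one.1 this
    refine ⟨i, Subtype.ext ?_⟩
    change Finset.univ.erase i = s
    rw [← compl_compl s, hi, Finset.compl_eq_univ_sdiff, Finset.sdiff_singleton_eq_erase]
  · congr 1
    funext l
    by_cases hl : l = i
    · subst hl; simp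
    · simp [Finset.piecewise, hl]

variable (P : Z →L[K] Z)

/-- The series whose part of degree `j` in the image of the projector `P` is multiplied by
`w j`. -/
def weightedSeries (w : ℕ → K) (p : FormalMultilinearSeries K Z A) :
    FormalMultilinearSeries K Z A := fun n =>
  ∑ S : Finset (Fin n), w S.card • (p n).compContinuousLinearMap
    fun i => if i ∈ S then P else ContinuousLinearMap.id K Z - P

theorem weightedSeries_apply (w : ℕ → K) (p : FormalMultilinearSeries K Z A) (n : ℕ)
    (y : Fin n → Z) : weightedSeries P w p n y =
      ∑ S : Finset (Fin n), w S.card • p n fun i => if i ∈ S then P (y i) else y i - P (y i) := by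
  rw [weightedSeries, sum_apply]
  refine Finset.sum_congr rfl fun S _ => ?_
  rw [_root_.smul_apply, ContinuousMultilinearMap.compContinuousLinearMap_apply]
  congr 2
  funext i
  split_ifs <;> simp

/-- The n-th term splits into 2^n pieces, each bounded by the norm of p n times M^n and a linearly
growing weight; hence the constant 2M. -/
theorem weightedSeries_radius_pos {w : ℕ → K} {C : ℝ} (hC : 0 ≤ C)
    (hw : ∀ j, ‖w j‖ ≤ C * (j + 1)) {p : FormalMultilinearSeries K Z A} (hp : 0 < p.radius) :
    0 < (weightedSeries P w p).radius := by
  let M := 1 + ‖P‖ + ‖ContinuousLinearMap.id K Z - P‖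
  have hM : 1 ≤ M := by
    have := norm_nonneg P; have := norm_nonneg (ContinuousLinearMap.id K Z - P)
    simp only [M]; linarith
  refine radius_pos_of_norm_le (M := 2 * M) hC (by linarith) (fun n => ?_) hp
  calc ‖weightedSeries P w p n‖ ≤ ∑ S : Finset (Fin n), C * (n + 1) * (‖p n‖ * M ^ n) := by
        refine norm_sum_le_of_le _ fun S _ => ?_
        rw [norm_smul]
        refine mul_le_mul ((hw _).trans ?_) ?_ (norm_nonneg _) (by positivity)
        · gcongr
          exact_mod_cast (Finset.card_le_univ S).trans (by simp)
        · refine (ContinuousMultilinearMap.norm_compContinuousLinearMap_le _ _).trans ?_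
          gcongr
          refine (Finset.prod_le_prod (fun i _ => norm_nonneg _)
            (g := fun _ => M) fun i _ => ?_).trans (by simp)
          have := norm_nonneg P; have := norm_nonneg (ContinuousLinearMap.id K Z - P)
          split_ifs <;> simp only [M] <;> linarith
    _ = C * (n + 1) * (2 * M) ^ n * ‖p n‖ := by
        rw [Finset.sum_const, Finset.card_univ, Fintype.card_finset, Fintype.card_fin,
          nsmul_eq_mul, mul_pow]
        push_cast
        ring

/-- Differentiation along P y on the piece indexed by S: putting P y into slot i reproduces the
piece if i ∈ S and kills it otherwise, because P y - P (P y) = 0. The piece is therefore multiplied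
by the size of S. -/
theorem sum_update_weighted (hP : P ∘L P = P) {n : ℕ} (f : ContinuousMultilinearMap K
    (fun _ : Fin n => Z) A) (w : ℕ → K) (y : Z) :
    ∑ i : Fin n, ∑ S : Finset (Fin n), w S.card • f (fun l => if l ∈ S then
      P (Function.update (fun _ => y) i (P y) l) else
        Function.update (fun _ => y) i (P y) l - P (Function.update (fun _ => y) i (P y) l)) =
    ∑ S : Finset (Fin n), (S.card * w S.card) • f (fun l => if l ∈ S then P y else y - P y) := by
  have hPP : P (P y) = P y := congrArg (fun T : Z →L[K] Z => T y) hP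
  rw [Finset.sum_comm]
  refine Finset.sum_congr rfl fun S _ => ?_
  have h : ∀ i, w S.card • f (fun l => if l ∈ S then
      P (Function.update (fun _ => y) i (P y) l) else
        Function.update (fun _ => y) i (P y) l - P (Function.update (fun _ => y) i (P y) l)) =
      if i ∈ S then w S.card • f (fun l => if l ∈ S then P y else y - P y) else 0 := by
    intro i
    by_cases hi : i ∈ S
    · rw [if_pos hi]
      congr 2
      funext l
      by_cases hl : l = i
      · subst hl; simp [hi, hPP]
      · simp [hl]
    · rw [if_neg hi, f.map_coord_zero i, smul_zero]
      simp [hi, hPP]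
  simp only [h, Finset.sum_ite_mem, Finset.univ_inter, Finset.sum_const]
  rw [← Nat.cast_smul_eq_nsmul K, smul_smul]

variable (K) in
/-- The inverses of integers grow at most linearly. -/
def InvNatBounded : Prop := ∀ n : ℕ, n ≠ 0 → (n : K) ≠ 0 ∧ ‖(n : K)⁻¹‖ ≤ n

variable [CompleteSpace A]

/-- The Euler operator `G ↦ D_{P(z - z₀)} G + k G`, `k ≥ 1`, is surjective on germs. -/
theorem exists_euler_eq (hK : InvNatBounded K) (hP : P ∘L P = P) {α : Z → A} {z₀ : Z}
    (hα : AnalyticAt K α z₀) {k : ℕ} (hk : k ≠ 0) :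
    ∃ G : Z → A, AnalyticAt K G z₀ ∧
      ∀ᶠ z in 𝓝 z₀, fderiv K G z (P (z - z₀)) + (k : K) • G z = α z := by
  obtain ⟨p, r, hp⟩ := hα
  -- The operator multiplies the piece of degree j in the P-direction by j + k, so its inverse
  -- divides by j + k.
  let w : ℕ → K := fun j => ((j + k : ℕ) : K)⁻¹
  have hw : ∀ j, ‖w j‖ ≤ k * (j + 1) := by
    intro j
    refine (hK (j + k) (by omega)).2.trans ?_
    have : (1 : ℝ) ≤ k := by exact_mod_cast Nat.one_le_iff_ne_zero.2 hk
    push_cast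
    nlinarith [(Nat.cast_nonneg j : (0 : ℝ) ≤ j)]
  have hrad := weightedSeries_radius_pos P (Nat.cast_nonneg k) hw (hp.r_pos.trans_le hp.r_le)
  set q := weightedSeries P w p with hq
  let G : Z → A := fun z => q.sum (z - z₀)
  have hG : HasFPowerSeriesOnBall G q z₀ q.radius := by
    have := (q.hasFPowerSeriesOnBall hrad).comp_sub z₀
    rwa [zero_add] at this
  refine ⟨G, hG.analyticAt, ?_⟩
  filter_upwards [Metric.eball_mem_nhds z₀ hp.r_pos, Metric.eball_mem_nhds z₀ hrad] with z hz₁ hz₂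
  have hy₁ : z - z₀ ∈ Metric.eball (0 : Z) r := by
    simpa [Metric.mem_eball, edist_eq_enorm_sub] using hz₁
  have hy₂ : z - z₀ ∈ Metric.eball (0 : Z) q.radius := by
    simpa [Metric.mem_eball, edist_eq_enorm_sub] using hz₂
  set y := z - z₀ with hy
  have hz : z₀ + y = z := by simp [hy]
  have h₁ := hp.hasSum hy₁
  have h₂ := hG.hasSum hy₂
  have h₃ := (hG.fderiv.hasSum hy₂).mapL (ContinuousLinearMap.apply K A (P y))
  rw [hz] at h₁ h₂ h₃
  let a : ℕ → A := fun n => ∑ S : Finset (Fin n), ((S.card : K) * w S.card) •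
    p n (fun l => if l ∈ S then P y else y - P y)
  have ha : ∀ n, (ContinuousLinearMap.apply K A (P y)) (q.derivSeries n fun _ => y) = a (n + 1) := by
    intro n
    rw [add_comm n 1, ContinuousLinearMap.apply_apply, derivSeries_apply_const]
    simp only [hq, weightedSeries_apply]
    exact sum_update_weighted P hP (p (1 + n)) w y
  simp only [ha] at h₃
  -- The derivative series starts in degree one; the missing term of degree zero has weight zero, so
  -- the index can be shifted back.
  have ha0 : a 0 = 0 := Finset.sum_eq_zero fun S _ => by
    rw [Finset.eq_empty_of_isEmpty S]; simp
  have h₄ : HasSum a (fderiv K G z (P y)) := by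
    have := (hasSum_nat_add_iff 1).1 h₃
    simpa [ha0] using this
  have h₅ := h₄.add (h₂.const_smul (k : K))
  refine h₅.unique ?_
  convert h₁ using 2 with n
  have hsum : p n (fun _ => y) = ∑ S : Finset (Fin n), p n
      (fun l => if l ∈ S then P y else y - P y) := by
    have := (p n).map_add_univ (fun _ => P y) (fun _ => y - P y)
    simp only [Pi.add_def, add_sub_cancel] at this
    rw [this]
    refine Finset.sum_congr rfl fun S _ => ?_
    congr 1
  rw [hsum, hq, weightedSeries_apply, Finset.smul_sum]
  simp only [a]
  rw [← Finset.sum_add_distrib]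
  refine Finset.sum_congr rfl fun S _ => ?_
  rw [smul_smul, ← add_smul, ← add_mul]
  have := (hK (S.card + k) (by omega)).1
  simp only [w]
  push_cast at this ⊢
  rw [mul_inv_cancel₀ this, one_smul]

/-- The Euler operator `G ↦ D_{P(z - z₀)} G + k G` is injective on germs for `k ≥ 1`, and its
kernel for `k = 0` consists of the germs which are constant in the direction of the image
of `P`. -/
theorem eventually_of_euler_eq_zero (hK : InvNatBounded K) (hP : P ∘L P = P) {γ : Z → A} {z₀ : Z}
    (hγ : AnalyticAt K γ z₀) {k : ℕ}
    (h : ∀ᶠ z in 𝓝 z₀, fderiv K γ z (P (z - z₀)) + (k : K) • γ z = 0) :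
    ∀ᶠ z in 𝓝 z₀, (k ≠ 0 → γ z = 0) ∧ (k = 0 → γ z = γ (z - P (z - z₀))) := by
  have hPP : ∀ y, P (P y) = P y := fun y => congrArg (fun T : Z →L[K] Z => T y) hP
  obtain ⟨p, r, hp⟩ := hγ
  obtain ⟨δ, hδ, hδh⟩ := Metric.eventually_nhds_iff_ball.1 h
  obtain ⟨ε, hε0, hε⟩ := ENNReal.lt_iff_exists_nnreal_btwn.1
    (lt_min hp.r_pos (ENNReal.ofReal_pos.2 hδ))
  have hεδ : (ε : ℝ) < δ := by
    have := hε.trans_le (min_le_right _ _)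
    rwa [← ENNReal.ofReal_coe_nnreal, ENNReal.ofReal_lt_ofReal_iff hδ] at this
  have hε0' : (0 : ℝ) < ε := by exact_mod_cast hε0
  replace hp := hp.mono hε0 (hε.le.trans (min_le_left _ _))
  let M := 1 + ‖P‖ + ‖ContinuousLinearMap.id K Z - P‖
  have hM1 : ‖P‖ ≤ M := by
    have := norm_nonneg (ContinuousLinearMap.id K Z - P); simp only [M]; linarith
  have hM2 : ‖ContinuousLinearMap.id K Z - P‖ ≤ M := by
    have := norm_nonneg P; simp only [M]; linarith
  have hM0 : 1 ≤ M := by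
    have := norm_nonneg P; have := norm_nonneg (ContinuousLinearMap.id K Z - P)
    simp only [M]; linarith
  have hbound : ∀ y : Z, ‖y‖ < ε / (2 * M) → ‖P y‖ < ε / 2 ∧ ‖y - P y‖ < ε / 2 := by
    intro y hy
    have h3 : M * ‖y‖ < ε / 2 := by
      calc M * ‖y‖ < M * (ε / (2 * M)) := by gcongr
        _ = ε / 2 := by field_simp
    refine ⟨((P.le_opNorm y).trans ?_).trans_lt h3,
      (((ContinuousLinearMap.id K Z - P).le_opNorm y).trans ?_).trans_lt h3⟩ <;> gcongr
  have hεM : 0 < ε / (2 * M) := by positivity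
  filter_upwards [Metric.ball_mem_nhds z₀ hεM] with z hz
  rw [mem_ball_iff_norm] at hz
  set y := z - z₀ with hy
  have hyP := hbound y hz
  -- The point b is the projection of z to the slice P(b - z₀) = 0. Expanding γ at b turns the
  -- equation into one about a power series along the leaf b + im P.
  set b := z - P y with hb
  have hby : z₀ + (y - P y) = b := by rw [hb, hy]; abel
  have hbε : (‖y - P y‖₊ : ℝ≥0∞) < ε := by
    rw [ENNReal.coe_lt_coe, ← NNReal.coe_lt_coe, coe_nnnorm]
    linarith [hyP.2]
  have hp' := hp.changeOrigin hbε
  rw [hby] at hp'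
  set p' := p.changeOrigin (y - P y)
  have hrad : ∀ u : Z, ‖u‖ < ε / 2 → u ∈ Metric.eball (0 : Z) (ε - ‖y - P y‖₊) := by
    intro u hu
    rw [Metric.mem_eball, edist_zero_right, lt_tsub_iff_right, enorm_eq_nnnorm, ← ENNReal.coe_add,
      ENNReal.coe_lt_coe, ← NNReal.coe_lt_coe]
    push_cast
    linarith [hyP.2]
  -- On the leaf the operator multiplies the n-th term by n + k. The resulting series sums to zero
  -- near 0, so its terms vanish; dividing by n + k leaves only the possible term n = k = 0.
  let Q : FormalMultilinearSeries K Z A := fun n =>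
    ((n + k : ℕ) : K) • (p' n).compContinuousLinearMap fun _ => P
  have hQ : 0 < Q.radius := by
    refine radius_pos_of_norm_le (C := (k + 1) * ‖(1 : K)‖) (M := M) (by positivity) hM0
      (fun n => ?_) (hp'.r_pos.trans_le hp'.r_le)
    rw [norm_smul]
    calc ‖((n + k : ℕ) : K)‖ * ‖(p' n).compContinuousLinearMap fun _ => P‖
        ≤ ((n + k : ℕ) * ‖(1 : K)‖) * (‖p' n‖ * M ^ n) := by
          gcongr
          · exact Nat.norm_cast_le _
          · refine (ContinuousMultilinearMap.norm_compContinuousLinearMap_le _ _).trans ?_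
            gcongr
            rw [Finset.prod_const, Finset.card_univ, Fintype.card_fin]
            gcongr
      _ ≤ ((k + 1) * (n + 1)) * ‖(1 : K)‖ * (‖p' n‖ * M ^ n) := by
          gcongr
          push_cast
          nlinarith [(Nat.cast_nonneg n : (0 : ℝ) ≤ n), (Nat.cast_nonneg k : (0 : ℝ) ≤ k)]
      _ = _ := by ring
  have hQs : ∀ y' : Z, ‖y'‖ < ε / (2 * M) → HasSum (fun n => Q n fun _ => y') 0 := by
    intro y' hy'
    have hu := hrad _ (hbound y' hy').1
    set u := P y' with hu'
    have h₁ := hp'.hasSum hu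
    have h₂ := (hp'.fderiv.hasSum hu).mapL (ContinuousLinearMap.apply K A u)
    simp only [ContinuousLinearMap.apply_apply, derivSeries_apply_diag] at h₂
    have h₃ : HasSum (fun n : ℕ => n • p' n fun _ => u) (fderiv K γ (b + u) u) := by
      have := (hasSum_nat_add_iff (f := fun n : ℕ => n • p' n fun _ => u) 1).1 h₂
      simpa using this
    have h₄ := h₃.add (h₁.const_smul (k : K))
    have hzu : b + u - z₀ = (y - P y) + u := by rw [hb, hy]; abel
    have hz' : b + u ∈ Metric.ball z₀ δ := by
      rw [mem_ball_iff_norm, hzu]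
      refine (norm_add_le _ _).trans_lt ?_
      linarith [hyP.2, (hbound y' hy').1]
    have h₅ := hδh _ hz'
    rw [hzu] at h₅
    have h₆ : P (y - P y + u) = u := by rw [map_add, map_sub, hPP, sub_self, zero_add, hu', hPP]
    rw [h₆] at h₅
    rw [h₅] at h₄
    convert h₄ using 2 with n
    simp only [Q]
    rw [_root_.smul_apply, ContinuousMultilinearMap.compContinuousLinearMap_apply,
      ← Nat.cast_smul_eq_nsmul K, ← add_smul]
    push_cast
    rfl
  have hQ0 : HasFPowerSeriesAt (0 : Z → A) Q 0 := by
    refine ⟨min Q.radius (ENNReal.ofReal (ε / (2 * M))), min_le_left _ _,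
      lt_min hQ (ENNReal.ofReal_pos.2 hεM), fun {y'} hy' => ?_⟩
    refine hQs y' ?_
    have := lt_of_lt_of_le (Metric.mem_eball.1 hy') (min_le_right _ _)
    rwa [edist_zero_right, ← ofReal_norm, ENNReal.ofReal_lt_ofReal_iff hεM] at this
  have hz0 : ∀ n : ℕ, n + k ≠ 0 → (p' n fun _ => P y) = 0 := by
    intro n hn
    have h₁ := hQ0.apply_eq_zero n y
    simp only [Q] at h₁
    rw [_root_.smul_apply, ContinuousMultilinearMap.compContinuousLinearMap_apply,
      smul_eq_zero] at h₁
    exact h₁.resolve_left (hK _ hn).1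
  have hsum := hp'.hasSum (hrad _ hyP.1)
  have hbz : b + P y = z := by rw [hb]; abel
  rw [hbz] at hsum
  constructor
  · intro hk
    refine hsum.unique ?_
    convert hasSum_zero with n
    exact hz0 n (by omega)
  · intro hk
    refine hsum.unique ?_
    have := hasSum_single (f := fun n => p' n fun _ => P y) 0 fun n hn => hz0 n (by omega)
    convert this using 1
    exact (hp'.coeff_zero _).symm

end Euler

/-! ### The Poincaré lemma with parameters -/

section Poincare

open Filter Topology

variable {K : Type*} [NontriviallyNormedField K] [CompleteSpace K]
  {E : Type*} [NormedAddCommGroup E] [NormedSpace K E] [FiniteDimensional K E]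
  {Z : Type*} [NormedAddCommGroup Z] [NormedSpace K Z]
  {A : Type*} [NormedAddCommGroup A] [NormedSpace K A]
  {B : Type*} [NormedAddCommGroup B] [NormedSpace K B]

theorem analyticAt_clm_apply [CompleteSpace A] [CompleteSpace B] {f : Z → A →L[K] B} {g : Z → A}
    {z : Z} (hf : AnalyticAt K f z) (hg : AnalyticAt K g z) :
    AnalyticAt K (fun y => f y (g y)) z :=
  (ContinuousLinearMap.analyticAt_bilinear (ContinuousLinearMap.id K (A →L[K] B))
    (f z, g z)).comp₂ hf hg

theorem isSymmSndFDerivAt_of_analyticAt [CompleteSpace A] {f : Z → A} {z : Z}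
    (hf : AnalyticAt K f z) : IsSymmSndFDerivAt K f z :=
  (hf.contDiffAt (n := ω)).isSymmSndFDerivAt le_top

/-- The exterior derivative in the direction of the image of `j`. -/
def relExtDeriv (j : E →L[K] Z) {q : ℕ} (F : Z → Form K E q) (z : Z) : Form K E (q + 1) :=
  ContinuousAlternatingMap.alternatizeUncurryFin (fderiv K F z ∘L j)

theorem relExtDeriv_congr (j : E →L[K] Z) {q : ℕ} {F F' : Z → Form K E q} {z : Z}
    (h : F =ᶠ[𝓝 z] F') : relExtDeriv j F z = relExtDeriv j F' z := by
  rw [relExtDeriv, relExtDeriv, h.fderiv_eq]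

/-- The map `T ↦ ∑ eᵢ* ∧ T (j eᵢ)`. -/
def altPrecomp (j : E →L[K] Z) (q : ℕ) : (Z →L[K] Form K E q) →L[K] Form K E (q + 1) :=
  (ContinuousAlternatingMap.alternatizeUncurryFinCLM K E K) ∘L
    ((ContinuousLinearMap.compL K E Z (Form K E q)).flip j)

theorem relExtDeriv_eq_altPrecomp (j : E →L[K] Z) {q : ℕ} (F : Z → Form K E q) :
    relExtDeriv j F = fun z => altPrecomp j q (fderiv K F z) := rfl

theorem analyticAt_relExtDeriv (j : E →L[K] Z) {q : ℕ} {F : Z → Form K E q} {z : Z}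
    (hF : AnalyticAt K F z) : AnalyticAt K (relExtDeriv j F) z := by
  rw [relExtDeriv_eq_altPrecomp]
  exact (altPrecomp j q).analyticAt (fderiv K F z) |>.comp hF.fderiv

/-- Symmetry of the second derivative lets d pass through the directional derivative; the extra
summand comes from differentiating y ↦ P(y - z₀), as P fixes the image of j. It raises the constant
of the Euler operator by one along with the degree of the form. -/
theorem relExtDeriv_fderiv_apply (j : E →L[K] Z) (P : Z →L[K] Z) (hj : ∀ e, P (j e) = j e)
    {q : ℕ} {F : Z → Form K E q} {z z₀ : Z} (hF : AnalyticAt K F z) :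
    relExtDeriv j (fun y => fderiv K F y (P (y - z₀))) z =
      fderiv K (relExtDeriv j F) z (P (z - z₀)) + relExtDeriv j F z := by
  have h₀ : HasFDerivAt (fun y : Z => P (y - z₀)) P z :=
    P.hasFDerivAt.comp z ((hasFDerivAt_id z).sub_const z₀)
  have h' : HasFDerivAt (fderiv K F) (fderiv K (fderiv K F) z) z :=
    hF.fderiv.differentiableAt.hasFDerivAt
  have h₁ := h'.clm_apply h₀
  have h₂ : HasFDerivAt (fun y => altPrecomp j q (fderiv K F y))
      (altPrecomp j q ∘L fderiv K (fderiv K F) z) z :=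
    (altPrecomp j q).hasFDerivAt.comp z h'
  rw [relExtDeriv, h₁.fderiv, relExtDeriv_eq_altPrecomp, h₂.fderiv,
    ContinuousLinearMap.comp_apply, ← map_add]
  change ContinuousAlternatingMap.alternatizeUncurryFin _ =
    ContinuousAlternatingMap.alternatizeUncurryFin _
  congr 1
  ext e : 1
  have hs := (isSymmSndFDerivAt_of_analyticAt hF).eq (j e) (P (z - z₀))
  change fderiv K F z (P (j e)) + fderiv K (fderiv K F) z (j e) (P (z - z₀)) =
    fderiv K (fderiv K F) z (P (z - z₀)) (j e) + fderiv K F z (j e)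
  rw [hs, hj]
  exact add_comm _ _

/-- Cartan's formula for the Euler field X = ρ(y - z₀): on a closed form the Lie derivative is d
ι_X, and on forms of degree q + 1 it equals D_X + (q + 1). -/
theorem relExtDeriv_curryLeft (j : E →L[K] Z) (ρ : Z →L[K] E) (hρ : ∀ e, ρ (j e) = e)
    {q : ℕ} {G : Z → Form K E (q + 1)} {z z₀ : Z} (hG : AnalyticAt K G z)
    (hd : relExtDeriv j G z = 0) :
    relExtDeriv j (fun y => (G y).curryLeft (ρ (y - z₀))) z =
      fderiv K G z (j (ρ (z - z₀))) + ((q + 1 : ℕ) : K) • G z := by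
  have h₀ : HasFDerivAt (fun y : Z => ρ (y - z₀)) ρ z :=
    ρ.hasFDerivAt.comp z ((hasFDerivAt_id z).sub_const z₀)
  let C : Form K E (q + 1) →L[K] E →L[K] Form K E q :=
    (ContinuousAlternatingMap.curryLeftLI (𝕜 := K) (E := E) (F := K) (n := q)).toContinuousLinearMap
  have h₁ := (C.hasFDerivAt.comp z hG.differentiableAt.hasFDerivAt).clm_apply h₀
  have h₂ : (fun y => (G y).curryLeft (ρ (y - z₀))) = fun y => (⇑C ∘ G) y (ρ (y - z₀)) := rfl
  rw [relExtDeriv, h₂, h₁.fderiv, ← wedge_coe]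
  let L : E →ₗ[K] Form K E (q + 1) := (fderiv K G z ∘L j : E →L[K] Form K E (q + 1))
  have hL : wedge L = 0 := by rw [wedge_coe]; exact hd
  have h₃ := curryForm_wedge L (ρ (z - z₀))
  rw [hL, map_zero, LinearMap.zero_apply, eq_comm, sub_eq_zero] at h₃
  have h₄ := wedge_curryForm (G z)
  have h₅ : ((((⇑C ∘ G) z ∘L ρ +
      (C ∘L fderiv K G z).flip (ρ (z - z₀))) ∘L j : E →L[K] Form K E q) : E →ₗ[K] Form K E q) =
      curryForm (G z) + (curryForm.flip (ρ (z - z₀))) ∘ₗ L := by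
    ext e : 1
    simp only [ContinuousLinearMap.coe_coe, ContinuousLinearMap.comp_apply,
      _root_.add_apply, hρ, LinearMap.add_apply, ContinuousLinearMap.flip_apply,
      LinearMap.comp_apply, LinearMap.flip_apply]
    rfl
  rw [h₅, map_add, h₄, ← h₃, Nat.cast_add, Nat.cast_one]
  exact add_comm _ _

/-- The Poincaré lemma with parameters, for germs of analytic forms. -/
theorem exists_relExtDeriv_eq (hK : InvNatBounded K) (j : E →L[K] Z) (ρ : Z →L[K] E)
    (hρ : ∀ e, ρ (j e) = e) {q : ℕ} {α : Z → Form K E (q + 1)} {z₀ : Z} (hα : AnalyticAt K α z₀)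
    (hd : ∀ᶠ z in 𝓝 z₀, relExtDeriv j α z = 0) :
    ∃ β : Z → Form K E q, AnalyticAt K β z₀ ∧ ∀ᶠ z in 𝓝 z₀, relExtDeriv j β z = α z := by
  let P := j ∘L ρ
  have hPj : ∀ e, P (j e) = j e := fun e => congrArg j (hρ e)
  have hP : P ∘L P = P := by ext z; exact hPj (ρ z)
  -- G solves L_X G = α for the Euler field X; the constant q + 1 is the degree of α.
  obtain ⟨G, hG, hGα⟩ := exists_euler_eq P hK hP hα (k := q + 1) (by omega)
  -- Applying d gives L_X(dG) = dα = 0 with constant q + 2, and this operator is injective on germs.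
  have hclosed : ∀ᶠ z in 𝓝 z₀, relExtDeriv j G z = 0 := by
    have h := eventually_of_euler_eq_zero P hK hP (analyticAt_relExtDeriv j hG) (k := q + 2) (by
      filter_upwards [hG.eventually_analyticAt, hGα.eventually_nhds, hd] with z h₁ h₂ h₃
      have h₄ : relExtDeriv j (fun y => fderiv K G y (P (y - z₀)) + ((q + 1 : ℕ) : K) • G y) z =
          0 := (relExtDeriv_congr j h₂).trans h₃
      have h₅ : relExtDeriv j (fun y => fderiv K G y (P (y - z₀)) + ((q + 1 : ℕ) : K) • G y) z =
          relExtDeriv j (fun y => fderiv K G y (P (y - z₀))) z +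
            ((q + 1 : ℕ) : K) • relExtDeriv j G z := by
        have hd₁ : DifferentiableAt K (fun y => fderiv K G y (P (y - z₀))) z :=
          h₁.fderiv.differentiableAt.clm_apply
            (P.differentiableAt.comp z (differentiableAt_id.sub_const z₀))
        have hd₂ := hd₁.hasFDerivAt.add
          (h₁.differentiableAt.hasFDerivAt.const_smul ((q + 1 : ℕ) : K))
        simp only [relExtDeriv_eq_altPrecomp]
        rw [← map_smul, ← map_add]
        exact congrArg _ hd₂.fderiv
      rw [h₅, relExtDeriv_fderiv_apply j P hPj h₁] at h₄
      rw [← h₄]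
      push_cast
      module)
    filter_upwards [h] with z hz
    exact hz.1 (by omega)
  let C : Form K E (q + 1) →L[K] E →L[K] Form K E q :=
    (ContinuousAlternatingMap.curryLeftLI (𝕜 := K) (E := E) (F := K) (n := q)).toContinuousLinearMap
  -- The primitive is ι_X G.
  refine ⟨fun y => (G y).curryLeft (ρ (y - z₀)), ?_, ?_⟩
  · have : CompleteSpace E := FiniteDimensional.complete K E
    exact analyticAt_clm_apply ((C.analyticAt _).comp hG)
      ((ρ.analyticAt _).comp (analyticAt_id.sub analyticAt_const))
  · filter_upwards [hG.eventually_analyticAt, hGα, hclosed] with z h₁ h₂ h₃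
    rw [relExtDeriv_curryLeft j ρ hρ h₁ h₃]
    exact h₂

/-- Germs which are constant in the direction of the image of `j`. -/
theorem eventually_eq_of_fderiv_comp_eq_zero [CompleteSpace A] (hK : InvNatBounded K)
    (j : E →L[K] Z) (ρ : Z →L[K] E)
    (hρ : ∀ e, ρ (j e) = e) {γ : Z → A} {z₀ : Z} (hγ : AnalyticAt K γ z₀)
    (hd : ∀ᶠ z in 𝓝 z₀, fderiv K γ z ∘L j = 0) :
    ∀ᶠ z in 𝓝 z₀, γ z = γ (z - j (ρ (z - z₀))) := by
  let P := j ∘L ρ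
  have hP : P ∘L P = P := by ext z; exact congrArg j (hρ (ρ z))
  have h := eventually_of_euler_eq_zero P hK hP hγ (k := 0) (by
    filter_upwards [hd] with z hz
    have := congrArg (fun T : E →L[K] A => T (ρ (z - z₀))) hz
    rw [Nat.cast_zero, zero_smul, add_zero]
    exact this)
  filter_upwards [h] with z hz
  exact hz.2 rfl

end Poincare

/-! ### Gluing on compact sets -/

section Gluing

open Filter Topology

/-- Local solutions of a local problem can be glued near a compact set, if every point has
arbitrarily small clopen neighbourhoods. -/
theorem IsCompact.exists_glue {Z A : Type*} [TopologicalSpace Z] [Nonempty A]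
    (hZ : ∀ z : Z, ∀ s ∈ 𝓝 z, ∃ t ⊆ s, IsClopen t ∧ z ∈ t) {W : Set Z} (hW : IsCompact W)
    {Q : (Z → A) → Z → Prop} (hQ : ∀ β β' z, β =ᶠ[𝓝 z] β' → Q β z → Q β' z)
    (hloc : ∀ z ∈ W, ∃ β, ∀ᶠ y in 𝓝 z, Q β y) : ∃ β, ∀ z ∈ W, Q β z := by
  have key : ∃ O : Set Z, IsClopen O ∧ W ⊆ O ∧ ∃ β, ∀ z ∈ O, Q β z := by
    refine hW.induction_on
      (p := fun S => ∃ O : Set Z, IsClopen O ∧ S ⊆ O ∧ ∃ β, ∀ z ∈ O, Q β z) ?_ ?_ ?_ ?_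
    · exact ⟨∅, isClopen_empty, subset_rfl, fun _ => Classical.arbitrary A, by simp⟩
    · rintro S T hST ⟨O, hO, hTO, β, hβ⟩
      exact ⟨O, hO, hST.trans hTO, β, hβ⟩
    · rintro S T ⟨O, hO, hSO, β, hβ⟩ ⟨O', hO', hTO, β', hβ'⟩
      classical
      refine ⟨O ∪ O', hO.union hO', Set.union_subset_union hSO hTO,
        -- Because O is clopen, the germ of this function at any point is that of β or of β', and
        -- the local property survives.
        fun z => if z ∈ O then β z else β' z, fun z hz => ?_⟩
      by_cases hzO : z ∈ O
      · refine hQ β _ z ?_ (hβ z hzO)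
        filter_upwards [hO.isOpen.mem_nhds hzO] with y hy
        rw [if_pos hy]
      · refine hQ β' _ z ?_ (hβ' z (hz.resolve_left hzO))
        filter_upwards [hO.compl.isOpen.mem_nhds hzO] with y hy
        rw [if_neg hy]
    · intro z hz
      obtain ⟨β, hβ⟩ := hloc z hz
      obtain ⟨t, hts, ht, hzt⟩ := hZ z _ hβ
      exact ⟨t, mem_nhdsWithin_of_mem_nhds (ht.isOpen.mem_nhds hzt), t, ht, subset_rfl, β,
        fun y hy => hts hy⟩
  obtain ⟨O, -, hWO, β, hβ⟩ := key
  exact ⟨β, fun z hz => hβ z (hWO hz)⟩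

end Gluing

/-! ### Groups with a global analytic chart -/

section Chart

open Filter Topology

variable (K : Type*) [NontriviallyNormedField K] [CompleteSpace K]
  (E : Type*) [NormedAddCommGroup E] [NormedSpace K E] [FiniteDimensional K E]
  (V : Type*) [TopologicalSpace V] [Group V]

/-- A chart defined on all of the group `V`, in which the group operations are analytic. -/
structure GroupChart where
  /-- The chart. -/
  c : V → E
  /-- The inverse of the chart, with arbitrary values outside its range. -/
  s : E → V
  isOpenEmbedding : IsOpenEmbedding c
  left_inv : ∀ x, s (c x) = x
  analyticAt_mul : ∀ a b, AnalyticAt K (fun z : E × E => c (s z.1 * s z.2)) (c a, c b)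
  analyticAt_inv : ∀ a, AnalyticAt K (fun z : E => c (s z)⁻¹) (c a)

variable {K E V}
variable {Z : Type*} [NormedAddCommGroup Z] [NormedSpace K Z]
  {A : Type*} [NormedAddCommGroup A] [NormedSpace K A]
  {B : Type*} [NormedAddCommGroup B] [NormedSpace K B]

namespace GroupChart

variable (S : GroupChart K E V)

theorem eventually_right_inv (a : V) : ∀ᶠ y in 𝓝 (S.c a), S.c (S.s y) = y := by
  filter_upwards [S.isOpenEmbedding.isOpen_range.mem_nhds ⟨a, rfl⟩]
  rintro _ ⟨b, rfl⟩
  rw [S.left_inv]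

/-- Analyticity of functions on powers of `V`. -/
def IsAn {n : ℕ} (f : (Fin n → V) → Z) : Prop :=
  ∀ g : Fin n → V, AnalyticAt K (fun y : Fin n → E => f fun i => S.s (y i)) (fun i => S.c (g i))

/-- The analytic functions on `Vⁿ`. -/
def Cochain (n : ℕ) (Z : Type*) [NormedAddCommGroup Z] [NormedSpace K Z] :
    Submodule K ((Fin n → V) → Z) where
  carrier := {f | S.IsAn f}
  add_mem' hf hf' g := (hf g).add (hf' g)
  zero_mem' _ := analyticAt_const
  smul_mem' a _ hf g := (hf g).const_smul (c := a)

theorem isAn_const {n : ℕ} (z : Z) : S.IsAn (fun _ : Fin n → V => z) := fun _ => analyticAt_const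

theorem isAn_apply {n : ℕ} (i : Fin n) : S.IsAn fun g : Fin n → V => S.c (g i) := by
  intro g
  have h : (fun y : Fin n → E => S.c (S.s (y i))) =ᶠ[𝓝 fun i => S.c (g i)] fun y => y i :=
    ((continuous_apply i).tendsto fun i => S.c (g i)).eventually (S.eventually_right_inv (g i))
  exact (analyticAt_congr h).2
    ((ContinuousLinearMap.proj (R := K) (φ := fun _ : Fin n => E) i).analyticAt _)

theorem isAn_mul {n : ℕ} {φ ψ : (Fin n → V) → V} (hφ : S.IsAn fun g => S.c (φ g))
    (hψ : S.IsAn fun g => S.c (ψ g)) : S.IsAn fun g => S.c (φ g * ψ g) := by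
  intro g
  have h := S.analyticAt_mul (φ fun i => S.s (S.c (g i))) (ψ fun i => S.s (S.c (g i)))
  have := h.comp₂ (hφ g) (hψ g)
  simpa only [S.left_inv] using this

variable {S}

theorem IsAn.comp {n k : ℕ} {f : (Fin k → V) → Z} (hf : S.IsAn f) {T : (Fin n → V) → Fin k → V}
    (hT : ∀ i, S.IsAn fun g => S.c (T g i)) : S.IsAn fun g => f (T g) := by
  intro g
  have h₁ : AnalyticAt K (fun y : Fin n → E => fun i => S.c (T (fun l => S.s (y l)) i))
      (fun i => S.c (g i)) := analyticAt_pi_iff.2 fun i => hT i g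
  have h₂ := (hf (T fun l => S.s (S.c (g l)))).comp h₁
  simpa only [S.left_inv, Function.comp_def] using h₂

variable (S)

/-- The inverse image of analytic functions under an analytic map. -/
def pull {n k : ℕ} (T : (Fin n → V) → Fin k → V) (hT : ∀ i, S.IsAn fun g => S.c (T g i)) :
    S.Cochain k Z →ₗ[K] S.Cochain n Z where
  toFun f := ⟨fun g => f.1 (T g), f.2.comp hT⟩
  map_add' _ _ := rfl
  map_smul' _ _ := rfl

/-- Composition with a linear map of the values. -/
def post {n : ℕ} (L : A →L[K] B) : S.Cochain n A →ₗ[K] S.Cochain n B where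
  toFun f := ⟨fun g => L (f.1 g), fun g => (L.analyticAt _).comp (f.2 g)⟩
  map_add' _ _ := Subtype.ext (funext fun _ => L.map_add _ _)
  map_smul' _ _ := Subtype.ext (funext fun _ => L.map_smul _ _)

/-- Constant functions. -/
def const (n : ℕ) : Z →ₗ[K] S.Cochain n Z where
  toFun z := ⟨fun _ => z, S.isAn_const z⟩
  map_add' _ _ := rfl
  map_smul' _ _ := rfl

/-- The coordinate of the identity. -/
def o : E := S.c 1

@[simp] theorem s_o : S.s S.o = 1 := S.left_inv 1

variable {S} in
theorem IsAn.cons {n : ℕ} {f : (Fin (n + 1) → V) → Z} (hf : S.IsAn f) (a : V) (g : Fin n → V) :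
    AnalyticAt K (fun y : E × (Fin n → E) => f (Fin.cons (S.s y.1) fun i => S.s (y.2 i)))
      (S.c a, fun i => S.c (g i)) := by
  let T : E × (Fin n → E) →L[K] Fin (n + 1) → E := ContinuousLinearMap.pi
    (Fin.cons (ContinuousLinearMap.fst K _ _)
      fun i => ContinuousLinearMap.proj i ∘L ContinuousLinearMap.snd K _ _)
  have hT : ∀ y : E × (Fin n → E), T y = Fin.cons y.1 y.2 := fun y => by
    funext i
    refine Fin.cases ?_ (fun i => ?_) i <;> rfl
  have h := hf (Fin.cons a g)
  have hc : (fun i => S.c ((Fin.cons a g : Fin (n + 1) → V) i)) =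
      T (S.c a, fun i => S.c (g i)) := by
    rw [hT]
    funext i
    refine Fin.cases ?_ (fun i => ?_) i <;> rfl
  rw [hc] at h
  convert h.comp (T.analyticAt _) using 2 with y
  simp only [Function.comp_apply, hT]
  congr 1
  funext i
  refine Fin.cases ?_ (fun i => ?_) i <;> rfl

variable {S} in
theorem IsAn.cons_left {n : ℕ} {f : (Fin (n + 1) → V) → Z} (hf : S.IsAn f) (a : V)
    (g : Fin n → V) : AnalyticAt K (fun y : E => f (Fin.cons (S.s y) g)) (S.c a) := by
  have := (hf.cons a g).comp₂ (analyticAt_id (𝕜 := K) (z := S.c a)) analyticAt_const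
  simpa only [S.left_inv, id] using this

variable [CompleteSpace Z] [CompleteSpace A]

/-- The derivative in the first variable at the identity. -/
def firstDeriv {n : ℕ} : S.Cochain (n + 1) Z →ₗ[K] S.Cochain n (E →L[K] Z) where
  toFun f := ⟨fun g => fderiv K (fun y => f.1 (Fin.cons (S.s y) g)) S.o, by
    intro g
    have h := f.2.cons 1 g
    have h₁ : AnalyticAt K (fun y : Fin n → E => fderiv K (fun y : E × (Fin n → E) =>
        f.1 (Fin.cons (S.s y.1) fun i => S.s (y.2 i))) (S.o, y) ∘L
          ContinuousLinearMap.inl K E (Fin n → E)) (fun i => S.c (g i)) := by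
      have h₂ : AnalyticAt K (fun y : Fin n → E => (S.o, y)) (fun i => S.c (g i)) :=
        analyticAt_const.prod analyticAt_id
      have h₃ := h.fderiv.comp_of_eq h₂ rfl
      exact (((ContinuousLinearMap.compL K E (E × (Fin n → E)) Z).flip
        (ContinuousLinearMap.inl K E (Fin n → E))).analyticAt _).comp h₃
    refine h₁.congr ?_
    have h₄ : ∀ᶠ y : Fin n → E in 𝓝 fun i => S.c (g i), AnalyticAt K
        (fun y : E × (Fin n → E) => f.1 (Fin.cons (S.s y.1) fun i => S.s (y.2 i))) (S.o, y) := by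
      have h₅ : Tendsto (fun y : Fin n → E => (S.o, y)) (𝓝 fun i => S.c (g i))
        (𝓝 (S.o, fun i => S.c (g i))) := (by fun_prop : Continuous _).continuousAt
      exact h₅.eventually h.eventually_analyticAt
    filter_upwards [h₄] with y hy
    have h₆ : HasFDerivAt (fun u : E => (u, y)) (ContinuousLinearMap.inl K E (Fin n → E)) S.o :=
      hasFDerivAt_prodMk_left _ _
    exact (HasFDerivAt.comp S.o hy.differentiableAt.hasFDerivAt h₆).fderiv.symm⟩
  map_add' f f' := Subtype.ext (funext fun g =>
    fderiv_fun_add (f.2.cons_left 1 g).differentiableAt (f'.2.cons_left 1 g).differentiableAt)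
  map_smul' a f := Subtype.ext (funext fun g =>
    fderiv_fun_const_smul (f.2.cons_left 1 g).differentiableAt a)

theorem hasFDerivAt_firstDeriv {n : ℕ} (f : S.Cochain (n + 1) Z) (g : Fin n → V) :
    HasFDerivAt (fun y => f.1 (Fin.cons (S.s y) g)) ((S.firstDeriv f).1 g) S.o :=
  (f.2.cons_left 1 g).differentiableAt.hasFDerivAt

/-- Right multiplication of the last variable. -/
def mulLast {n : ℕ} (x : V) (g : Fin (n + 1) → V) : Fin (n + 1) → V :=
  Function.update g (Fin.last n) (g (Fin.last n) * x)

theorem mulLast_one {n : ℕ} (g : Fin (n + 1) → V) : mulLast 1 g = g := by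
  simp [mulLast]

theorem isAn_mulLast {n : ℕ} (i : Fin (n + 1)) :
    S.IsAn fun g : Fin (n + 2) → V => S.c (mulLast (g 0) (Fin.tail g) i) := by
  by_cases hi : i = Fin.last n
  · subst hi
    simp only [mulLast, Function.update_self]
    exact S.isAn_mul (S.isAn_apply _) (S.isAn_apply _)
  · simp only [mulLast, Function.update_of_ne hi]
    exact S.isAn_apply _

/-- The derivative of right multiplication of the last variable. -/
def lastDeriv {n : ℕ} : S.Cochain (n + 1) Z →ₗ[K] S.Cochain (n + 1) (E →L[K] Z) :=
  S.firstDeriv ∘ₗ S.pull (fun g => mulLast (g 0) (Fin.tail g)) S.isAn_mulLast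

theorem hasFDerivAt_lastDeriv {n : ℕ} (f : S.Cochain (n + 1) Z) (g : Fin (n + 1) → V) :
    HasFDerivAt (fun y => f.1 (mulLast (S.s y) g)) ((S.lastDeriv f).1 g) S.o :=
  S.hasFDerivAt_firstDeriv (S.pull (fun g => mulLast (g 0) (Fin.tail g)) S.isAn_mulLast f) g

theorem isAn_cons_mul {n : ℕ} (i : Fin (n + 1)) : S.IsAn fun g : Fin (n + 2) → V =>
    S.c ((Fin.cons (g 0 * g 1) (Fin.tail (Fin.tail g)) : Fin (n + 1) → V) i) := by
  refine Fin.cases ?_ (fun i => ?_) i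
  · simp only [Fin.cons_zero]
    exact S.isAn_mul (S.isAn_apply _) (S.isAn_apply _)
  · simp only [Fin.cons_succ]
    exact S.isAn_apply _

/-- The derivative of left multiplication of the first variable. -/
def leftDeriv {n : ℕ} : S.Cochain (n + 1) Z →ₗ[K] S.Cochain (n + 1) (E →L[K] Z) :=
  S.firstDeriv ∘ₗ S.pull (fun g => Fin.cons (g 0 * g 1) (Fin.tail (Fin.tail g))) S.isAn_cons_mul

theorem hasFDerivAt_leftDeriv {n : ℕ} (f : S.Cochain (n + 1) Z) (g : Fin (n + 1) → V) :
    HasFDerivAt (fun y => f.1 (Fin.cons (S.s y * g 0) (Fin.tail g))) ((S.leftDeriv f).1 g) S.o :=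
  S.hasFDerivAt_firstDeriv
    (S.pull (fun g => Fin.cons (g 0 * g 1) (Fin.tail (Fin.tail g))) S.isAn_cons_mul f) g

end GroupChart

end Chart

/-! ### Partial derivatives -/

section Partial

open Filter Topology

variable {K : Type*} [NontriviallyNormedField K] [CompleteSpace K]
  {E : Type*} [NormedAddCommGroup E] [NormedSpace K E]
  {F : Type*} [NormedAddCommGroup F] [NormedSpace K F]
  {A : Type*} [NormedAddCommGroup A] [NormedSpace K A] [CompleteSpace A]

theorem eventually_fderiv_left {Φ : E × F → A} {a : E} {b : F} (h : AnalyticAt K Φ (a, b)) :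
    (fun z => fderiv K (fun y => Φ (y, z)) a) =ᶠ[𝓝 b]
      fun z => fderiv K Φ (a, z) ∘L ContinuousLinearMap.inl K E F := by
  have ht : Tendsto (fun z : F => (a, z)) (𝓝 b) (𝓝 (a, b)) :=
    (by fun_prop : Continuous fun z : F => (a, z)).continuousAt
  filter_upwards [ht.eventually h.eventually_analyticAt] with z hz
  have h₆ : HasFDerivAt (fun u : E => (u, z)) (ContinuousLinearMap.inl K E F) a :=
    hasFDerivAt_prodMk_left _ _
  exact (HasFDerivAt.comp a hz.differentiableAt.hasFDerivAt h₆).fderiv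

theorem eventually_fderiv_right {Φ : E × F → A} {a : E} {b : F} (h : AnalyticAt K Φ (a, b)) :
    (fun y => fderiv K (fun z => Φ (y, z)) b) =ᶠ[𝓝 a]
      fun y => fderiv K Φ (y, b) ∘L ContinuousLinearMap.inr K E F := by
  have ht : Tendsto (fun y : E => (y, b)) (𝓝 a) (𝓝 (a, b)) :=
    (by fun_prop : Continuous fun y : E => (y, b)).continuousAt
  filter_upwards [ht.eventually h.eventually_analyticAt] with y hy
  have h₆ : HasFDerivAt (fun u : F => (y, u)) (ContinuousLinearMap.inr K E F) b :=
    hasFDerivAt_prodMk_right _ _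
  exact (HasFDerivAt.comp b hy.differentiableAt.hasFDerivAt h₆).fderiv

theorem analyticAt_fderiv_left {Φ : E × F → A} {a : E} {b : F} (h : AnalyticAt K Φ (a, b)) :
    AnalyticAt K (fun z => fderiv K (fun y => Φ (y, z)) a) b := by
  refine (analyticAt_congr (eventually_fderiv_left h)).2 ?_
  have h₂ : AnalyticAt K (fun z : F => (a, z)) b := analyticAt_const.prod analyticAt_id
  exact (((ContinuousLinearMap.compL K E (E × F) A).flip
    (ContinuousLinearMap.inl K E F)).analyticAt _).comp (h.fderiv.comp_of_eq h₂ rfl)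

theorem analyticAt_fderiv_right {Φ : E × F → A} {a : E} {b : F} (h : AnalyticAt K Φ (a, b)) :
    AnalyticAt K (fun y => fderiv K (fun z => Φ (y, z)) b) a := by
  refine (analyticAt_congr (eventually_fderiv_right h)).2 ?_
  have h₂ : AnalyticAt K (fun y : E => (y, b)) a := analyticAt_id.prod analyticAt_const
  exact (((ContinuousLinearMap.compL K F (E × F) A).flip
    (ContinuousLinearMap.inr K E F)).analyticAt _).comp (h.fderiv.comp_of_eq h₂ rfl)

theorem fderiv_fderiv_left_apply {Φ : E × F → A} {a : E} {b : F} (h : AnalyticAt K Φ (a, b))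
    (v : E) (w : F) : fderiv K (fun z => fderiv K (fun y => Φ (y, z)) a) b w v =
      fderiv K (fderiv K Φ) (a, b) (0, w) (v, 0) := by
  rw [(eventually_fderiv_left h).fderiv_eq]
  have h₁ : HasFDerivAt (fun z : F => fderiv K Φ (a, z))
      (fderiv K (fderiv K Φ) (a, b) ∘L ContinuousLinearMap.inr K E F) b :=
    HasFDerivAt.comp b h.fderiv.differentiableAt.hasFDerivAt (hasFDerivAt_prodMk_right _ _)
  have h₂ := (((ContinuousLinearMap.compL K E (E × F) A).flip
    (ContinuousLinearMap.inl K E F)).hasFDerivAt.comp b h₁).fderiv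
  exact congrArg (fun T : F →L[K] E →L[K] A => T w v) h₂

theorem fderiv_fderiv_right_apply {Φ : E × F → A} {a : E} {b : F} (h : AnalyticAt K Φ (a, b))
    (v : E) (w : F) : fderiv K (fun y => fderiv K (fun z => Φ (y, z)) b) a v w =
      fderiv K (fderiv K Φ) (a, b) (v, 0) (0, w) := by
  rw [(eventually_fderiv_right h).fderiv_eq]
  have h₁ : HasFDerivAt (fun y : E => fderiv K Φ (y, b))
      (fderiv K (fderiv K Φ) (a, b) ∘L ContinuousLinearMap.inl K E F) a :=
    HasFDerivAt.comp a h.fderiv.differentiableAt.hasFDerivAt (hasFDerivAt_prodMk_left _ _)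
  have h₂ := (((ContinuousLinearMap.compL K F (E × F) A).flip
    (ContinuousLinearMap.inr K E F)).hasFDerivAt.comp a h₁).fderiv
  exact congrArg (fun T : E →L[K] F →L[K] A => T v w) h₂

/-- Partial derivatives in different variables commute. -/
theorem fderiv_fderiv_comm {Φ : E × F → A} {a : E} {b : F} (h : AnalyticAt K Φ (a, b))
    (v : E) (w : F) : fderiv K (fun z => fderiv K (fun y => Φ (y, z)) a) b w v =
      fderiv K (fun y => fderiv K (fun z => Φ (y, z)) b) a v w := by
  rw [fderiv_fderiv_left_apply h, fderiv_fderiv_right_apply h]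
  exact (isSymmSndFDerivAt_of_analyticAt h).eq (0, w) (v, 0)

end Partial

/-! ### Faces -/

section Faces

variable {V : Type*} [Group V] {n : ℕ}

theorem tail_mulLast (x : V) (g : Fin (n + 2) → V) :
    Fin.tail (GroupChart.mulLast x g) = GroupChart.mulLast x (Fin.tail g) := by
  funext i
  simp only [Fin.tail, GroupChart.mulLast, Function.update_apply, ← Fin.succ_last, Fin.succ_inj]

/-- Inner faces multiply the last variable only from the left, hence commute with its right
translations by associativity. -/
theorem contractNth_mulLast (i : Fin (n + 1)) (x : V) (g : Fin (n + 2) → V) :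
    Fin.contractNth i.castSucc (· * ·) (GroupChart.mulLast x g) =
      GroupChart.mulLast x (Fin.contractNth i.castSucc (· * ·) g) := by
  funext k
  have hk : k.succ = Fin.last (n + 1) ↔ k = Fin.last n := by
    rw [← Fin.succ_last, Fin.succ_inj]
  have hk' : k.castSucc ≠ Fin.last (n + 1) := (Fin.castSucc_lt_last k).ne
  rcases lt_trichotomy (k : ℕ) i with h | h | h
  · have h' : k ≠ Fin.last n := fun h' => by
      have := i.2; rw [h', Fin.val_last] at h; omega
    simp only [GroupChart.mulLast, Function.update_of_ne h']
    rw [Fin.contractNth_apply_of_lt _ _ _ _ h, Fin.contractNth_apply_of_lt _ _ _ _ h,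
      Function.update_of_ne hk']
  · rw [Fin.contractNth_apply_of_eq _ _ _ _ h]
    by_cases h' : k = Fin.last n
    · subst h'
      simp only [GroupChart.mulLast, Function.update_self]
      rw [Fin.contractNth_apply_of_eq _ _ _ _ h, Function.update_of_ne hk', Fin.succ_last,
        Function.update_self, mul_assoc]
    · simp only [GroupChart.mulLast, Function.update_of_ne h']
      rw [Fin.contractNth_apply_of_eq _ _ _ _ h, Function.update_of_ne hk',
        Function.update_of_ne (fun h => h' (hk.1 h))]
  · rw [Fin.contractNth_apply_of_gt _ _ _ _ h]
    by_cases h' : k = Fin.last n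
    · subst h'
      simp only [GroupChart.mulLast, Function.update_self]
      rw [Fin.contractNth_apply_of_gt _ _ _ _ h, Fin.succ_last, Function.update_self]
    · simp only [GroupChart.mulLast, Function.update_of_ne h']
      rw [Fin.contractNth_apply_of_gt _ _ _ _ h, Function.update_of_ne (fun h => h' (hk.1 h))]

theorem tail_snoc (g : Fin (n + 1) → V) (x : V) :
    Fin.tail (Fin.snoc g x : Fin (n + 2) → V) = (Fin.snoc (Fin.tail g) x : Fin (n + 1) → V) := by
  funext i
  refine Fin.lastCases ?_ (fun i => ?_) i
  · rw [Fin.snoc_last, Fin.tail, Fin.succ_last, Fin.snoc_last]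
  · rw [Fin.snoc_castSucc, Fin.tail, ← Fin.castSucc_succ, Fin.snoc_castSucc, Fin.tail]

theorem contractNth_snoc (i : Fin n) (g : Fin (n + 1) → V) (x : V) :
    Fin.contractNth i.castSucc.castSucc (· * ·) (Fin.snoc g x : Fin (n + 2) → V) =
      (Fin.snoc (Fin.contractNth i.castSucc (· * ·) g) x : Fin (n + 1) → V) := by
  funext k
  refine Fin.lastCases ?_ (fun k => ?_) k
  · rw [Fin.contractNth_apply_of_gt _ _ _ _ (by simp), Fin.succ_last, Fin.snoc_last,
      Fin.snoc_last]
  · rw [Fin.snoc_castSucc]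
    rcases lt_trichotomy (k : ℕ) i with h | h | h
    · rw [Fin.contractNth_apply_of_lt _ _ _ _ h, Fin.contractNth_apply_of_lt _ _ _ _ h,
        Fin.snoc_castSucc]
    · rw [Fin.contractNth_apply_of_eq _ _ _ _ h, Fin.contractNth_apply_of_eq _ _ _ _ h,
        Fin.snoc_castSucc, ← Fin.castSucc_succ, Fin.snoc_castSucc]
    · rw [Fin.contractNth_apply_of_gt _ _ _ _ h, Fin.contractNth_apply_of_gt _ _ _ _ h,
        ← Fin.castSucc_succ, Fin.snoc_castSucc]

/-- The top face lets the last group variable act on the argument x. At x = 1 it becomes the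
identity, the source of the row contraction. -/
theorem contractNth_last_snoc (g : Fin (n + 1) → V) (x : V) :
    Fin.contractNth (Fin.last n).castSucc (· * ·) (Fin.snoc g x : Fin (n + 2) → V) =
      GroupChart.mulLast x g := by
  funext k
  refine Fin.lastCases ?_ (fun k => ?_) k
  · rw [Fin.contractNth_apply_of_eq _ _ _ _ (by simp), Fin.snoc_castSucc, Fin.succ_last,
      Fin.snoc_last, GroupChart.mulLast, Function.update_self]
  · rw [Fin.contractNth_apply_of_lt _ _ _ _ (by simp), Fin.snoc_castSucc,
      GroupChart.mulLast, Function.update_of_ne (Fin.castSucc_lt_last k).ne]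

theorem contractNth_zero_cons (a : V) (g : Fin (n + 1) → V) :
    Fin.contractNth 0 (· * ·) (Fin.cons a g : Fin (n + 2) → V) =
      (Fin.cons (a * g 0) (Fin.tail g) : Fin (n + 1) → V) := by
  funext k
  refine Fin.cases ?_ (fun k => ?_) k
  · rw [Fin.contractNth_apply_of_eq _ _ _ _ (by simp)]
    rfl
  · rw [Fin.contractNth_apply_of_gt _ _ _ _ (by simp), Fin.cons_succ, Fin.cons_succ]
    rfl

theorem contractNth_succ_cons (i : Fin (n + 1)) (a : V) (g : Fin (n + 1) → V) :
    Fin.contractNth i.succ (· * ·) (Fin.cons a g : Fin (n + 2) → V) =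
      (Fin.cons a (Fin.contractNth i (· * ·) g) : Fin (n + 1) → V) := by
  funext k
  refine Fin.cases ?_ (fun k => ?_) k
  · rw [Fin.contractNth_apply_of_lt _ _ _ _ (by simp)]
    rfl
  · rw [Fin.cons_succ]
    rcases lt_trichotomy (k : ℕ) i with h | h | h
    · rw [Fin.contractNth_apply_of_lt _ _ _ _ h, Fin.contractNth_apply_of_lt _ _ _ _ (by simpa)]
      rfl
    · rw [Fin.contractNth_apply_of_eq _ _ _ _ h, Fin.contractNth_apply_of_eq _ _ _ _ (by simpa)]
      rfl
    · rw [Fin.contractNth_apply_of_gt _ _ _ _ h, Fin.contractNth_apply_of_gt _ _ _ _ (by simpa)]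
      rfl

theorem mulLast_cons (x a : V) (g : Fin (n + 1) → V) :
    GroupChart.mulLast x (Fin.cons a g : Fin (n + 2) → V) =
      (Fin.cons a (GroupChart.mulLast x g) : Fin (n + 2) → V) := by
  rw [GroupChart.mulLast, GroupChart.mulLast, Fin.cons_update, ← Fin.succ_last, Fin.cons_succ]

theorem mulLast_snoc (x a : V) (g : Fin n → V) :
    GroupChart.mulLast x (Fin.snoc g a : Fin (n + 1) → V) =
      (Fin.snoc g (a * x) : Fin (n + 1) → V) := by
  rw [GroupChart.mulLast, Fin.snoc_last, Fin.update_snoc_last]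

end Faces

/-! ### The double complex -/

section DoubleComplex

open Filter Topology

variable {K : Type*} [NontriviallyNormedField K] [CompleteSpace K]
  {E : Type*} [NormedAddCommGroup E] [NormedSpace K E] [FiniteDimensional K E]
  {V : Type*} [TopologicalSpace V] [Group V]
  {Z : Type*} [NormedAddCommGroup Z] [NormedSpace K Z]
  {A : Type*} [NormedAddCommGroup A] [NormedSpace K A]
  {B : Type*} [NormedAddCommGroup B] [NormedSpace K B]

instance finiteDimensional_form (q : ℕ) : FiniteDimensional K (Form K E q) :=
  Module.Finite.of_injective
    (N := MultilinearMap K (fun _ : Fin q => E) K)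
    ({ toFun := fun η => η.toMultilinearMap
       map_add' := fun _ _ => rfl
       map_smul' := fun _ _ => rfl } :
      Form K E q →ₗ[K] MultilinearMap K (fun _ : Fin q => E) K)
    fun _ _ h => ContinuousAlternatingMap.ext fun v =>
      congrArg (fun F : MultilinearMap K (fun _ : Fin q => E) K => F v) h

namespace GroupChart

variable (S : GroupChart K E V)

theorem isAn_contractNth {n : ℕ} (i : Fin n) (k : Fin n) :
    S.IsAn fun g : Fin (n + 1) → V => S.c (Fin.contractNth i.castSucc (· * ·) g k) := by
  simp only [Fin.contractNth]
  split_ifs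
  · exact S.isAn_apply _
  · exact S.isAn_mul (S.isAn_apply _) (S.isAn_apply _)
  · exact S.isAn_apply _

/-- The differential of the complex computing the cohomology of `V` with values in the functions
on `V`, where the last variable is the argument of these functions. -/
def cobar (n : ℕ) : S.Cochain n Z →ₗ[K] S.Cochain (n + 1) Z :=
  S.pull Fin.tail (fun _ => S.isAn_apply _) + ∑ i : Fin n, (-1 : K) ^ ((i : ℕ) + 1) •
    S.pull (Fin.contractNth i.castSucc (· * ·)) (S.isAn_contractNth i)

theorem cobar_apply {n : ℕ} (f : S.Cochain n Z) (g : Fin (n + 1) → V) :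
    (S.cobar n f).1 g = f.1 (Fin.tail g) + ∑ i : Fin n, (-1 : K) ^ ((i : ℕ) + 1) •
      f.1 (Fin.contractNth i.castSucc (· * ·) g) := by
  rw [cobar, LinearMap.add_apply, LinearMap.sum_apply, Submodule.coe_add, Pi.add_apply,
    AddSubmonoidClass.coe_finsetSum, Finset.sum_apply]
  rfl

theorem isAn_snoc {n : ℕ} (i : Fin (n + 1)) (a : V) :
    S.IsAn fun g : Fin n → V => S.c ((Fin.snoc g a : Fin (n + 1) → V) i) := by
  refine Fin.lastCases ?_ (fun i => ?_) i
  · simp only [Fin.snoc_last]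
    exact S.isAn_const _
  · simp only [Fin.snoc_castSucc]
    exact S.isAn_apply _

/-- Evaluation of the last variable at `1`. -/
def evalLast (n : ℕ) : S.Cochain (n + 1) Z →ₗ[K] S.Cochain n Z :=
  S.pull (fun g => Fin.snoc g 1) fun i => S.isAn_snoc i 1

/-- Functions which do not depend on the last variable. -/
def extendLast (n : ℕ) : S.Cochain n Z →ₗ[K] S.Cochain (n + 1) Z :=
  S.pull Fin.init fun _ => S.isAn_apply _

theorem evalLast_extendLast {n : ℕ} (f : S.Cochain n Z) : S.evalLast n (S.extendLast n f) = f :=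
  Subtype.ext (funext fun _ => congrArg f.1 (Fin.init_snoc _ _))

/-- The differential of inhomogeneous cochains. -/
def groupDiff (n : ℕ) : S.Cochain n Z →ₗ[K] S.Cochain (n + 1) Z :=
  S.cobar n + (-1 : K) ^ (n + 1) • S.extendLast n

theorem cobar_snoc {n : ℕ} (f : S.Cochain (n + 1) Z) (g : Fin (n + 1) → V) (x : V) :
    (S.cobar (n + 1) f).1 (Fin.snoc g x) = f.1 (Fin.snoc (Fin.tail g) x) +
      ∑ i : Fin n, (-1 : K) ^ ((i : ℕ) + 1) •
        f.1 (Fin.snoc (Fin.contractNth i.castSucc (· * ·) g) x) +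
      (-1 : K) ^ (n + 1) • f.1 (mulLast x g) := by
  rw [cobar_apply, Fin.sum_univ_castSucc, tail_snoc, contractNth_last_snoc, Fin.val_last]
  simp only [contractNth_snoc, Fin.val_castSucc, add_assoc]

/-- The top face at argument 1 returns f itself, so evaluation at 1 is, up to sign, a contracting
homotopy of the rows. -/
theorem evalLast_cobar {n : ℕ} (f : S.Cochain (n + 1) Z) :
    S.evalLast (n + 1) (S.cobar (n + 1) f) =
      S.cobar n (S.evalLast n f) + (-1 : K) ^ (n + 1) • f := by
  refine Subtype.ext (funext fun g => ?_)
  refine (S.cobar_snoc f g 1).trans ?_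
  rw [mulLast_one]
  exact congrArg (· + _) (S.cobar_apply (S.evalLast n f) g).symm

/-- On functions independent of the argument the top face drops a variable, which is precisely the
final term of the group differential. This embeds the group complex into the bottom row. -/
theorem cobar_extendLast {n : ℕ} (f : S.Cochain n Z) :
    S.cobar (n + 1) (S.extendLast n f) = S.extendLast (n + 1) (S.groupDiff n f) := by
  refine Subtype.ext (funext fun g => ?_)
  obtain ⟨g, x, rfl⟩ : ∃ (g' : Fin (n + 1) → V) (x : V), g = Fin.snoc g' x :=
    ⟨Fin.init g, g (Fin.last _), (Fin.snoc_init_self g).symm⟩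
  rw [cobar_snoc]
  have h : (S.extendLast (n + 1) (S.groupDiff n f)).1 (Fin.snoc g x) =
      (S.groupDiff n f).1 g := congrArg (S.groupDiff n f).1 (Fin.init_snoc _ _)
  have h' : ∀ (g' : Fin n → V), (S.extendLast n f).1 (Fin.snoc g' x) = f.1 g' :=
    fun g' => congrArg f.1 (Fin.init_snoc _ _)
  have h'' : (S.extendLast n f).1 (mulLast x g) = f.1 (Fin.init g) :=
    congrArg f.1 (Fin.init_update_last _ _)
  rw [h, h'']
  simp only [h']
  exact congrArg (· + _) (S.cobar_apply f g).symm

/-- Right translation of the last variable. -/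
def translateLast {n : ℕ} (x : V) : S.Cochain (n + 1) Z →ₗ[K] S.Cochain (n + 1) Z :=
  S.pull (mulLast x) fun i => by
    by_cases hi : i = Fin.last n
    · subst hi
      simp only [mulLast, Function.update_self]
      exact S.isAn_mul (S.isAn_apply _) (S.isAn_const _)
    · simp only [mulLast, Function.update_of_ne hi]
      exact S.isAn_apply _

theorem translateLast_cobar {n : ℕ} (x : V) (f : S.Cochain (n + 1) Z) :
    S.translateLast x (S.cobar (n + 1) f) = S.cobar (n + 1) (S.translateLast x f) := by
  refine Subtype.ext (funext fun g => ?_)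
  refine (S.cobar_apply f (mulLast x g)).trans (Eq.trans ?_ (S.cobar_apply _ g).symm)
  rw [tail_mulLast]
  simp only [contractNth_mulLast]
  rfl

/-- By induction, `evalLast_cobar` gives the vanishing when the last variable is 1; right
translations, which commute with `cobar`, carry this to every value of the last variable. -/
theorem cobar_cobar : {n : ℕ} → (f : S.Cochain n Z) → S.cobar (n + 1) (S.cobar n f) = 0
  | 0, f => by
    refine Subtype.ext (funext fun g => ?_)
    have h : ∀ g, (S.cobar 0 f).1 g = f.1 Fin.elim0 := fun g => by
      rw [cobar_apply, Fin.sum_univ_zero, add_zero]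
      exact congrArg f.1 (Subsingleton.elim _ _)
    rw [cobar_apply]
    simp [h]
  | n + 1, f => by
    have key : ∀ F : S.Cochain (n + 1) Z,
        S.evalLast (n + 2) (S.cobar (n + 2) (S.cobar (n + 1) F)) = 0 := fun F => by
      rw [evalLast_cobar, evalLast_cobar, map_add, cobar_cobar, map_smul, zero_add, ← add_smul,
        pow_succ (-1 : K) (n + 1), mul_neg_one, add_neg_cancel, zero_smul]
    refine Subtype.ext (funext fun g => ?_)
    have h₁ := congrArg (fun F => F.1 (Fin.init g)) (key (S.translateLast (g (Fin.last _)) f))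
    rw [← translateLast_cobar, ← translateLast_cobar] at h₁
    refine Eq.trans (congrArg _ ?_) h₁
    rw [mulLast_snoc, one_mul, Fin.snoc_init_self]

theorem cobar_post {n : ℕ} (L : A →L[K] B) (f : S.Cochain n A) :
    S.cobar n (S.post L f) = S.post L (S.cobar n f) := by
  refine Subtype.ext (funext fun g => ?_)
  refine (S.cobar_apply _ g).trans (Eq.trans ?_ (congrArg L (S.cobar_apply f g)).symm)
  rw [map_add, map_sum]
  simp only [map_smul]
  rfl

/-- Faces commute with right translations of the argument, hence with the left invariant fields that
these generate. -/
theorem cobar_lastDeriv [CompleteSpace Z] {n : ℕ} (f : S.Cochain (n + 1) Z) :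
    S.cobar (n + 1) (S.lastDeriv f) = S.lastDeriv (S.cobar (n + 1) f) := by
  refine Subtype.ext (funext fun g => ?_)
  refine HasFDerivAt.unique ?_ (S.hasFDerivAt_lastDeriv (S.cobar (n + 1) f) g)
  simp only [cobar_apply, tail_mulLast, contractNth_mulLast]
  exact (S.hasFDerivAt_lastDeriv f _).add (HasFDerivAt.fun_sum fun i _ =>
    (S.hasFDerivAt_lastDeriv f _).const_smul _)

/-- The second order part of the multiplication. -/
def mulDeriv : E →L[K] E →L[K] E :=
  fderiv K (fun y => fderiv K (fun z => S.c (S.s y * S.s z)) S.o) S.o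

/-- The Lie bracket on the tangent space at the identity. -/
def bracket : E →ₗ[K] E →ₗ[K] E :=
  (ContinuousLinearMap.coeLM K ∘ₗ S.mulDeriv.toLinearMap) -
    (ContinuousLinearMap.coeLM K ∘ₗ S.mulDeriv.flip.toLinearMap)

theorem bracket_apply (v w : E) : S.bracket v w = S.mulDeriv v w - S.mulDeriv w v := rfl

/-- The Chevalley–Eilenberg differential as a continuous linear map. -/
def ceDiff (q : ℕ) : Form K E q →L[K] Form K E (q + 1) :=
  LinearMap.toContinuousLinearMap (ceDifferential S.bracket q)

/-- The exterior derivative in the last variable, for forms written in the left invariant frame. -/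
def extDeriv {n q : ℕ} : S.Cochain (n + 1) (Form K E q) →ₗ[K] S.Cochain (n + 1) (Form K E (q + 1)) :=
  S.post (ContinuousAlternatingMap.alternatizeUncurryFinCLM K E K) ∘ₗ S.lastDeriv +
    S.post (S.ceDiff q)

theorem cobar_extDeriv {n q : ℕ} (f : S.Cochain (n + 1) (Form K E q)) :
    S.cobar (n + 1) (S.extDeriv f) = S.extDeriv (S.cobar (n + 1) f) := by
  have h : ∀ {n : ℕ} (f : S.Cochain (n + 1) (Form K E q)), S.extDeriv f =
      S.post (ContinuousAlternatingMap.alternatizeUncurryFinCLM K E K) (S.lastDeriv f) +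
        S.post (S.ceDiff q) f := fun _ => rfl
  rw [h, h, map_add, cobar_post, cobar_post, cobar_lastDeriv]

end GroupChart

end DoubleComplex

/-! ### Differentiating in all group variables -/

section Total

open Filter Topology

variable {K : Type*} [NontriviallyNormedField K] [CompleteSpace K]
  {E : Type*} [NormedAddCommGroup E] [NormedSpace K E] [FiniteDimensional K E]
  {V : Type*} [TopologicalSpace V] [Group V]
  {Z : Type*} [NormedAddCommGroup Z] [NormedSpace K Z] [CompleteSpace Z]
  {A : Type*} [NormedAddCommGroup A] [NormedSpace K A] [CompleteSpace A]
  {B : Type*} [NormedAddCommGroup B] [NormedSpace K B] [CompleteSpace B]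

theorem wedge_sub_smul_castForm {a b : ℕ} (h : a = b) (M : E →ₗ[K] Form K E b)
    (L : E →ₗ[K] Form K E a) (r : K) : wedge (M - r • (castForm h ∘ₗ L)) =
      wedge M - r • castForm (congrArg (· + 1) h) (wedge L) := by
  subst h
  rw [wedge_sub, map_smul]
  rfl

theorem sub_smul_castForm_add {a b : ℕ} (h : a = b) (x : Form K E b) (y y' : Form K E a) (r : K) :
    x - r • castForm h y' + (r * -1) • castForm h y = x - r • castForm h (y + y') := by
  subst h
  simp only [castForm_rfl]
  module

namespace GroupChart

variable (S : GroupChart K E V)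

variable {S} in
theorem IsAn.comp₂ {k : ℕ} {f : (Fin k → V) → Z} (hf : S.IsAn f) {T : V → V → Fin k → V}
    (hT : ∀ i, S.IsAn fun g : Fin 2 → V => S.c (T (g 0) (g 1) i)) (a b : V) :
    AnalyticAt K (fun z : E × E => f (T (S.s z.1) (S.s z.2))) (S.c a, S.c b) := by
  let P : E × E →L[K] Fin 2 → E := ContinuousLinearMap.pi
    ![ContinuousLinearMap.fst K E E, ContinuousLinearMap.snd K E E]
  have h := hf.comp (T := fun g : Fin 2 → V => T (g 0) (g 1)) hT ![a, b]
  refine h.comp_of_eq (P.analyticAt _) ?_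
  funext i
  fin_cases i <;> rfl

theorem analyticAt_mul_o : AnalyticAt K (fun z : E × E => S.c (S.s z.1 * S.s z.2)) (S.o, S.o) :=
  S.analyticAt_mul 1 1

theorem mulDeriv_eq (v w : E) : S.mulDeriv v w =
    fderiv K (fun z => fderiv K (fun y => S.c (S.s y * S.s z)) S.o) S.o w v :=
  have : CompleteSpace E := FiniteDimensional.complete K E
  (fderiv_fderiv_comm S.analyticAt_mul_o v w).symm

/-- Second order chain rule for κ(yz) at the identity. The Hessian of κ is symmetric, so after
antisymmetrization only the second order part of the multiplication survives, and that is the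
bracket. -/
theorem fderiv_fderiv_comp_mul {κ : E → A} (hκ : AnalyticAt K κ S.o) (v w : E) :
    fderiv K (fun z => fderiv K (fun y => κ (S.c (S.s y * S.s z))) S.o) S.o w v =
      fderiv K (fderiv K κ) S.o w v + fderiv K κ S.o (S.mulDeriv v w) := by
  have : CompleteSpace E := FiniteDimensional.complete K E
  let M : E → E →L[K] E := fun z => fderiv K (fun y => S.c (S.s y * S.s z)) S.o
  have hM : HasFDerivAt M (fderiv K M S.o) S.o :=
    (analyticAt_fderiv_left S.analyticAt_mul_o).differentiableAt.hasFDerivAt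
  have hMo : M S.o = ContinuousLinearMap.id K E := by
    have : (fun y => S.c (S.s y * S.s S.o)) =ᶠ[𝓝 S.o] id := by
      filter_upwards [S.eventually_right_inv 1] with y hy
      rw [s_o, mul_one, hy, id]
    exact this.fderiv_eq.trans fderiv_id
  have h : (fun z => fderiv K (fun y => κ (S.c (S.s y * S.s z))) S.o) =ᶠ[𝓝 S.o]
      fun z => fderiv K κ z ∘L M z := by
    have ht : Tendsto (fun z : E => (S.o, z)) (𝓝 S.o) (𝓝 (S.o, S.o)) :=
      (by fun_prop : Continuous fun z : E => (S.o, z)).continuousAt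
    filter_upwards [ht.eventually S.analyticAt_mul_o.eventually_analyticAt,
      S.eventually_right_inv 1, hκ.eventually_analyticAt] with z h₁ h₂ h₃
    have h₄ : S.c (S.s S.o * S.s z) = z := by rw [s_o, one_mul, h₂]
    have h₅ : DifferentiableAt K (fun y => S.c (S.s y * S.s z)) S.o :=
      DifferentiableAt.comp (g := fun z : E × E => S.c (S.s z.1 * S.s z.2)) (f := fun y => (y, z))
        S.o h₁.differentiableAt (hasFDerivAt_prodMk_left S.o z).differentiableAt
    have h₆ : DifferentiableAt K κ (S.c (S.s S.o * S.s z)) := h₄.symm ▸ h₃.differentiableAt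
    have := (h₆.hasFDerivAt.comp S.o h₅.hasFDerivAt).fderiv
    rw [h₄] at this
    exact this
  rw [h.fderiv_eq, (hκ.fderiv.differentiableAt.hasFDerivAt.clm_comp hM).fderiv, hMo, mulDeriv_eq]
  exact add_comm _ _

/-- Evaluation of functions with values in linear maps. -/
def slice {n : ℕ} : S.Cochain n (E →L[K] A) →ₗ[K] E →ₗ[K] S.Cochain n A :=
  LinearMap.mk₂ K (fun F v => S.post (ContinuousLinearMap.apply K A v) F)
    (fun _ _ _ => rfl) (fun _ _ _ => rfl)
    (fun F v w => Subtype.ext (funext fun g => (F.1 g).map_add v w))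
    (fun a F v => Subtype.ext (funext fun g => (F.1 g).map_smul a v))

theorem slice_apply {n : ℕ} (F : S.Cochain n (E →L[K] A)) (v : E) (g : Fin n → V) :
    (S.slice F v).1 g = F.1 g v := rfl

theorem hasFDerivAt_slice {n : ℕ} (F : S.Cochain (n + 1) (E →L[K] A)) (v : E) (g : Fin n → V) :
    (S.firstDeriv (S.slice F v)).1 g = (ContinuousLinearMap.apply K A v) ∘L
      (S.firstDeriv F).1 g :=
  (S.hasFDerivAt_firstDeriv _ g).unique
    ((ContinuousLinearMap.apply K A v).hasFDerivAt.comp S.o (S.hasFDerivAt_firstDeriv F g))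

theorem slice_firstDeriv_post {n : ℕ} (L : A →L[K] B) (f : S.Cochain (n + 1) A) (v : E) :
    S.slice (S.firstDeriv (S.post L f)) v = S.post L (S.slice (S.firstDeriv f) v) := by
  refine Subtype.ext (funext fun g => ?_)
  have h : (S.firstDeriv (S.post L f)).1 g = L ∘L (S.firstDeriv f).1 g :=
    (S.hasFDerivAt_firstDeriv _ g).unique
      (L.hasFDerivAt.comp S.o (S.hasFDerivAt_firstDeriv f g))
  exact congrArg (fun T : E →L[K] B => T v) h

theorem firstDeriv_pull_tail {n : ℕ} (f : S.Cochain n A) :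
    S.firstDeriv (S.pull Fin.tail (fun i => S.isAn_apply i.succ) f) = 0 :=
  Subtype.ext (funext fun g => (S.hasFDerivAt_firstDeriv _ g).unique (hasFDerivAt_const (f.1 g) S.o))

/-- The outer face does not see the first variable, the face multiplying the first two variables
gives `leftDeriv`, and the others reassemble, with shifted signs, to the cobar of the derivative.
That cobar contains one tail term with no counterpart, which is added back. -/
theorem firstDeriv_cobar {n : ℕ} (k : S.Cochain (n + 1) A) :
    S.firstDeriv (S.cobar (n + 1) k) = -S.leftDeriv k - S.cobar n (S.firstDeriv k) +
      S.pull Fin.tail (fun i => S.isAn_apply i.succ) (S.firstDeriv k) := by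
  refine Subtype.ext (funext fun g => (S.hasFDerivAt_firstDeriv _ g).unique ?_)
  have h : (fun y => (S.cobar (n + 1) k).1 (Fin.cons (S.s y) g)) = fun y => k.1 g +
      (-k.1 (Fin.cons (S.s y * g 0) (Fin.tail g)) + ∑ i : Fin n, (-1 : K) ^ ((i : ℕ) + 1 + 1) •
        k.1 (Fin.cons (S.s y) (Fin.contractNth i.castSucc (· * ·) g))) := by
    funext y
    rw [cobar_apply, Fin.sum_univ_succ, Fin.tail_cons]
    simp only [Fin.castSucc_zero, contractNth_zero_cons, Fin.castSucc_succ, contractNth_succ_cons,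
      Fin.val_zero, zero_add, pow_one, neg_smul, one_smul, Fin.val_succ]
  rw [h]
  have h' := ((S.hasFDerivAt_leftDeriv k g).neg.add (HasFDerivAt.fun_sum
    (u := Finset.univ) fun (i : Fin n) _ => (S.hasFDerivAt_firstDeriv k
      (Fin.contractNth i.castSucc (· * ·) g)).const_smul ((-1 : K) ^ ((i : ℕ) + 1 + 1)))).const_add
        (k.1 g)
  refine h'.congr_fderiv (Eq.symm ?_)
  change -(S.leftDeriv k).1 g - (S.cobar n (S.firstDeriv k)).1 g +
    (S.firstDeriv k).1 (Fin.tail g) = _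
  rw [cobar_apply]
  simp only [pow_succ _ (_ + 1), mul_neg_one, neg_smul, Finset.sum_neg_distrib]
  abel

/-- The derivative in the first variables `1, …, p` at the identity, antisymmetrized. -/
def total : (p : ℕ) → {q : ℕ} → S.Cochain p (Form K E q) →ₗ[K] Form K E (q + p)
  | 0, _ =>
    { toFun := fun f => f.1 Fin.elim0
      map_add' := fun _ _ => rfl
      map_smul' := fun _ _ => rfl }
  | p + 1, _ =>
    { toFun := fun f => wedge (total p ∘ₗ S.slice (S.firstDeriv f))
      map_add' := fun f f' => by rw [map_add, map_add, LinearMap.comp_add, map_add]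
      map_smul' := fun a f => by
        rw [map_smul, map_smul, LinearMap.comp_smul, map_smul, RingHom.id_apply] }

theorem total_zero {q : ℕ} (f : S.Cochain 0 (Form K E q)) : S.total 0 f = f.1 Fin.elim0 := rfl

theorem total_succ {p q : ℕ} (f : S.Cochain (p + 1) (Form K E q)) :
    S.total (p + 1) f = wedge (S.total p ∘ₗ S.slice (S.firstDeriv f)) := rfl

/-- The derivative in all variables of functions with values in linear maps. -/
def wedgeTotal (p : ℕ) {q : ℕ} : S.Cochain p (E →L[K] Form K E q) →ₗ[K] Form K E (q + p + 1) where
  toFun F := wedge (S.total p ∘ₗ S.slice F)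
  map_add' F F' := by rw [map_add, LinearMap.comp_add, map_add]
  map_smul' a F := by rw [map_smul, LinearMap.comp_smul, map_smul, RingHom.id_apply]

theorem wedgeTotal_apply {p q : ℕ} (F : S.Cochain p (E →L[K] Form K E q)) :
    S.wedgeTotal p F = wedge (S.total p ∘ₗ S.slice F) := rfl

theorem wedgeTotal_neg_sub_add {p q : ℕ} (F F' F'' : S.Cochain p (E →L[K] Form K E q)) :
    S.wedgeTotal p (-F - F' + F'') = -S.wedgeTotal p F - S.wedgeTotal p F' + S.wedgeTotal p F'' := by
  rw [map_add, map_sub, map_neg]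

/-- Once the term from the second order part of the multiplication is removed, only the symmetric
Hessian in the first variable is left. -/
theorem slice_firstDeriv_slice_leftDeriv {n : ℕ} (k : S.Cochain (n + 1) A) (v w : E) :
    S.slice (S.firstDeriv (S.slice (S.leftDeriv k) v)) w - S.slice (S.firstDeriv k)
      (S.mulDeriv v w) = S.slice (S.firstDeriv (S.slice (S.leftDeriv k) w)) v -
        S.slice (S.firstDeriv k) (S.mulDeriv w v) := by
  have h : ∀ (v w : E) (g : Fin n → V),
      (S.slice (S.firstDeriv (S.slice (S.leftDeriv k) v)) w).1 g =
        fderiv K (fderiv K (fun u => k.1 (Fin.cons (S.s u) g))) S.o w v +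
          (S.slice (S.firstDeriv k) (S.mulDeriv v w)).1 g := by
    intro v w g
    rw [slice_apply, hasFDerivAt_slice]
    refine Eq.trans ?_ (S.fderiv_fderiv_comp_mul (k.2.cons_left 1 g) v w)
    simp only [S.left_inv]
    rfl
  refine Subtype.ext (funext fun g => ?_)
  have h₁ := h v w g
  have h₂ := h w v g
  have h₃ := (isSymmSndFDerivAt_of_analyticAt (k.2.cons_left 1 g)).eq v w
  change (S.slice (S.firstDeriv (S.slice (S.leftDeriv k) v)) w).1 g -
    (S.slice (S.firstDeriv k) (S.mulDeriv v w)).1 g =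
    (S.slice (S.firstDeriv (S.slice (S.leftDeriv k) w)) v).1 g -
    (S.slice (S.firstDeriv k) (S.mulDeriv w v)).1 g
  rw [h₁, h₂, add_sub_cancel_right, add_sub_cancel_right]
  exact h₃.symm

/-- This is where the bracket enters. Modulo symmetric terms the double derivative is a derivative
along `mulDeriv`, whose antisymmetrization is the bracket; the resulting 2 cancels the 1/2 in
`wedgeBracket`. -/
theorem wedge_total_leftDeriv [CharZero K] {p q : ℕ} (k : S.Cochain (p + 1) (Form K E q)) :
    wedge (S.total (p + 1) ∘ₗ S.slice (S.leftDeriv k)) =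
      -wedgeBracket S.bracket (S.total p ∘ₗ S.slice (S.firstDeriv k)) := by
  let Q : E →ₗ[K] E →ₗ[K] S.Cochain p (Form K E q) :=
    S.slice ∘ₗ S.firstDeriv ∘ₗ S.slice (S.leftDeriv k)
  let R : E →ₗ[K] E →ₗ[K] S.Cochain p (Form K E q) :=
    (ContinuousLinearMap.coeLM K ∘ₗ S.mulDeriv.toLinearMap).compr₂ (S.slice (S.firstDeriv k))
  let Q' := Q.compr₂ (S.total p)
  let R' := R.compr₂ (S.total p)
  have hQ : S.total (p + 1) ∘ₗ S.slice (S.leftDeriv k) = wedge ∘ₗ Q' := rfl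
  have hQR : wedge (wedge ∘ₗ (Q' - R')) = 0 := wedge_wedge_eq_zero fun v w => by
    change S.total p (Q v w) - S.total p (R v w) = S.total p (Q w v) - S.total p (R w v)
    rw [← map_sub, ← map_sub]
    exact congrArg _ (S.slice_firstDeriv_slice_leftDeriv k v w)
  have hR : S.bracket.compr₂ (S.total p ∘ₗ S.slice (S.firstDeriv k)) = R' - R'.flip := by
    refine LinearMap.ext fun v => LinearMap.ext fun w => ?_
    change S.total p (S.slice (S.firstDeriv k) (S.mulDeriv v w - S.mulDeriv w v)) = _
    rw [map_sub, map_sub]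
    rfl
  have h₁ : wedge (wedge ∘ₗ Q') = wedge (wedge ∘ₗ R') := by
    have : wedge ∘ₗ (Q' - R') = wedge ∘ₗ Q' - wedge ∘ₗ R' := LinearMap.comp_sub _ _ _
    rw [this, wedge_sub] at hQR
    exact sub_eq_zero.1 hQR
  have h₂ : wedge (wedge ∘ₗ (R' - R'.flip)) = (2 : K) • wedge (wedge ∘ₗ R') := by
    have : wedge ∘ₗ (R' - R'.flip) = wedge ∘ₗ R' - wedge ∘ₗ R'.flip := LinearMap.comp_sub _ _ _
    rw [this, wedge_sub, wedge_wedge_flip, sub_neg_eq_add, two_smul]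
  rw [hQ, h₁, wedgeBracket, hR, h₂, neg_neg, smul_smul]
  norm_num

theorem total_pull_tail {p q : ℕ} (f : S.Cochain p (Form K E q)) :
    S.total (p + 1) (S.pull Fin.tail (fun i => S.isAn_apply i.succ) f) = 0 := by
  rw [total_succ, firstDeriv_pull_tail, map_zero, LinearMap.comp_zero, map_zero]

-- Induction on the number of variables: differentiate the first one by `firstDeriv_cobar` and
-- compare with the Leibniz rule `ceDifferential_wedge`. The `cobar` does not touch the form-valued
-- coefficients, so their Chevalley–Eilenberg differential has to be subtracted.
set_option maxHeartbeats 1000000 in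
theorem total_cobar [CharZero K] : {p q : ℕ} → (k : S.Cochain p (Form K E q)) →
    S.total (p + 1) (S.cobar p k) = ceDifferential S.bracket (q + p) (S.total p k) -
      (-1 : K) ^ p • castForm (by omega) (S.total p (S.post (S.ceDiff q) k))
  | 0, q, k => by
    have h : S.cobar 0 k = S.pull Fin.tail (fun i => S.isAn_apply i.succ) k := by
      rw [cobar, Finset.univ_eq_empty, Finset.sum_empty, add_zero]
    rw [h, total_pull_tail, pow_zero, one_smul, eq_comm, sub_eq_zero]
    rfl
  | p + 1, q, k => by
    let L := S.total p ∘ₗ S.slice (S.firstDeriv k)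
    have h₁ : S.total (p + 1) ∘ₗ S.slice (S.cobar p (S.firstDeriv k)) =
        ceDifferential S.bracket (q + p) ∘ₗ L - (-1 : K) ^ p • (castForm (by omega) ∘ₗ
          (S.total p ∘ₗ S.slice (S.firstDeriv (S.post (S.ceDiff q) k)))) := by
      refine LinearMap.ext fun v => ?_
      have h₂ : S.slice (S.cobar p (S.firstDeriv k)) v =
        S.cobar p (S.slice (S.firstDeriv k) v) := (S.cobar_post _ _).symm
      rw [LinearMap.comp_apply, h₂, total_cobar, ← slice_firstDeriv_post]
      rfl
    have h₂ : S.wedgeTotal (p + 1) (S.cobar p (S.firstDeriv k)) =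
        wedge (ceDifferential S.bracket (q + p) ∘ₗ L) -
          (-1 : K) ^ p • castForm (by omega) (S.total (p + 1) (S.post (S.ceDiff q) k)) := by
      rw [wedgeTotal_apply, h₁]
      exact wedge_sub_smul_castForm _ _ _ _
    have h₃ : S.wedgeTotal (p + 1) (S.pull Fin.tail (fun i => S.isAn_apply i.succ)
        (S.firstDeriv k)) = 0 := by
      have : S.total (p + 1) ∘ₗ S.slice (S.pull Fin.tail (fun i => S.isAn_apply i.succ)
        (S.firstDeriv k)) = 0 := LinearMap.ext fun v =>
          S.total_pull_tail (S.slice (S.firstDeriv k) v)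
      rw [wedgeTotal_apply, this, map_zero]
    have h₄ : ceDifferential S.bracket (q + (p + 1)) (S.total (p + 1) k) =
      wedgeBracket S.bracket L - wedge (ceDifferential S.bracket (q + p) ∘ₗ L) :=
        ceDifferential_wedge _ L
    have h₅ : S.wedgeTotal (p + 1) (S.leftDeriv k) = -wedgeBracket S.bracket L :=
      S.wedge_total_leftDeriv k
    have h₆ := S.wedgeTotal_neg_sub_add (S.leftDeriv k) (S.cobar p (S.firstDeriv k))
      (S.pull Fin.tail (fun i => S.isAn_apply i.succ) (S.firstDeriv k))
    rw [h₂, h₃, h₅, ← firstDeriv_cobar, add_zero, neg_neg] at h₆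
    refine h₆.trans ?_
    rw [h₄, pow_succ, mul_neg_one, neg_smul, sub_neg_eq_add, sub_add]

theorem isAn_cons_mulLast {n : ℕ} (g : Fin (n + 1) → V) (i : Fin (n + 2)) :
    S.IsAn fun h : Fin 2 → V => S.c ((Fin.cons (h 0) (mulLast (h 1) g) : Fin (n + 2) → V) i) := by
  refine Fin.cases ?_ (fun i => ?_) i
  · exact S.isAn_apply 0
  · simp only [Fin.cons_succ]
    by_cases hi : i = Fin.last n
    · subst hi
      simp only [mulLast, Function.update_self]
      exact S.isAn_mul (S.isAn_const _) (S.isAn_apply 1)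
    · simp only [mulLast, Function.update_of_ne hi]
      exact S.isAn_const _

/-- Partial derivatives in different variables commute. The presence of at least two variables keeps
the first apart from the last. -/
theorem lastDeriv_slice_firstDeriv {n : ℕ} (f : S.Cochain (n + 2) A) (v w : E)
    (g : Fin (n + 1) → V) : (S.lastDeriv (S.slice (S.firstDeriv f) v)).1 g w =
      (S.firstDeriv (S.slice (S.lastDeriv f) w)).1 g v := by
  have h := f.2.comp₂ (T := fun a b => Fin.cons a (mulLast b g)) (S.isAn_cons_mulLast g) 1 1
  have h₁ : (S.lastDeriv (S.slice (S.firstDeriv f) v)).1 g =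
      (ContinuousLinearMap.apply K A v) ∘L (S.lastDeriv (S.firstDeriv f)).1 g :=
    (S.hasFDerivAt_lastDeriv _ g).unique
      ((ContinuousLinearMap.apply K A v).hasFDerivAt.comp S.o (S.hasFDerivAt_lastDeriv _ g))
  have h₂ : (S.firstDeriv (S.lastDeriv f)).1 g =
      fderiv K (fun y => fderiv K (fun z => f.1 (Fin.cons (S.s y) (mulLast (S.s z) g))) S.o) S.o := by
    refine Eq.trans (S.hasFDerivAt_firstDeriv _ g).fderiv.symm ?_
    congr 1
    funext y
    refine Eq.trans (S.hasFDerivAt_lastDeriv f _).fderiv.symm ?_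
    simp only [mulLast_cons]
  rw [h₁, hasFDerivAt_slice, h₂]
  refine Eq.trans ?_ (fderiv_fderiv_comm h v w)
  rfl

theorem lastDeriv_snoc_one {n : ℕ} (f : S.Cochain (n + 1) A) (g : Fin n → V) :
    (S.lastDeriv f).1 (Fin.snoc g 1) =
      fderiv K (fun y => f.1 (Fin.snoc g (S.s y))) S.o := by
  refine Eq.trans (S.hasFDerivAt_lastDeriv f _).fderiv.symm ?_
  simp only [mulLast_snoc, one_mul]

-- In `total` the last variable is differentiated innermost, so its derivative can be taken and
-- alternated first. This matches the top face term of `evalLast_cobar` with the derivative part of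
-- `extDeriv`.
set_option maxHeartbeats 1000000 in
theorem total_succ_eq : {p q : ℕ} → (f : S.Cochain (p + 1) (Form K E q)) →
    S.total (p + 1) f = castForm (by omega) (S.total p (S.evalLast p (S.post
      (ContinuousAlternatingMap.alternatizeUncurryFinCLM K E K) (S.lastDeriv f))))
  | 0, q, f => by
    have h : (S.lastDeriv f).1 (Fin.snoc Fin.elim0 1) = (S.firstDeriv f).1 Fin.elim0 := by
      rw [lastDeriv_snoc_one]
      refine Eq.trans ?_ (S.hasFDerivAt_firstDeriv f _).fderiv
      congr 1
      funext y
      refine congrArg f.1 (funext fun i => ?_)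
      have hi : i = Fin.last 0 := Fin.ext (by omega)
      rw [hi, Fin.snoc_last]
      rfl
    rw [castForm_rfl, total_zero, total_succ]
    change wedge ((S.firstDeriv f).1 Fin.elim0 : E →ₗ[K] Form K E q) =
      ContinuousAlternatingMap.alternatizeUncurryFin ((S.lastDeriv f).1 (Fin.snoc Fin.elim0 1))
    rw [h, wedge_coe]
  | p + 1, q, f => by
    let alt := ContinuousAlternatingMap.alternatizeUncurryFinCLM K E (n := q) K
    have h : ∀ v, S.slice (S.firstDeriv (S.evalLast (p + 1) (S.post alt (S.lastDeriv f)))) v =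
        S.evalLast p (S.post alt (S.lastDeriv (S.slice (S.firstDeriv f) v))) := by
      intro v
      have h₁ : S.evalLast (p + 1) (S.post alt (S.lastDeriv f)) =
        S.post alt (S.evalLast (p + 1) (S.lastDeriv f)) := rfl
      have h₂ : ∀ F : S.Cochain (p + 2) (E →L[K] Form K E q),
          S.firstDeriv (S.evalLast (p + 1) F) = S.evalLast p (S.firstDeriv F) := fun F => by
        refine Subtype.ext (funext fun g => (S.hasFDerivAt_firstDeriv _ g).unique ?_)
        have := S.hasFDerivAt_firstDeriv F (Fin.snoc g 1)
        simp only [Fin.cons_snoc_eq_snoc_cons] at this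
        exact this
      rw [h₁, slice_firstDeriv_post, h₂]
      refine Subtype.ext (funext fun g => congrArg alt (ContinuousLinearMap.ext fun w => ?_))
      have h₃ := S.lastDeriv_slice_firstDeriv f v w (Fin.snoc g 1)
      rw [hasFDerivAt_slice] at h₃
      exact h₃.symm
    have h' : S.total (p + 1) ∘ₗ S.slice (S.firstDeriv f) = castForm (by omega) ∘ₗ (S.total p ∘ₗ
        S.slice (S.firstDeriv (S.evalLast (p + 1) (S.post alt (S.lastDeriv f))))) := by
      refine LinearMap.ext fun v => ?_
      refine (total_succ_eq (S.slice (S.firstDeriv f) v)).trans ?_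
      exact congrArg (fun F => castForm _ (S.total p F)) (h v).symm
    rw [total_succ, h']
    exact wedge_castForm _ _

/-- The restriction of a cochain of the double complex to the Lie algebra. -/
def restrict (p : ℕ) {q : ℕ} : S.Cochain (p + 1) (Form K E q) →ₗ[K] Form K E (q + p) :=
  S.total p ∘ₗ S.evalLast p

/-- The chain map property. By `evalLast_cobar` there are two contributions: `total_cobar` yields
the Chevalley–Eilenberg differential and the algebraic part of `extDeriv`, and `total_succ_eq`
yields its derivative part. -/
theorem restrict_cobar [CharZero K] {p q : ℕ} (f : S.Cochain (p + 1) (Form K E q)) :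
    S.restrict (p + 1) (S.cobar (p + 1) f) = ceDifferential S.bracket (q + p) (S.restrict p f) -
      (-1 : K) ^ p • castForm (by omega) (S.restrict p (S.extDeriv f)) := by
  have h : S.restrict p (S.extDeriv f) = S.total p (S.evalLast p (S.post
      (ContinuousAlternatingMap.alternatizeUncurryFinCLM K E K) (S.lastDeriv f))) +
        S.total p (S.post (S.ceDiff q) (S.evalLast p f)) :=
    (S.total p).map_add (S.evalLast p (S.post
      (ContinuousAlternatingMap.alternatizeUncurryFinCLM K E K) (S.lastDeriv f)))
      (S.post (S.ceDiff q) (S.evalLast p f))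
  have h₁ : S.restrict (p + 1) (S.cobar (p + 1) f) =
    S.total (p + 1) (S.cobar p (S.evalLast p f)) + (-1 : K) ^ (p + 1) • S.total (p + 1) f := by
    have h₂ := congrArg (S.total (p + 1)) (S.evalLast_cobar f)
    rw [(S.total (p + 1)).map_add, (S.total (p + 1)).map_smul] at h₂
    exact h₂
  rw [h₁, h, total_cobar, total_succ_eq, pow_succ]
  exact sub_smul_castForm_add _ _ _ _ _

theorem lastDeriv_extendLast {n : ℕ} (f : S.Cochain n A) : S.lastDeriv (S.extendLast n f) = 0 := by
  refine Subtype.ext (funext fun g => (S.hasFDerivAt_lastDeriv _ g).unique ?_)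
  have : (fun y => (S.extendLast n f).1 (mulLast (S.s y) g)) = fun _ => f.1 (Fin.init g) :=
    funext fun y => congrArg f.1 (Fin.init_update_last _ _)
  rw [this]
  exact hasFDerivAt_const (f.1 (Fin.init g)) S.o

/-- The final face of the group differential omits the last variable, so differentiating in all
variables kills it, and `total_cobar` applies. -/
theorem total_groupDiff [CharZero K] {p q : ℕ} (f : S.Cochain p (Form K E q)) :
    S.total (p + 1) (S.groupDiff p f) = ceDifferential S.bracket (q + p) (S.total p f) -
      (-1 : K) ^ p • castForm (by omega) (S.total p (S.post (S.ceDiff q) f)) := by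
  have h : S.total (p + 1) (S.extendLast p f) = 0 := by
    rw [total_succ_eq, lastDeriv_extendLast, map_zero, map_zero, map_zero, map_zero]
  rw [groupDiff, LinearMap.add_apply, LinearMap.smul_apply, map_add, map_smul, h, smul_zero,
    add_zero, total_cobar]

end GroupChart

end Total

/-! ### The left invariant frame and the exactness of the columns -/

section Frame

open Filter Topology

variable {K : Type*} [NontriviallyNormedField K] [CompleteSpace K]
  {E : Type*} [NormedAddCommGroup E] [NormedSpace K E] [FiniteDimensional K E]
  {V : Type*} [TopologicalSpace V] [Group V]
  {Z : Type*} [NormedAddCommGroup Z] [NormedSpace K Z]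

theorem analyticAt_form_of_toContinuousMultilinearMap {q : ℕ} {F : Z → Form K E q} {z : Z}
    (h : AnalyticAt K (fun y => (F y).toContinuousMultilinearMap) z) : AnalyticAt K F z := by
  have : FiniteDimensional K (ContinuousMultilinearMap K (fun _ : Fin q => E) K) :=
    Module.Finite.of_injective
      (N := MultilinearMap K (fun _ : Fin q => E) K)
      ({ toFun := fun η => η.toMultilinearMap
         map_add' := fun _ _ => rfl
         map_smul' := fun _ _ => rfl } : ContinuousMultilinearMap K (fun _ : Fin q => E) K →ₗ[K]
          MultilinearMap K (fun _ : Fin q => E) K)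
      fun _ _ h => ContinuousMultilinearMap.toMultilinearMap_injective h
  let T : Form K E q →ₗ[K] ContinuousMultilinearMap K (fun _ : Fin q => E) K :=
    { toFun := fun η => η.toContinuousMultilinearMap
      map_add' := fun _ _ => rfl
      map_smul' := fun _ _ => rfl }
  obtain ⟨R, hR⟩ := T.exists_leftInverse_of_injective
    (LinearMap.ker_eq_bot.2 ContinuousAlternatingMap.toContinuousMultilinearMap_injective)
  have h' := ((LinearMap.toContinuousLinearMap R).analyticAt _).comp h
  convert h' using 1
  funext y
  exact (congrArg (fun S : Form K E q →ₗ[K] Form K E q => S (F y)) hR).symm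

/-- Pullback of a form along L is polynomial in L and linear in the form. -/
theorem analyticAt_compContinuousLinearMap {q : ℕ} {F : Z → Form K E q} {L : Z → E →L[K] E} {z : Z}
    (hF : AnalyticAt K F z) (hL : AnalyticAt K L z) :
    AnalyticAt K (fun y => (F y).compContinuousLinearMap (L y)) z := by
  refine analyticAt_form_of_toContinuousMultilinearMap ?_
  have h₁ : AnalyticAt K (fun y => fun _ : Fin q => L y) z := analyticAt_pi_iff.2 fun _ => hL
  have h₂ := ((ContinuousMultilinearMap.compContinuousLinearMapContinuousMultilinear K
    (fun _ : Fin q => E) (fun _ : Fin q => E) K).analyticAt).comp_of_eq h₁ rfl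
  let T : Form K E q →L[K] ContinuousMultilinearMap K (fun _ : Fin q => E) K :=
    ContinuousAlternatingMap.toContinuousMultilinearMapCLM K
  have h₃ := (T.analyticAt _).comp hF
  exact analyticAt_clm_apply h₂ h₃

theorem relExtDeriv_relExtDeriv (j : E →L[K] Z) {q : ℕ} {F : Z → Form K E q} {z : Z}
    (hF : AnalyticAt K F z) : relExtDeriv j (relExtDeriv j F) z = 0 := by
  have h₂ : HasFDerivAt (fun y => altPrecomp j q (fderiv K F y))
      (altPrecomp j q ∘L fderiv K (fderiv K F) z) z :=
    (altPrecomp j q).hasFDerivAt.comp z hF.fderiv.differentiableAt.hasFDerivAt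
  rw [relExtDeriv, relExtDeriv_eq_altPrecomp, h₂.fderiv, ← wedge_coe]
  let N : E →ₗ[K] E →ₗ[K] Form K E q :=
    (ContinuousLinearMap.coeLM K ∘ₗ ((ContinuousLinearMap.compL K E Z (Form K E q)).flip j ∘L
      fderiv K (fderiv K F) z ∘L j).toLinearMap)
  have hN : wedge (wedge ∘ₗ N) = 0 := wedge_wedge_eq_zero fun v w =>
    (isSymmSndFDerivAt_of_analyticAt hF).eq (j v) (j w)
  refine Eq.trans (congrArg wedge (LinearMap.ext fun v => ?_)) hN
  exact (wedge_coe _).symm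

namespace GroupChart

/-! ### The Maurer–Cartan form and de Rham differential in the left invariant frame -/

variable (S : GroupChart K E V)

theorem analyticAt_mul_left (a b : V) : AnalyticAt K (fun z => S.c (a * S.s z)) (S.c b) := by
  have := (S.analyticAt_mul a b).comp₂ (f := fun _ : E => S.c a) (g := fun z : E => z)
    analyticAt_const analyticAt_id
  simpa only [S.left_inv] using this

/-- The left invariant frame. -/
def frame (y : E) : E →L[K] E := fderiv K (fun z => S.c (S.s y * S.s z)) S.o

/-- The dual of the left invariant frame. -/
def coframe (x : E) : E →L[K] E := fderiv K (fun z => S.c ((S.s x)⁻¹ * S.s z)) x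

theorem analyticAt_frame (a : V) : AnalyticAt K S.frame (S.c a) :=
  have : CompleteSpace E := FiniteDimensional.complete K E
  analyticAt_fderiv_right (S.analyticAt_mul a 1)

theorem analyticAt_coframe (a : V) : AnalyticAt K S.coframe (S.c a) := by
  have : CompleteSpace E := FiniteDimensional.complete K E
  have h : AnalyticAt K (fun z : E × E => S.c ((S.s z.1)⁻¹ * S.s z.2)) (S.c a, S.c a) := by
    have h₁ : AnalyticAt K (fun z : E × E => S.c (S.s z.1)⁻¹) (S.c a, S.c a) :=
      (S.analyticAt_inv a).comp_of_eq analyticAt_fst rfl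
    have h₂ : AnalyticAt K (fun z : E × E => (S.c (S.s z.1)⁻¹, z.2)) (S.c a, S.c a) :=
      h₁.prod analyticAt_snd
    have := (S.analyticAt_mul a⁻¹ a).comp_of_eq h₂ (by rw [S.left_inv])
    simpa only [S.left_inv, Function.comp_def] using this
  have h₁ : AnalyticAt K (fun x : E => (x, x)) (S.c a) := analyticAt_id.prod analyticAt_id
  have h₂ : AnalyticAt K (fun x : E => fderiv K (fun z : E × E => S.c ((S.s z.1)⁻¹ * S.s z.2))
      (x, x) ∘L ContinuousLinearMap.inr K E E) (S.c a) :=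
    (((ContinuousLinearMap.compL K E (E × E) E).flip
      (ContinuousLinearMap.inr K E E)).analyticAt _).comp (h.fderiv.comp_of_eq h₁ rfl)
  refine h₂.congr ?_
  have ht : Tendsto (fun x : E => (x, x)) (𝓝 (S.c a)) (𝓝 (S.c a, S.c a)) :=
    (by fun_prop : Continuous fun x : E => (x, x)).continuousAt
  filter_upwards [ht.eventually h.eventually_analyticAt] with x hx
  exact (HasFDerivAt.comp x hx.differentiableAt.hasFDerivAt
    (hasFDerivAt_prodMk_right x x)).fderiv.symm

theorem hasFDerivAt_frame (a : V) :
    HasFDerivAt (fun z => S.c (a * S.s z)) (S.frame (S.c a)) S.o := by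
  have := (S.analyticAt_mul_left a 1).differentiableAt.hasFDerivAt
  rw [frame, S.left_inv]
  exact this

theorem hasFDerivAt_coframe (a : V) :
    HasFDerivAt (fun z => S.c (a⁻¹ * S.s z)) (S.coframe (S.c a)) (S.c a) := by
  have := (S.analyticAt_mul_left a⁻¹ a).differentiableAt.hasFDerivAt
  rw [coframe, S.left_inv]
  exact this

theorem hasFDerivAt_c_s (a : V) :
    HasFDerivAt (fun z => S.c (S.s z)) (ContinuousLinearMap.id K E) (S.c a) :=
  (hasFDerivAt_id _).congr_of_eventuallyEq (S.eventually_right_inv a)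

theorem coframe_comp_frame (a : V) :
    S.coframe (S.c a) ∘L S.frame (S.c a) = ContinuousLinearMap.id K E := by
  refine HasFDerivAt.unique ?_ (S.hasFDerivAt_c_s 1)
  have h : S.c a = S.c (a * S.s S.o) := by rw [s_o, mul_one]
  have h₁ := S.hasFDerivAt_coframe a
  have := HasFDerivAt.comp (g := fun z => S.c (a⁻¹ * S.s z)) (f := fun z => S.c (a * S.s z)) S.o
    (g' := S.coframe (S.c a)) (by rwa [← h]) (S.hasFDerivAt_frame a)
  simp only [Function.comp_def, S.left_inv, inv_mul_cancel_left] at this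
  exact this

theorem frame_comp_coframe (a : V) :
    S.frame (S.c a) ∘L S.coframe (S.c a) = ContinuousLinearMap.id K E := by
  refine HasFDerivAt.unique ?_ (S.hasFDerivAt_c_s a)
  have h : S.o = S.c (a⁻¹ * S.s (S.c a)) := by rw [S.left_inv, inv_mul_cancel]; rfl
  have h₁ := S.hasFDerivAt_frame a
  have := HasFDerivAt.comp (g := fun z => S.c (a * S.s z)) (f := fun z => S.c (a⁻¹ * S.s z)) (S.c a)
    (g' := S.frame (S.c a)) (by rwa [← h]) (S.hasFDerivAt_coframe a)
  simpa only [Function.comp_def, S.left_inv, mul_inv_cancel_left] using this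

/-- Left invariance of the Maurer–Cartan form, from (ab)⁻¹(au) = b⁻¹u. -/
theorem coframe_comp_fderiv (a b : V) : S.coframe (S.c (a * b)) ∘L
    fderiv K (fun u => S.c (a * S.s u)) (S.c b) = S.coframe (S.c b) := by
  refine HasFDerivAt.unique ?_ (S.hasFDerivAt_coframe b)
  have h : S.c (a * b) = S.c (a * S.s (S.c b)) := by rw [S.left_inv]
  have h₁ := S.hasFDerivAt_coframe (a * b)
  have := HasFDerivAt.comp (g := fun z => S.c ((a * b)⁻¹ * S.s z)) (f := fun z => S.c (a * S.s z))
    (S.c b) (g' := S.coframe (S.c (a * b))) (by rwa [← h])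
    (S.analyticAt_mul_left a b).differentiableAt.hasFDerivAt
  simpa only [Function.comp_def, S.left_inv, mul_inv_rev, mul_assoc, inv_mul_cancel_left] using this

theorem eventually_mem_range (a : V) : ∀ᶠ y in 𝓝 (S.c a), ∃ b, S.c b = y :=
  S.isOpenEmbedding.isOpen_range.mem_nhds ⟨a, rfl⟩

theorem frame_o : S.frame S.o = ContinuousLinearMap.id K E := by
  have h := S.hasFDerivAt_frame 1
  simp only [one_mul] at h
  exact h.unique (S.hasFDerivAt_c_s 1)

theorem coframe_o : S.coframe S.o = ContinuousLinearMap.id K E := by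
  have h := S.coframe_comp_frame 1
  change S.coframe S.o ∘L S.frame S.o = _ at h
  rwa [frame_o, ContinuousLinearMap.comp_id] at h

/-- Differentiate coframe ∘ frame = id at the identity, where both factors are the identity map. -/
theorem fderiv_coframe (v w : E) : fderiv K S.coframe S.o v w = -S.mulDeriv v w := by
  have : CompleteSpace E := FiniteDimensional.complete K E
  have h₁ := (S.analyticAt_frame 1).differentiableAt.hasFDerivAt
  have h₂ := (S.analyticAt_coframe 1).differentiableAt.hasFDerivAt
  have h₃ := h₂.clm_comp h₁
  have h₄ : HasFDerivAt (fun y => S.coframe y ∘L S.frame y) (0 : E →L[K] E →L[K] E) (S.c 1) := by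
    refine (hasFDerivAt_const (ContinuousLinearMap.id K E) (S.c 1)).congr_of_eventuallyEq ?_
    filter_upwards [S.eventually_mem_range 1]
    rintro _ ⟨b, rfl⟩
    exact S.coframe_comp_frame b
  have h₅ := congrArg (fun T : E →L[K] E →L[K] E => T v w) (h₃.unique h₄)
  change S.coframe S.o (S.mulDeriv v w) + fderiv K S.coframe S.o v (S.frame S.o w) = 0 at h₅
  rw [coframe_o, frame_o] at h₅
  exact eq_neg_of_add_eq_zero_right h₅

/-- The Maurer–Cartan equation at the identity: the derivative of the coframe is -`mulDeriv`, and
alternation turns it into structure constants. Thus the zeroth order part of d in the left invariant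
frame is the Chevalley–Eilenberg differential. -/
theorem alternatizeUncurryFin_fderivComp [CharZero K] {q : ℕ} (η : Form K E q) :
    ContinuousAlternatingMap.alternatizeUncurryFin
      (η.fderivCompContinuousLinearMap (ContinuousLinearMap.id K E) ∘L fderiv K S.coframe S.o) =
      ceDifferential S.bracket q η := by
  cases q with
  | zero =>
    have h : η.fderivCompContinuousLinearMap (ContinuousLinearMap.id K E) ∘L
        fderiv K S.coframe S.o = 0 := by
      rw [ContinuousAlternatingMap.fderivCompContinuousLinearMap_of_isEmpty]
      rfl
    rw [h]
    exact (ContinuousAlternatingMap.alternatizeUncurryFinCLM K E K).map_zero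
  | succ q =>
    let R : E →ₗ[K] E →ₗ[K] Form K E q :=
      (ContinuousLinearMap.coeLM K ∘ₗ S.mulDeriv.toLinearMap).compr₂ (curryForm η)
    have h₁ : S.bracket.compr₂ (curryForm η) = R - R.flip := by
      refine LinearMap.ext fun v => LinearMap.ext fun w => ?_
      exact (curryForm η).map_sub _ _
    have h₂ : wedge (wedge ∘ₗ (R - R.flip)) = (2 : K) • wedge (wedge ∘ₗ R) := by
      have : wedge ∘ₗ (R - R.flip) = wedge ∘ₗ R - wedge ∘ₗ R.flip := LinearMap.comp_sub _ _ _
      rw [this, wedge_sub, wedge_wedge_flip, sub_neg_eq_add, two_smul]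
    rw [ceDifferential_succ, wedgeBracket, h₁, h₂, smul_smul, one_div,
      inv_mul_cancel₀ two_ne_zero, one_smul, ← wedge_coe, ← wedge_neg]
    congr 1
    refine LinearMap.ext fun v => ?_
    change η.fderivCompContinuousLinearMap (ContinuousLinearMap.id K E) (fderiv K S.coframe S.o v) =
      -wedge (R v)
    rw [ContinuousAlternatingMap.fderivCompContinuousLinearMap_eq_alternatizeUncurryFin,
      ← wedge_neg]
    refine Eq.trans (wedge_coe _).symm (congrArg wedge (LinearMap.ext fun w => ?_))
    change (η.curryLeft (fderiv K S.coframe S.o v w)).compContinuousLinearMap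
      (ContinuousLinearMap.id K E) = -(curryForm η (S.mulDeriv v w))
    rw [fderiv_coframe]
    exact (curryForm η).map_neg _

/-- A cochain of the double complex, as a differential form in the last variable. -/
def toDiffForm {n q : ℕ} (f : S.Cochain (n + 1) (Form K E q)) (z : Fin (n + 1) → E) : Form K E q :=
  (f.1 fun i => S.s (z i)).compContinuousLinearMap (S.coframe (z (Fin.last n)))

/-- The inclusion of the last variable. -/
def lastIncl (n : ℕ) : E →L[K] (Fin (n + 1) → E) :=
  ContinuousLinearMap.single K (fun _ : Fin (n + 1) => E) (Fin.last n)

theorem hasFDerivAt_update_last {n : ℕ} (z : Fin (n + 1) → E) (x : E) :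
    HasFDerivAt (Function.update z (Fin.last n)) (lastIncl (K := K) n) x := by
  refine (hasFDerivAt_update (𝕜 := K) z x).congr_fderiv ?_
  ext e i
  by_cases hi : i = Fin.last n
  · subst hi; simp [lastIncl]
  · simp [lastIncl, hi]

theorem analyticAt_toDiffForm {n q : ℕ} (f : S.Cochain (n + 1) (Form K E q))
    (g : Fin (n + 1) → V) : AnalyticAt K (S.toDiffForm f) fun i => S.c (g i) :=
  analyticAt_compContinuousLinearMap (f.2 g) ((S.analyticAt_coframe _).comp_of_eq
    ((ContinuousLinearMap.proj (R := K) (φ := fun _ : Fin (n + 1) => E) (Fin.last n)).analyticAt _)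
    rfl)

theorem extDeriv_pullback_toDiffForm [CharZero K] {n q : ℕ} (f : S.Cochain (n + 1) (Form K E q))
    (g : Fin (n + 1) → V) :
    _root_.extDeriv (fun z => (f.1 (mulLast (S.s z) g)).compContinuousLinearMap (S.coframe z)) S.o =
      (S.extDeriv f).1 g := by
  have h := (S.hasFDerivAt_lastDeriv f g).continuousAlternatingMapCompContinuousLinearMap
    (S.analyticAt_coframe 1).differentiableAt.hasFDerivAt
  have h₁ : (S.extDeriv f).1 g =
    ContinuousAlternatingMap.alternatizeUncurryFin ((S.lastDeriv f).1 g) +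
      ceDifferential S.bracket q (f.1 g) := rfl
  rw [_root_.extDeriv, h.fderiv, ContinuousAlternatingMap.alternatizeUncurryFin_add, h₁,
    ← S.alternatizeUncurryFin_fderivComp]
  change ContinuousAlternatingMap.alternatizeUncurryFin (_ ∘L (S.lastDeriv f).1 g) +
    ContinuousAlternatingMap.alternatizeUncurryFin (_ ∘L fderiv K S.coframe S.o) = _
  rw [s_o, mulLast_one, coframe_o]
  rfl

/-- Left translation by the last variable reduces the claim to the identity: d commutes with
pullback, and the coframe is left invariant. There the product rule of
`extDeriv_pullback_toDiffForm` applies. -/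
theorem relExtDeriv_toDiffForm_comp_frame [CharZero K] {n q : ℕ}
    (f : S.Cochain (n + 1) (Form K E q)) (g : Fin (n + 1) → V) :
    (relExtDeriv (lastIncl n) (S.toDiffForm f) fun i => S.c (g i)).compContinuousLinearMap
      (S.frame (S.c (g (Fin.last n)))) = (S.extDeriv f).1 g := by
  have : CompleteSpace E := FiniteDimensional.complete K E
  set a := g (Fin.last n) with ha
  let η : E → Form K E q := fun x =>
    (f.1 (Function.update g (Fin.last n) (S.s x))).compContinuousLinearMap (S.coframe x)
  have hη : η = fun x => S.toDiffForm f (Function.update (fun i => S.c (g i)) (Fin.last n) x) := by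
    funext x
    simp only [η, toDiffForm, Function.update_self]
    refine congrArg (fun A => ContinuousAlternatingMap.compContinuousLinearMap A (S.coframe x))
      (congrArg f.1 (funext fun i => ?_))
    by_cases hi : i = Fin.last n
    · subst hi; simp
    · simp [hi, S.left_inv]
  have hup : Function.update (fun i => S.c (g i)) (Fin.last n) (S.c a) = fun i => S.c (g i) :=
    Function.update_eq_self _ _
  have hηd : HasFDerivAt η (fderiv K (S.toDiffForm f) (fun i => S.c (g i)) ∘L lastIncl n)
      (S.c a) := by
    rw [hη]
    have h₁ : HasFDerivAt (S.toDiffForm f) (fderiv K (S.toDiffForm f) fun i => S.c (g i))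
        (Function.update (fun i => S.c (g i)) (Fin.last n) (S.c a)) := by
      rw [hup]
      exact (S.analyticAt_toDiffForm f g).differentiableAt.hasFDerivAt
    exact h₁.comp _ (hasFDerivAt_update_last _ _)
  have hext : _root_.extDeriv η (S.c a) =
      relExtDeriv (lastIncl n) (S.toDiffForm f) fun i => S.c (g i) := by
    rw [_root_.extDeriv, hηd.fderiv, relExtDeriv]
  have hLo : S.c (a * S.s S.o) = S.c a := by rw [s_o, mul_one]
  -- Pull back along left translation by a, whose derivative at the identity is the frame at a.
  have hpull := extDeriv_pullback (𝕜 := K) (f := fun z => S.c (a * S.s z)) (x := S.o)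
    (r := ω) (show DifferentiableAt K η (S.c (a * S.s S.o)) by
      rw [hLo]; exact hηd.differentiableAt)
    ((S.analyticAt_mul_left a 1).contDiffAt) le_top
  rw [hLo, hext, (S.hasFDerivAt_frame a).fderiv] at hpull
  rw [← hpull, ← extDeriv_pullback_toDiffForm]
  refine Filter.EventuallyEq.extDeriv_eq ?_
  filter_upwards [S.eventually_mem_range 1]
  rintro _ ⟨b, rfl⟩
  simp only [η, S.left_inv]
  rw [← S.coframe_comp_fderiv a b]
  rfl

theorem compContinuousLinearMap_frame_coframe {q : ℕ} (η : Form K E q) (a : V) :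
    (η.compContinuousLinearMap (S.frame (S.c a))).compContinuousLinearMap (S.coframe (S.c a)) =
      η := by
  have : (η.compContinuousLinearMap (S.frame (S.c a))).compContinuousLinearMap (S.coframe (S.c a)) =
    η.compContinuousLinearMap (S.frame (S.c a) ∘L S.coframe (S.c a)) := rfl
  rw [this, frame_comp_coframe]
  rfl

theorem relExtDeriv_toDiffForm [CharZero K] {n q : ℕ} (f : S.Cochain (n + 1) (Form K E q))
    (g : Fin (n + 1) → V) : relExtDeriv (lastIncl n) (S.toDiffForm f) (fun i => S.c (g i)) =
      S.toDiffForm (S.extDeriv f) fun i => S.c (g i) := by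
  rw [← S.compContinuousLinearMap_frame_coframe (relExtDeriv _ _ _) (g (Fin.last n)),
    relExtDeriv_toDiffForm_comp_frame, toDiffForm]
  simp only [S.left_inv]

theorem eventually_mem_range_pi {n : ℕ} (g : Fin n → V) :
    ∀ᶠ z in 𝓝 fun i => S.c (g i), ∃ g' : Fin n → V, (fun i => S.c (g' i)) = z := by
  have : ∀ᶠ z : Fin n → E in 𝓝 fun i => S.c (g i), ∀ i, ∃ b, S.c b = z i :=
    eventually_all.2 fun i =>
      ((continuous_apply i).tendsto fun i => S.c (g i)).eventually (S.eventually_mem_range (g i))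
  filter_upwards [this] with z hz
  choose g' hg' using hz
  exact ⟨g', funext hg'⟩

theorem extDeriv_eq_of_toDiffForm {n q : ℕ} (f f' : S.Cochain (n + 1) (Form K E q))
    (h : ∀ g : Fin (n + 1) → V, S.toDiffForm f (fun i => S.c (g i)) =
      S.toDiffForm f' fun i => S.c (g i)) : f = f' := by
  refine Subtype.ext (funext fun g => ?_)
  have h₁ := congrArg (fun η => ContinuousAlternatingMap.compContinuousLinearMap η
    (S.frame (S.c (g (Fin.last n))))) (h g)
  have h₂ : ∀ f : S.Cochain (n + 1) (Form K E q),
      (S.toDiffForm f fun i => S.c (g i)).compContinuousLinearMap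
        (S.frame (S.c (g (Fin.last n)))) = f.1 g := fun f => by
    have : (S.toDiffForm f fun i => S.c (g i)).compContinuousLinearMap
        (S.frame (S.c (g (Fin.last n)))) = (f.1 fun i => S.s (S.c (g i))).compContinuousLinearMap
          (S.coframe (S.c (g (Fin.last n))) ∘L S.frame (S.c (g (Fin.last n)))) := rfl
    rw [this, coframe_comp_frame]
    simp only [S.left_inv]
    rfl
  simp only [h₂] at h₁
  exact h₁

theorem extDeriv_extDeriv [CharZero K] {n q : ℕ} (f : S.Cochain (n + 1) (Form K E q)) :
    S.extDeriv (S.extDeriv f) = 0 := by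
  refine S.extDeriv_eq_of_toDiffForm _ _ fun g => ?_
  have h : S.toDiffForm (S.extDeriv f) =ᶠ[𝓝 fun i => S.c (g i)]
      relExtDeriv (lastIncl n) (S.toDiffForm f) := by
    filter_upwards [S.eventually_mem_range_pi g]
    rintro _ ⟨g', rfl⟩
    exact (S.relExtDeriv_toDiffForm f g').symm
  rw [← relExtDeriv_toDiffForm, relExtDeriv_congr _ h,
    relExtDeriv_relExtDeriv _ (S.analyticAt_toDiffForm f g)]
  rfl

/-- The columns of the double complex are exact in positive degrees. -/
theorem exists_extDeriv_eq [CharZero K] [CompactSpace V] (hK : InvNatBounded K)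
    (hE : ∀ n : ℕ, ∀ z : Fin n → E, ∀ s ∈ 𝓝 z, ∃ t ⊆ s, IsClopen t ∧ z ∈ t) {n q : ℕ}
    (f : S.Cochain (n + 1) (Form K E (q + 1))) (hf : S.extDeriv f = 0) :
    ∃ b : S.Cochain (n + 1) (Form K E q), S.extDeriv b = f := by
  have hc : Continuous fun g : Fin (n + 1) → V => fun i => S.c (g i) :=
    continuous_pi fun i => S.isOpenEmbedding.continuous.comp (continuous_apply i)
  have hd : ∀ g : Fin (n + 1) → V, relExtDeriv (lastIncl n) (S.toDiffForm f)
      (fun i => S.c (g i)) = 0 := fun g => by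
    rw [relExtDeriv_toDiffForm, hf]
    rfl
  -- Local primitives, with the first n variables as parameters, are glued over the compact image of
  -- V^(n+1); gluing happens in the model space, where the clopen neighbourhoods are given.
  obtain ⟨β, hβ⟩ := IsCompact.exists_glue (hE (n + 1)) (isCompact_range hc)
    (Q := fun (β : (Fin (n + 1) → E) → Form K E q) z =>
      AnalyticAt K β z ∧ relExtDeriv (lastIncl n) β z = S.toDiffForm f z)
    (fun β β' z h hβ => ⟨hβ.1.congr h, (relExtDeriv_congr _ h).symm.trans hβ.2⟩) (by
      rintro _ ⟨g, rfl⟩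
      obtain ⟨β, h₁, h₂⟩ := exists_relExtDeriv_eq hK (lastIncl n)
        (ContinuousLinearMap.proj (R := K) (φ := fun _ : Fin (n + 1) => E) (Fin.last n))
        (fun e => by simp [lastIncl]) (S.analyticAt_toDiffForm f g) (by
          filter_upwards [S.eventually_mem_range_pi g]
          rintro _ ⟨g', rfl⟩
          exact hd g')
      exact ⟨β, h₁.eventually_analyticAt.and h₂⟩)
  have hβ' : ∀ g : Fin (n + 1) → V, _ := fun g => hβ _ ⟨g, rfl⟩
  -- Rewriting the glued primitive in the left invariant frame makes it a cochain again.
  let b : S.Cochain (n + 1) (Form K E q) :=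
    ⟨fun g => (β fun i => S.c (g i)).compContinuousLinearMap (S.frame (S.c (g (Fin.last n)))), by
      intro g
      have h₁ : AnalyticAt K (fun z : Fin (n + 1) → E =>
          (β z).compContinuousLinearMap (S.frame (z (Fin.last n)))) fun i => S.c (g i) :=
        analyticAt_compContinuousLinearMap (hβ' g).1 ((S.analyticAt_frame _).comp_of_eq
          ((ContinuousLinearMap.proj (R := K) (φ := fun _ : Fin (n + 1) => E)
            (Fin.last n)).analyticAt _) rfl)
      refine h₁.congr ?_
      filter_upwards [S.eventually_mem_range_pi g]
      rintro _ ⟨g', rfl⟩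
      simp only [S.left_inv]⟩
  refine ⟨b, S.extDeriv_eq_of_toDiffForm _ _ fun g => ?_⟩
  have h : S.toDiffForm b =ᶠ[𝓝 fun i => S.c (g i)] β := by
    filter_upwards [S.eventually_mem_range_pi g]
    rintro _ ⟨g', rfl⟩
    simp only [toDiffForm, b, S.left_inv]
    exact S.compContinuousLinearMap_frame_coframe _ _
  rw [← relExtDeriv_toDiffForm, relExtDeriv_congr _ h]
  exact (hβ' g).2

end GroupChart

end Frame

/-! ### Comparison of the rows and the columns of the double complex -/

section Comparison

open Filter Topology

variable {K : Type*} [NontriviallyNormedField K] [CompleteSpace K]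
  {E : Type*} [NormedAddCommGroup E] [NormedSpace K E] [FiniteDimensional K E]
  {V : Type*} [TopologicalSpace V] [Group V]
  {Z : Type*} [NormedAddCommGroup Z] [NormedSpace K Z] [CompleteSpace Z]

/-- The coboundaries of the Chevalley–Eilenberg complex. -/
def ceRange (br : E →ₗ[K] E →ₗ[K] E) : (n : ℕ) → Submodule K (Form K E n)
  | 0 => ⊥
  | n + 1 => LinearMap.range (ceDifferential br n)

theorem castForm_mem_ceRange (br : E →ₗ[K] E →ₗ[K] E) {a b : ℕ} (h : a = b) (η : Form K E a) :
    castForm h η ∈ ceRange br b ↔ η ∈ ceRange br a := by subst h; rfl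

namespace GroupChart

variable (S : GroupChart K E V)

/-- At the start of a row the differential is f(h) - f(gh), so its kernel consists of constants,
that is, of left invariant forms. -/
theorem eq_const_of_cobar_eq_zero {q : ℕ} (f : S.Cochain 1 (Form K E q)) (hf : S.cobar 1 f = 0) :
    f = S.const 1 (S.restrict 0 f) := by
  refine Subtype.ext (funext fun g => ?_)
  have h := S.cobar_snoc f g 1
  have h₁ : (-1 : K) ^ (0 + 1) = -1 := pow_one _
  rw [hf, mulLast_one, Finset.univ_eq_empty, Finset.sum_empty, h₁, neg_smul, one_smul,
    add_zero] at h
  have h' : f.1 g = f.1 (Fin.snoc (Fin.tail g) 1) := (eq_of_sub_eq_zero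
    ((sub_eq_add_neg _ _).trans h.symm)).symm
  rw [h']
  exact congrArg (fun g' => f.1 (Fin.snoc g' 1)) (Subsingleton.elim _ _)

theorem cobar_const {q : ℕ} (η : Form K E q) : S.cobar 1 (S.const 1 η) = 0 := by
  refine Subtype.ext (funext fun g => ?_)
  have h₁ : (-1 : K) ^ (0 + 1) = -1 := pow_one _
  rw [cobar_apply, Fin.sum_univ_succ, Finset.univ_eq_empty, Finset.sum_empty, Fin.val_zero,
    h₁, neg_smul, one_smul, add_zero]
  exact add_neg_cancel η

theorem extDeriv_eq_post {n q : ℕ} (f : S.Cochain (n + 1) (Form K E q)) (hf : S.lastDeriv f = 0) :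
    S.extDeriv f = S.post (S.ceDiff q) f := by
  rw [extDeriv, LinearMap.add_apply, LinearMap.comp_apply, hf, map_zero, zero_add]

theorem extDeriv_const {n q : ℕ} (η : Form K E q) :
    S.extDeriv (S.const (n + 1) η) = S.const (n + 1) (ceDifferential S.bracket q η) := by
  rw [extDeriv_eq_post]
  · rfl
  · exact Subtype.ext (funext fun g => (S.hasFDerivAt_lastDeriv _ g).unique (hasFDerivAt_const η S.o))

/-- The columns of the double complex are exact in positive degrees. -/
def ColumnsExact : Prop := ∀ (n q : ℕ) (f : S.Cochain (n + 1) (Form K E (q + 1))),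
  S.extDeriv f = 0 → ∃ b : S.Cochain (n + 1) (Form K E q), S.extDeriv b = f

variable {S}

/-- Zigzag for injectivity, by induction on p: lift f along its row to b, then correct b until it is
closed along the column. The obstruction `extDeriv` b has again both differentials zero, lies one
step to the left and one degree higher, and still restricts to a coboundary. -/
theorem ColumnsExact.exists_cobar_eq [CharZero K] (hS : S.ColumnsExact) :
    ∀ (p q : ℕ) (f : S.Cochain (p + 2) (Form K E q)), S.cobar (p + 2) f = 0 → S.extDeriv f = 0 →
      S.restrict (p + 1) f ∈ ceRange S.bracket (q + (p + 1)) →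
      ∃ b : S.Cochain (p + 1) (Form K E q), S.cobar (p + 1) b = f ∧ S.extDeriv b = 0 := by
  have hlift : ∀ (p q : ℕ) (f : S.Cochain (p + 2) (Form K E q)), S.cobar (p + 2) f = 0 →
      S.extDeriv f = 0 → S.restrict (p + 1) f ∈ ceRange S.bracket (q + (p + 1)) →
      ∃ b : S.Cochain (p + 1) (Form K E q), S.cobar (p + 1) b = f ∧
        S.cobar (p + 1) (S.extDeriv b) = 0 ∧
        S.restrict p (S.extDeriv b) ∈ ceRange S.bracket (q + 1 + p) := by
    intro p q f h₁ h₂ h₃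
    have h₄ := S.evalLast_cobar f
    rw [h₁, map_zero] at h₄
    -- The lift is the row contraction of f, up to sign.
    obtain ⟨b, hb⟩ : ∃ b : S.Cochain (p + 1) (Form K E q), S.cobar (p + 1) b = f := by
      refine ⟨(-(-1 : K) ^ (p + 1 + 1)) • S.evalLast (p + 1) f, ?_⟩
      rw [map_smul, eq_neg_of_add_eq_zero_left h₄.symm, neg_smul, smul_neg, neg_neg, smul_smul,
        ← pow_add, Even.neg_one_pow ⟨p + 1 + 1, rfl⟩, one_smul]
    refine ⟨b, hb, ?_, ?_⟩
    · rw [cobar_extDeriv, hb, h₂]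
    · have h₅ := S.restrict_cobar b
      rw [hb] at h₅
      rw [← castForm_mem_ceRange S.bracket (show q + 1 + p = q + p + 1 by omega)]
      have h₆ : (-1 : K) ^ p • castForm (show q + 1 + p = q + p + 1 by omega)
          (S.restrict p (S.extDeriv b)) ∈ ceRange S.bracket (q + p + 1) := by
        rw [← sub_sub_cancel (ceDifferential S.bracket (q + p) (S.restrict p b))
          ((-1 : K) ^ p • _), ← h₅]
        exact Submodule.sub_mem _ ⟨_, rfl⟩ h₃
      exact (Submodule.smul_mem_iff _ (pow_ne_zero p (neg_ne_zero.2 one_ne_zero))).1 h₆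
  intro p
  induction p with
  | zero =>
    intro q f h₁ h₂ h₃
    obtain ⟨b, hb, h₄, η, hη⟩ := hlift 0 q f h₁ h₂ h₃
    -- In the column p = 0 the obstruction is a constant form, namely the Chevalley–Eilenberg
    -- differential of η; subtracting the constant η removes it without changing the cobar.
    refine ⟨b - S.const 1 η, ?_, ?_⟩
    · rw [map_sub, cobar_const, sub_zero, hb]
    · have h₅ := S.extDeriv_const (n := 0) η
      rw [map_sub, S.eq_const_of_cobar_eq_zero _ h₄, ← hη, sub_eq_zero]
      exact h₅.symm
  | succ p ih =>
    intro q f h₁ h₂ h₃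
    obtain ⟨b, hb, h₄, h₅⟩ := hlift (p + 1) q f h₁ h₂ h₃
    obtain ⟨b₁, hb₁, hb₁'⟩ := ih (q + 1) (S.extDeriv b) h₄ (S.extDeriv_extDeriv b) h₅
    obtain ⟨a, ha⟩ := hS p q b₁ hb₁'
    -- By induction the obstruction is the cobar of a column-closed b₁; a column primitive a of b₁
    -- supplies the correction, since the two differentials commute.
    refine ⟨b - S.cobar (p + 1) a, ?_, ?_⟩
    · rw [map_sub, cobar_cobar, sub_zero, hb]
    · rw [map_sub, ← cobar_extDeriv, ha, hb₁, sub_self]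

/-- Zigzag for surjectivity: start from the left invariant form η in column p = 0 and repeatedly
take a primitive along the column, then its cobar, descending to q = 0. By `restrict_cobar` the
class changes only by a sign. -/
theorem ColumnsExact.exists_restrict_sub_mem [CharZero K] (hS : S.ColumnsExact) {n : ℕ}
    (η : Form K E n) (hη : ceDifferential S.bracket n η = 0) : ∀ (p q : ℕ) (h : q + p = n),
      ∃ f : S.Cochain (p + 1) (Form K E q), S.cobar (p + 1) f = 0 ∧ S.extDeriv f = 0 ∧
        castForm h (S.restrict p f) - η ∈ ceRange S.bracket n := by
  intro p
  induction p with
  | zero =>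
    intro q h
    subst h
    refine ⟨S.const 1 η, S.cobar_const η, ?_, ?_⟩
    · have h₅ := S.extDeriv_const (n := 0) (q := q) η
      refine h₅.trans ?_
      rw [show ceDifferential S.bracket q η = 0 from hη, map_zero]
    · have : castForm rfl (S.restrict 0 (S.const 1 η)) - η = 0 := sub_self η
      rw [this]
      exact Submodule.zero_mem _
  | succ p ih =>
    intro q h
    obtain ⟨f, h₁, h₂, h₃⟩ := ih (q + 1) (by omega)
    obtain ⟨a, ha⟩ := hS p q f h₂
    -- This sign undoes the one in `restrict_cobar`, so the Lie algebra class stays that of η.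
    refine ⟨-((-1 : K) ^ p • S.cobar (p + 1) a), ?_, ?_, ?_⟩
    · rw [map_neg, map_smul, cobar_cobar, smul_zero, neg_zero]
    · rw [map_neg, map_smul, ← cobar_extDeriv, ha, h₁, smul_zero, neg_zero]
    · have h₄ := S.restrict_cobar a
      rw [ha] at h₄
      subst h
      rw [castForm_rfl, map_neg, map_smul, h₄, smul_sub, smul_smul, ← pow_add,
        Even.neg_one_pow ⟨p, rfl⟩, one_smul, neg_sub, sub_right_comm]
      exact Submodule.sub_mem _ h₃ (Submodule.smul_mem _ _ ⟨_, rfl⟩)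

/-! ### Functions locally constant in the last variable, and averaging -/

variable (S)

theorem lastDeriv_eq_zero_of_extDeriv_eq_zero {n : ℕ} (f : S.Cochain (n + 1) (Form K E 0))
    (hf : S.extDeriv f = 0) : S.lastDeriv f = 0 := by
  refine Subtype.ext (funext fun g => ContinuousLinearMap.ext fun v => ?_)
  have h₁ : ContinuousAlternatingMap.alternatizeUncurryFin ((S.lastDeriv f).1 g) + 0 = 0 :=
    congrArg (fun F => F.1 g) hf
  rw [add_zero, ← wedge_coe] at h₁
  have h₂ := curryForm_wedge_zero ((S.lastDeriv f).1 g : E →ₗ[K] Form K E 0) v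
  rw [h₁, map_zero] at h₂
  exact h₂.symm

/-- An analytic germ with zero derivative along a direction is constant along it; this is the case k
= 0 of the Euler operator. The neighbourhood is uniform in all variables together. -/
theorem eventually_eq_update (hK : InvNatBounded K) {n : ℕ}
    (b : S.Cochain (n + 1) Z) (hb : S.lastDeriv b = 0) (g : Fin (n + 1) → V) :
    ∀ᶠ g' in 𝓝 g, b.1 g' = b.1 (Function.update g' (Fin.last n) (g (Fin.last n))) := by
  let γ : (Fin (n + 1) → E) → Z := fun z => b.1 fun i => S.s (z i)
  have hd : ∀ g' : Fin (n + 1) → V, fderiv K γ (fun i => S.c (g' i)) ∘L lastIncl n = 0 := by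
    intro g'
    set a := g' (Fin.last n)
    have hup : Function.update (fun i => S.c (g' i)) (Fin.last n) (S.c a) = fun i => S.c (g' i) :=
      Function.update_eq_self _ _
    have h₁ : HasFDerivAt γ (fderiv K γ fun i => S.c (g' i))
        (Function.update (fun i => S.c (g' i)) (Fin.last n) (S.c a)) := by
      rw [hup]
      exact (b.2 g').differentiableAt.hasFDerivAt
    have h₃ := h₁.comp _ (hasFDerivAt_update_last (K := K) (fun i => S.c (g' i)) (S.c a))
    refine h₃.unique ?_
    have h₄ : (γ ∘ Function.update (fun i => S.c (g' i)) (Fin.last n)) =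
        (fun y => b.1 (mulLast (S.s y) g')) ∘ fun x => S.c (a⁻¹ * S.s x) := by
      funext x
      refine congrArg b.1 (funext fun i => ?_)
      by_cases hi : i = Fin.last n
      · subst hi; simp [mulLast, S.left_inv, a]
      · simp [mulLast, hi, S.left_inv]
    rw [h₄]
    have ho : S.c (a⁻¹ * S.s (S.c a)) = S.o := by rw [S.left_inv, inv_mul_cancel]; rfl
    have h₅ := S.hasFDerivAt_lastDeriv b g'
    rw [hb, ← ho] at h₅
    exact (h₅.comp (S.c a) (S.hasFDerivAt_coframe a)).congr_fderiv
      (ContinuousLinearMap.zero_comp _)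
  have h := eventually_eq_of_fderiv_comp_eq_zero hK (lastIncl n)
    (ContinuousLinearMap.proj (R := K) (φ := fun _ : Fin (n + 1) => E) (Fin.last n))
    (fun e => by simp [lastIncl]) (b.2 g) (by
      filter_upwards [S.eventually_mem_range_pi g]
      rintro _ ⟨g', rfl⟩
      exact hd g')
  have hc : Continuous fun g : Fin (n + 1) → V => fun i => S.c (g i) :=
    continuous_pi fun i => S.isOpenEmbedding.continuous.comp (continuous_apply i)
  filter_upwards [hc.continuousAt.eventually h] with g' hg'
  simp only [S.left_inv] at hg'
  rw [hg']
  refine congrArg b.1 (funext fun i => ?_)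
  by_cases hi : i = Fin.last n
  · subst hi; simp [lastIncl, S.left_inv]
  · simp [lastIncl, hi, S.left_inv]

theorem mulLast_mul {n : ℕ} (x y : V) (g : Fin (n + 1) → V) :
    mulLast (x * y) g = mulLast y (mulLast x g) := by
  simp [mulLast, mul_assoc]

/-- The open subgroup of the elements leaving a function invariant. -/
theorem exists_openSubgroup_mulLast_eq [CompactSpace V] [IsTopologicalGroup V]
    (hK : InvNatBounded K) {n : ℕ} (b : S.Cochain (n + 1) Z) (hb : S.lastDeriv b = 0) :
    ∃ W : OpenSubgroup V, ∀ x ∈ W, ∀ g, b.1 (mulLast x g) = b.1 g := by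
  let W : Subgroup V :=
    { carrier := {x | ∀ g, b.1 (mulLast x g) = b.1 g}
      mul_mem' := fun {x y} hx hy g => by rw [mulLast_mul, hy, hx]
      one_mem' := fun g => by rw [mulLast_one]
      inv_mem' := fun {x} hx g => by
        rw [← hx (mulLast x⁻¹ g), ← mulLast_mul, inv_mul_cancel, mulLast_one] }
  refine ⟨⟨W, ?_⟩, fun x hx => hx⟩
  refine Subgroup.isOpen_of_mem_nhds (g := 1) W ?_
  -- Near (1, g), both h and its right translate have the same value as h with last entry reset to
  -- that of g. Compactness makes the neighbourhood of 1 uniform in g.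
  have h := (isCompact_univ (X := Fin (n + 1) → V)).eventually_forall_of_forall_eventually
    (x₀ := (1 : V)) (P := fun x g => b.1 (mulLast x g) = b.1 g) (by
      intro g _
      have h₁ : Continuous fun z : V × (Fin (n + 1) → V) => mulLast z.1 z.2 :=
        continuous_snd.update _ (((continuous_apply _).comp continuous_snd).mul continuous_fst)
      have h₂ : Tendsto (fun z : V × (Fin (n + 1) → V) => mulLast z.1 z.2) (𝓝 (1, g)) (𝓝 g) := by
        have := h₁.tendsto (1, g)
        rwa [mulLast_one] at this
      have h₃ : Tendsto (fun z : V × (Fin (n + 1) → V) => z.2) (𝓝 (1, g)) (𝓝 g) :=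
        continuous_snd.tendsto _
      filter_upwards [h₂.eventually (S.eventually_eq_update hK b hb g),
        h₃.eventually (S.eventually_eq_update hK b hb g)] with z hz₁ hz₂
      rw [hz₁, hz₂]
      simp [mulLast])
  filter_upwards [h] with x hx g
  exact hx g (Set.mem_univ g)

/-- The function b descends in its last variable to the finite quotient V/W. Averaging over the
quotient, possible in characteristic zero, eliminates the argument and turns the `cobar` identity
into one for the group differential. -/
theorem exists_groupDiff_eq_of_cobar_eq [CharZero K] [CompactSpace V] [IsTopologicalGroup V]
    (hK : InvNatBounded K) {n : ℕ} (f : S.Cochain (n + 1) Z) (b : S.Cochain (n + 1) Z)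
    (hb : S.lastDeriv b = 0) (hbf : S.cobar (n + 1) b = S.extendLast (n + 1) f) :
    ∃ k : S.Cochain n Z, S.groupDiff n k = f := by
  obtain ⟨W, hW⟩ := S.exists_openSubgroup_mulLast_eq hK b hb
  have : Finite (V ⧸ (W : Subgroup V)) := Subgroup.quotient_finite_of_isOpen _ W.isOpen
  let _ : Fintype (V ⧸ (W : Subgroup V)) := Fintype.ofFinite _
  set N : K := ((Fintype.card (V ⧸ (W : Subgroup V)) : ℕ) : K) with hN
  have hN0 : N ≠ 0 := Nat.cast_ne_zero.2 Fintype.card_ne_zero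
  have hout : ∀ (g : Fin n → V) (x : V),
      b.1 (Fin.snoc g (x : V ⧸ (W : Subgroup V)).out) = b.1 (Fin.snoc g x) := by
    intro g x
    obtain ⟨w, hw⟩ := QuotientGroup.mk_out_eq_mul (W : Subgroup V) x
    rw [hw, ← mulLast_snoc]
    exact hW w w.2 _
  let k : S.Cochain n Z := N⁻¹ • ∑ x : V ⧸ (W : Subgroup V),
    S.pull (fun g => Fin.snoc g x.out) (fun i => S.isAn_snoc i _) b
  have hk : ∀ g, k.1 g = N⁻¹ • ∑ x : V ⧸ (W : Subgroup V), b.1 (Fin.snoc g x.out) := by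
    intro g
    simp only [k]
    rw [Submodule.coe_smul, Pi.smul_apply, AddSubmonoidClass.coe_finsetSum, Finset.sum_apply]
    rfl
  refine ⟨k, Subtype.ext (funext fun g => ?_)⟩
  have h₁ : ∀ x : V ⧸ (W : Subgroup V), f.1 g = b.1 (Fin.snoc (Fin.tail g) x.out) +
      ∑ i : Fin n, (-1 : K) ^ ((i : ℕ) + 1) •
        b.1 (Fin.snoc (Fin.contractNth i.castSucc (· * ·) g) x.out) +
      (-1 : K) ^ (n + 1) • b.1 (mulLast x.out g) := by
    intro x
    rw [← cobar_snoc, hbf]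
    refine congrArg f.1 ?_
    rw [Fin.init_snoc]
  -- Left multiplication by the last group variable permutes the cosets, so the top face averages to
  -- a function of the other variables.
  have h₂ : ∑ x : V ⧸ (W : Subgroup V), b.1 (mulLast x.out g) =
      ∑ x : V ⧸ (W : Subgroup V), b.1 (Fin.snoc (Fin.init g) x.out) := by
    refine Fintype.sum_equiv (MulAction.toPerm (g (Fin.last n))) _ _ fun x => ?_
    have h₃ : MulAction.toPerm (g (Fin.last n)) x =
        ((g (Fin.last n) * x.out : V) : V ⧸ (W : Subgroup V)) := by
      conv_lhs => rw [← QuotientGroup.out_eq' x]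
      rfl
    rw [h₃, hout, ← mulLast_snoc, Fin.snoc_init_self]
  have h₄ : N • f.1 g = ∑ x : V ⧸ (W : Subgroup V), f.1 g := by
    rw [Finset.sum_const, Finset.card_univ, hN, Nat.cast_smul_eq_nsmul]
  have h₅ : (S.groupDiff n k).1 g = k.1 (Fin.tail g) + ∑ i : Fin n, (-1 : K) ^ ((i : ℕ) + 1) •
      k.1 (Fin.contractNth i.castSucc (· * ·) g) + (-1 : K) ^ (n + 1) • k.1 (Fin.init g) := by
    rw [← cobar_apply]
    rfl
  rw [← inv_smul_smul₀ hN0 (f.1 g), h₄, Finset.sum_congr rfl fun x _ => h₁ x, h₅]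
  simp only [hk, Finset.sum_add_distrib, smul_add, ← Finset.smul_sum, h₂]
  rw [Finset.sum_comm]
  simp only [← Finset.smul_sum, smul_comm N⁻¹]
  refine congrArg₂ (· + ·) (congrArg₂ (· + ·) rfl ?_) rfl
  rw [Finset.smul_sum]
  exact Finset.sum_congr rfl fun i _ => smul_comm _ _ _

variable {S}

/-- A cocycle whose image in the cohomology of the Lie algebra vanishes is a coboundary. -/
theorem ColumnsExact.exists_groupDiff_eq [CharZero K] [CompactSpace V] [IsTopologicalGroup V]
    (hS : S.ColumnsExact) (hK : InvNatBounded K) {n : ℕ} (f : S.Cochain (n + 1) (Form K E 0))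
    (hf : S.groupDiff (n + 1) f = 0)
    (hf' : S.total (n + 1) f ∈ ceRange S.bracket (0 + (n + 1))) :
    ∃ k : S.Cochain n (Form K E 0), S.groupDiff n k = f := by
  obtain ⟨b, hb, hb'⟩ := hS.exists_cobar_eq n 0 (S.extendLast (n + 1) f)
    (by rw [cobar_extendLast, hf, map_zero])
    (by
      rw [extDeriv_eq_post _ _ (S.lastDeriv_extendLast f)]
      rfl)
    (by
      have : S.restrict (n + 1) (S.extendLast (n + 1) f) = S.total (n + 1) f :=
        congrArg (S.total (n + 1)) (S.evalLast_extendLast f)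
      rwa [this])
  exact S.exists_groupDiff_eq_of_cobar_eq hK f b (S.lastDeriv_eq_zero_of_extDeriv_eq_zero b hb') hb

/-- Every cocycle of the Lie algebra comes from a cocycle on an open subgroup. -/
theorem ColumnsExact.exists_total_sub_mem [CharZero K] [CompactSpace V] [IsTopologicalGroup V]
    (hS : S.ColumnsExact) (hK : InvNatBounded K) {n : ℕ} (η : Form K E n)
    (hη : ceDifferential S.bracket n η = 0) :
    ∃ (f : S.Cochain n (Form K E 0)) (W : OpenSubgroup V),
      (∀ g : Fin (n + 1) → V, (∀ i, g i ∈ W) → (S.groupDiff n f).1 g = 0) ∧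
        castForm (Nat.zero_add n) (S.total n f) - η ∈ ceRange S.bracket n := by
  obtain ⟨F, h₁, h₂, h₃⟩ := hS.exists_restrict_sub_mem η hη n 0 (Nat.zero_add n)
  obtain ⟨W, hW⟩ := S.exists_openSubgroup_mulLast_eq hK F
    (S.lastDeriv_eq_zero_of_extDeriv_eq_zero F h₂)
  refine ⟨S.evalLast n F, W, fun g hg => ?_, h₃⟩
  have h₄ := S.evalLast_cobar F
  rw [h₁, map_zero] at h₄
  have h₅ : (S.groupDiff n (S.evalLast n F)).1 g = (S.cobar n (S.evalLast n F)).1 g +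
    (-1 : K) ^ (n + 1) • F.1 (Fin.snoc (Fin.init g) 1) := rfl
  have h₆ : F.1 (Fin.snoc (Fin.init g) 1) = F.1 g := by
    rw [← hW _ (hg (Fin.last n)) (Fin.snoc (Fin.init g) 1), mulLast_snoc, one_mul,
      Fin.snoc_init_self]
  rw [h₅, h₆]
  exact (congrArg (fun F' => F'.1 g) h₄).symm

end GroupChart

end Comparison

/-! ### Restriction to open subgroups -/

section Restriction

open Filter Topology

variable {K : Type*} [NontriviallyNormedField K] [CompleteSpace K]
  {E : Type*} [NormedAddCommGroup E] [NormedSpace K E] [FiniteDimensional K E]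
  {V : Type*} [TopologicalSpace V] [Group V]
  {U : Type*} [TopologicalSpace U] [Group U]
  {Z : Type*} [NormedAddCommGroup Z] [NormedSpace K Z] [CompleteSpace Z]

namespace GroupChart

variable {S : GroupChart K E V} {T : GroupChart K E U} {j : U →* V}

theorem eventually_s_eq (hj : ∀ x, S.c (j x) = T.c x) (a : U) :
    ∀ᶠ y in 𝓝 (T.c a), S.s y = j (T.s y) := by
  filter_upwards [T.eventually_mem_range a]
  rintro _ ⟨b, rfl⟩
  rw [T.left_inv, ← hj, S.left_inv]

theorem o_eq (hj : ∀ x, S.c (j x) = T.c x) : S.o = T.o := by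
  rw [o, o, ← hj, map_one]

theorem eventually_forall_s_eq (hj : ∀ x, S.c (j x) = T.c x) {n : ℕ} (g : Fin n → U) :
    ∀ᶠ y : Fin n → E in 𝓝 fun i => T.c (g i), (fun i => S.s (y i)) = fun i => j (T.s (y i)) := by
  have h : ∀ i, ∀ᶠ y : Fin n → E in 𝓝 fun i => T.c (g i), S.s (y i) = j (T.s (y i)) := fun i =>
    ((continuous_apply i).tendsto fun i => T.c (g i)).eventually (eventually_s_eq hj (g i))
  filter_upwards [eventually_all.2 h] with y hy
  exact funext hy

/-- Restriction of analytic functions along a homomorphism which preserves the coordinates. -/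
def comap (hj : ∀ x, S.c (j x) = T.c x) (n : ℕ) : S.Cochain n Z →ₗ[K] T.Cochain n Z where
  toFun f := ⟨fun g => f.1 fun i => j (g i), fun g => by
    have h := f.2 fun i => j (g i)
    simp only [hj] at h
    refine h.congr ?_
    filter_upwards [eventually_forall_s_eq hj g] with y hy
    rw [hy]⟩
  map_add' _ _ := rfl
  map_smul' _ _ := rfl

theorem firstDeriv_comap (hj : ∀ x, S.c (j x) = T.c x) {n : ℕ} (f : S.Cochain (n + 1) Z) :
    T.firstDeriv (comap hj (n + 1) f) = comap hj n (S.firstDeriv f) := by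
  refine Subtype.ext (funext fun g => (T.hasFDerivAt_firstDeriv _ g).unique ?_)
  have h := S.hasFDerivAt_firstDeriv f fun i => j (g i)
  rw [o_eq hj] at h
  refine h.congr_of_eventuallyEq ?_
  filter_upwards [eventually_s_eq hj 1] with y hy
  refine congrArg f.1 ?_
  funext i
  refine Fin.cases ?_ (fun i => ?_) i
  · exact hy.symm
  · rfl

/-- Only the germ at the identity matters, and the coordinates agree there. -/
theorem total_comap (hj : ∀ x, S.c (j x) = T.c x) : {p q : ℕ} → (f : S.Cochain p (Form K E q)) →
    T.total p (comap hj p f) = S.total p f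
  | 0, _, f => congrArg f.1 (Subsingleton.elim _ _)
  | p + 1, _, f => by
    rw [total_succ, total_succ]
    congr 1
    refine LinearMap.ext fun v => ?_
    rw [LinearMap.comp_apply, LinearMap.comp_apply, firstDeriv_comap]
    exact total_comap hj (S.slice (S.firstDeriv f) v)

theorem groupDiff_comap (hj : ∀ x, S.c (j x) = T.c x) {n : ℕ} (f : S.Cochain n Z)
    (g : Fin (n + 1) → U) :
    (T.groupDiff n (comap hj n f)).1 g = (S.groupDiff n f).1 fun i => j (g i) := by
  refine congrArg₂ (· + ·) ((T.cobar_apply _ g).trans (Eq.trans ?_ (S.cobar_apply f _).symm)) rfl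
  refine congrArg₂ (· + ·) rfl (Finset.sum_congr rfl fun i _ => ?_)
  refine congrArg (fun g' => (-1 : K) ^ ((i : ℕ) + 1) • f.1 g') ?_
  funext k
  simp only [Fin.contractNth]
  split_ifs
  · rfl
  · exact map_mul j _ _
  · rfl

theorem mulDeriv_comap (hj : ∀ x, S.c (j x) = T.c x) : T.mulDeriv = S.mulDeriv := by
  rw [mulDeriv, mulDeriv, o_eq hj]
  refine Filter.EventuallyEq.fderiv_eq ?_
  filter_upwards [eventually_s_eq hj 1] with y hy
  refine Filter.EventuallyEq.fderiv_eq ?_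
  filter_upwards [eventually_s_eq hj 1] with z hz
  rw [hy, hz, ← map_mul, hj]

theorem bracket_comap (hj : ∀ x, S.c (j x) = T.c x) : T.bracket = S.bracket := by
  rw [bracket, bracket, mulDeriv_comap hj]

end GroupChart

theorem Form.eq_zero_of_finrank_lt {n : ℕ} (hn : Module.finrank K E < n) (η : Form K E n) :
    η = 0 := by
  ext v
  refine η.toAlternatingMap.map_linearDependent v fun h => ?_
  have := h.fintype_card_le_finrank
  rw [Fintype.card_fin] at this
  omega

/-! ### One open subgroup for all cocycles in all degrees -/

namespace GroupChart

variable {S : GroupChart K E V}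

/-- Treat a finite basis of the space of cocycles, intersect the finitely many subgroups obtained,
and extend linearly. -/
theorem ColumnsExact.exists_openSubgroup_degree [CharZero K] [CompactSpace V]
    [IsTopologicalGroup V] (hS : S.ColumnsExact) (hK : InvNatBounded K) (n : ℕ) :
    ∃ W : OpenSubgroup V, ∀ η : Form K E n, ceDifferential S.bracket n η = 0 →
      ∃ f : S.Cochain n (Form K E 0),
        (∀ g : Fin (n + 1) → V, (∀ i, g i ∈ W) → (S.groupDiff n f).1 g = 0) ∧
        castForm (Nat.zero_add n) (S.total n f) - η ∈ ceRange S.bracket n := by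
  let b := Module.finBasis K (LinearMap.ker (ceDifferential (K := K) S.bracket n))
  choose f W hW hf using fun i => hS.exists_total_sub_mem hK (b i).1 (b i).2
  refine ⟨Finset.univ.inf W, fun η hη => ?_⟩
  let r := b.repr ⟨η, hη⟩
  have hr : η = ∑ i, r i • (b i).1 := by
    have := congrArg Subtype.val (b.sum_repr ⟨η, hη⟩)
    rw [AddSubmonoidClass.coe_finsetSum] at this
    exact this.symm
  refine ⟨∑ i, r i • f i, fun g hg => ?_, ?_⟩
  · rw [map_sum, AddSubmonoidClass.coe_finsetSum, Finset.sum_apply]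
    refine Finset.sum_eq_zero fun i _ => ?_
    rw [map_smul]
    have := hW i g fun l => (Finset.inf_le (Finset.mem_univ i) : Finset.univ.inf W ≤ W i) (hg l)
    exact (congrArg (r i • ·) this).trans (smul_zero _)
  · rw [map_sum, map_sum, hr, ← Finset.sum_sub_distrib]
    refine Submodule.sum_mem _ fun i _ => ?_
    rw [map_smul, map_smul, ← smul_sub]
    exact Submodule.smul_mem _ _ (hf i)

/-- An open subgroup on which every cocycle of the Lie algebra comes from a cocycle. -/
theorem ColumnsExact.exists_openSubgroup [CharZero K] [CompactSpace V]
    [IsTopologicalGroup V] (hS : S.ColumnsExact) (hK : InvNatBounded K) :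
    ∃ W : OpenSubgroup V, ∀ (n : ℕ) (η : Form K E n), ceDifferential S.bracket n η = 0 →
      ∃ f : S.Cochain n (Form K E 0),
        (∀ g : Fin (n + 1) → V, (∀ i, g i ∈ W) → (S.groupDiff n f).1 g = 0) ∧
        castForm (Nat.zero_add n) (S.total n f) - η ∈ ceRange S.bracket n := by
  choose W hW using hS.exists_openSubgroup_degree hK
  -- Forms above the dimension vanish, so finitely many degrees suffice.
  refine ⟨(Finset.range (Module.finrank K E + 1)).inf W, fun n η hη => ?_⟩
  by_cases hn : n < Module.finrank K E + 1
  · obtain ⟨f, hf, hf'⟩ := hW n η hη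
    exact ⟨f, fun g hg => hf g fun i => (Finset.inf_le (Finset.mem_range.2 hn) :
      (Finset.range (Module.finrank K E + 1)).inf W ≤ W n) (hg i), hf'⟩
  · refine ⟨0, fun g _ => by rw [map_zero]; rfl, ?_⟩
    rw [Form.eq_zero_of_finrank_lt (by omega) η, map_zero, map_zero, sub_zero]
    exact Submodule.zero_mem _

/-- The comparison of cocycles of the group and of its Lie algebra, for all sufficiently small
open subgroups. -/
theorem ColumnsExact.exists_openSubgroup_comparison [CharZero K] [CompactSpace V]
    [IsTopologicalGroup V] (hS : S.ColumnsExact) (hK : InvNatBounded K) :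
    ∃ W : OpenSubgroup V, ∀ (U : Type _) [TopologicalSpace U] [Group U] (T : GroupChart K E U)
      (j : U →* V), (∀ x, S.c (j x) = T.c x) → (∀ x, j x ∈ W) →
      ∀ (n : ℕ) (η : Form K E n), ceDifferential T.bracket n η = 0 →
      ∃ f : T.Cochain n (Form K E 0), T.groupDiff n f = 0 ∧
        castForm (Nat.zero_add n) (T.total n f) - η ∈ ceRange T.bracket n := by
  obtain ⟨W, hW⟩ := hS.exists_openSubgroup hK
  refine ⟨W, fun U _ _ T j hj hjW n η hη => ?_⟩
  rw [bracket_comap hj] at hη ⊢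
  obtain ⟨f, hf, hf'⟩ := hW n η hη
  refine ⟨comap hj n f, Subtype.ext (funext fun g => ?_), ?_⟩
  · rw [groupDiff_comap, hf _ fun i => hjW _]
    rfl
  · rwa [total_comap]

end GroupChart

end Restriction

/-! ### Lie algebra cochains as forms on a model space -/

section LieForms

variable {K : Type*} [NontriviallyNormedField K] [CompleteSpace K]
  {E : Type*} [NormedAddCommGroup E] [NormedSpace K E] [FiniteDimensional K E]
  {L : Type*} [LieRing L] [LieAlgebra K L] (e : L ≃ₗ[K] E)

/-- Expanding in a basis gives a polynomial in coordinates, hence continuity. -/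
theorem continuous_multilinearMap {n : ℕ} (f : MultilinearMap K (fun _ : Fin n => E) K) :
    Continuous f := by
  let b := Module.finBasis K E
  have h : ⇑f = fun v => ∑ r : Fin n → Fin (Module.finrank K E),
      (∏ i, b.coord (r i) (v i)) • f fun i => b (r i) := by
    funext v
    conv_lhs => rw [← funext fun i => b.sum_repr (v i)]
    rw [f.map_sum]
    exact Finset.sum_congr rfl fun r _ => f.map_smul_univ _ _
  rw [h]
  refine continuous_finsetSum _ fun r _ => ?_
  have hr : Continuous fun v : Fin n → E => ∏ i, b.coord (r i) (v i) :=
    continuous_finsetProd _ fun i _ => ?_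
  · exact hr.smul continuous_const
  exact (LinearMap.continuous_of_finiteDimensional (b.coord (r i))).comp (continuous_apply i)

/-- The Lie algebra cochains given by forms on a model space. -/
def formEquiv (n : ℕ) : Form K E n ≃ₗ[K] LieCochain K L n where
  toFun η := η.toAlternatingMap.compLinearMap e.toLinearMap
  map_add' _ _ := rfl
  map_smul' _ _ := rfl
  invFun η :=
    { AlternatingMap.compLinearMap (η : L [⋀^Fin n]→ₗ[K] K) e.symm.toLinearMap with
      cont := continuous_multilinearMap
        (AlternatingMap.compLinearMap (η : L [⋀^Fin n]→ₗ[K] K) e.symm.toLinearMap).toMultilinearMap }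
  left_inv η := by
    ext v
    exact congrArg η (funext fun i => e.apply_symm_apply (v i))
  right_inv η := by
    refine AlternatingMap.ext fun v => ?_
    exact congrArg (lieEval K L n η) (funext fun i => e.symm_apply_apply (v i))

theorem lieEval_formEquiv {n : ℕ} (η : Form K E n) (x : Fin n → L) :
    lieEval K L n (formEquiv e n η) x = η fun i => e (x i) := rfl

theorem succ_succAbove_succAbove {n : ℕ} {i j : Fin (n + 1)} (h : i ≤ j) (l : Fin n) :
    j.succ.succAbove (i.succAbove l) = i.castSucc.succAbove (j.succAbove l) := by
  have h' : (i : ℕ) ≤ j := h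
  ext
  simp only [Fin.succAbove, Fin.lt_def]
  split_ifs <;> simp only [Fin.val_castSucc, Fin.val_succ] at * <;> omega

/-- Both sides are sums over pairs of positions. Antisymmetry of `br` doubles each term of the
double wedge, cancelling the 1/2, and the shift from j to j + 1 accounts for the sign. -/
theorem lieDifferential_formEquiv [CharZero K] {br : E →ₗ[K] E →ₗ[K] E}
    (he : ∀ x y, e ⁅x, y⁆ = br (e x) (e y)) {n : ℕ} (η : Form K E n) (x : Fin (n + 1) → L) :
    lieDifferential K L n (formEquiv e n η) x = ceDifferential br n η fun i => e (x i) := by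
  cases n with
  | zero => rfl
  | succ n =>
    have hbr : ∀ v w, br w v = -br v w := fun v w => by
      rw [← e.apply_symm_apply v, ← e.apply_symm_apply w, ← he, ← he, ← lie_skew, map_neg]
    rw [ceDifferential_succ, wedgeBracket]
    rw [ContinuousAlternatingMap.neg_apply, ContinuousAlternatingMap.smul_apply, wedge_wedge_apply,
      smul_eq_mul, Finset.mul_sum, ← Finset.sum_neg_distrib]
    have h₁ : lieDifferential K L (n + 1) (formEquiv e (n + 1) η) x =
        ∑ J : Fin (n + 2), ∑ i : Fin (n + 1), if i.castSucc < J then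
          (-1) ^ ((i : ℕ) + (J : ℕ)) * lieEval K L (n + 1) (formEquiv e (n + 1) η)
            (Fin.cons ⁅x i.castSucc, x J⁆ fun l : Fin n => x (J.succAbove (i.succAbove l)))
        else 0 := rfl
    rw [h₁, Fin.sum_univ_succ, Finset.sum_eq_zero fun i _ => if_neg (Fin.not_lt_zero _), zero_add,
      Finset.sum_comm]
    refine Finset.sum_congr rfl fun i _ => ?_
    rw [← Finset.sum_filter, Finset.mul_sum, ← Finset.sum_neg_distrib]
    refine Finset.sum_congr ?_ fun j hj => ?_
    · ext j
      simp
    · have hij : i ≤ j := Finset.mem_Ici.1 hj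
      have h₂ : (fun l => e ((Fin.cons ⁅x i.castSucc, x j.succ⁆ fun l : Fin n =>
          x (j.succ.succAbove (i.succAbove l)) : Fin (n + 1) → L) l)) =
          (Fin.cons (br (e (x i.castSucc)) (e (x j.succ)))
            (j.removeNth (i.castSucc.removeNth fun l => e (x l))) : Fin (n + 1) → E) := by
        funext l
        refine Fin.cases ?_ (fun l => ?_) l
        · exact he _ _
        · exact congrArg (fun k => e (x k)) (succ_succAbove_succAbove hij l)
      rw [lieEval_formEquiv, h₂]
      simp only [LinearMap.compr₂_apply]
      rw [hbr (e (x i.castSucc)) (e (x j.succ)), map_neg, ContinuousAlternatingMap.neg_apply,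
        curryForm_apply, Fin.val_succ, ← add_assoc, pow_succ]
      ring

theorem formEquiv_mem_lieCocycles [CharZero K] {br : E →ₗ[K] E →ₗ[K] E}
    (he : ∀ x y, e ⁅x, y⁆ = br (e x) (e y)) {n : ℕ} (η : Form K E n) :
    formEquiv e n η ∈ lieCocycles K L n ↔ ceDifferential br n η = 0 := by
  rw [lieCocycles, LinearMap.mem_ker]
  constructor
  · intro h
    ext v
    have := congrFun h fun i => e.symm (v i)
    rw [lieDifferential_formEquiv e he] at this
    simp only [LinearEquiv.apply_symm_apply] at this
    exact this
  · intro h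
    funext x
    rw [lieDifferential_formEquiv e he, h]
    rfl

theorem formEquiv_mem_lieCoboundaries [CharZero K] {br : E →ₗ[K] E →ₗ[K] E}
    (he : ∀ x y, e ⁅x, y⁆ = br (e x) (e y)) : {n : ℕ} → (η : Form K E n) →
    (formEquiv e n η ∈ lieCoboundaries K L n ↔ η ∈ ceRange br n)
  | 0, η => (Submodule.mem_bot K).trans
      ((LinearEquiv.map_eq_zero_iff (formEquiv e 0)).trans (Submodule.mem_bot K).symm)
  | n + 1, η => by
    constructor
    · rintro ⟨θ, hθ⟩
      obtain ⟨θ, rfl⟩ := (formEquiv e n).surjective θ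
      refine ⟨θ, ?_⟩
      ext v
      have := congrFun hθ fun i => e.symm (v i)
      rw [lieDifferential_formEquiv e he, lieEval_formEquiv] at this
      simpa only [LinearEquiv.apply_symm_apply] using this
    · rintro ⟨θ, rfl⟩
      exact ⟨formEquiv e n θ, funext fun x => lieDifferential_formEquiv e he θ x⟩

end LieForms

/-! ### Alternatization of mixed derivatives -/

section MixedDerivatives

open Filter Topology

/-- A permutation of `Fin (n + 1)` is given by its value at `0` and a permutation of the rest. -/
def permCons {n : ℕ} (q : Fin (n + 1) × Equiv.Perm (Fin n)) : Equiv.Perm (Fin (n + 1)) :=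
  q.1.cycleRange.symm * Equiv.Perm.decomposeFin.symm (0, q.2)

theorem permCons_zero {n : ℕ} (q : Fin (n + 1) × Equiv.Perm (Fin n)) : permCons q 0 = q.1 := by
  rw [permCons, Equiv.Perm.mul_apply, Equiv.Perm.decomposeFin_symm_apply_zero,
    Fin.cycleRange_symm_zero]

theorem permCons_succ {n : ℕ} (q : Fin (n + 1) × Equiv.Perm (Fin n)) (l : Fin n) :
    permCons q l.succ = q.1.succAbove (q.2 l) := by
  rw [permCons, Equiv.Perm.mul_apply, Equiv.Perm.decomposeFin_symm_apply_succ, Equiv.swap_self,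
    Equiv.refl_apply, Fin.cycleRange_symm_succ]

theorem sign_permCons {n : ℕ} (q : Fin (n + 1) × Equiv.Perm (Fin n)) :
    Equiv.Perm.sign (permCons q) = (-1) ^ (q.1 : ℕ) * Equiv.Perm.sign q.2 := by
  rw [permCons, Equiv.Perm.sign_mul, Equiv.Perm.decomposeFin.symm_sign, if_pos rfl, one_mul,
    Equiv.Perm.sign_symm, Fin.sign_cycleRange]

theorem bijective_permCons {n : ℕ} : Function.Bijective (permCons (n := n)) := by
  rw [Fintype.bijective_iff_injective_and_card]
  refine ⟨fun q q' h => ?_, ?_⟩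
  · have h₁ : q.1 = q'.1 := by rw [← permCons_zero, ← permCons_zero, h]
    refine Prod.ext h₁ (Equiv.ext fun l => ?_)
    have h₂ := permCons_succ q l
    rw [h, permCons_succ, h₁] at h₂
    exact (Fin.succAbove_right_injective h₂).symm
  · rw [Fintype.card_prod, Fintype.card_perm, Fintype.card_perm, Fintype.card_fin,
      Fintype.card_fin, Nat.factorial_succ]

/-- This is the expansion along the first row, matching the recursive wedge in `total` with an
alternating sum over permutations. -/
theorem sum_perm_succ {A : Type*} [AddCommGroup A] {n : ℕ} (F : Equiv.Perm (Fin (n + 1)) → A) :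
    ∑ σ, F σ = ∑ i : Fin (n + 1), ∑ τ : Equiv.Perm (Fin n), F (permCons (i, τ)) := by
  rw [← Fintype.sum_prod_type' (f := fun i τ => F (permCons (i, τ)))]
  exact (Fintype.sum_bijective permCons bijective_permCons _ _ fun _ => rfl).symm

variable {K : Type*} [NontriviallyNormedField K]
  {X : Type*} [NormedAddCommGroup X] [NormedSpace K X]
  {Y : Type*} [NormedAddCommGroup Y] [NormedSpace K Y]
  {Z : Type*} [NormedAddCommGroup Z] [NormedSpace K Z] [CompleteSpace Z]

theorem iteratedFDeriv_comp_add_clm {F : Y → Z} {c : Y} {J : X →L[K] Y} {x : X}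
    (hF : AnalyticAt K F (c + J x)) (n : ℕ) :
    iteratedFDeriv K n (fun y => F (c + J y)) x =
      (iteratedFDeriv K n F (c + J x)).compContinuousLinearMap fun _ => J := by
  let H : Y → Z := fun z => F (c + z)
  have hH : AnalyticAt K H (J x) :=
    hF.comp_of_eq (g := F) (f := fun z => c + z) (analyticAt_const.add analyticAt_id) rfl
  obtain ⟨t, ht, ht', hxt⟩ := eventually_nhds_iff.1 hH.eventually_analyticAt
  have h₁ : ContDiffOn K ω H t := fun z hz => (ht z hz).contDiffAt.contDiffWithinAt
  have h₂ := J.iteratedFDerivWithin_comp_right h₁ ht'.uniqueDiffOn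
    (ht'.preimage J.continuous).uniqueDiffOn (x := x) hxt (i := n) (by simp)
  rw [iteratedFDerivWithin_of_isOpen n (ht'.preimage J.continuous) hxt,
    iteratedFDerivWithin_of_isOpen n ht' hxt, iteratedFDeriv_comp_add_left] at h₂
  exact h₂

/-- Symmetry of higher derivatives rotates the first direction to the last slot, where the recursion
of `iteratedFDeriv` splits it off. -/
theorem iteratedFDeriv_succ_apply_first {F : X → Z} {x : X} (hF : AnalyticAt K F x) {n : ℕ}
    (v : Fin (n + 1) → X) : iteratedFDeriv K (n + 1) F x v =
      iteratedFDeriv K n (fun y => fderiv K F y (v 0)) x (Fin.tail v) := by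
  have h₁ : v ∘ finRotate (n + 1) = Fin.snoc (Fin.tail v) (v 0) := by
    rw [Fin.snoc_eq_cons_rotate]
    funext i
    rw [Fin.cons_self_tail]
    rfl
  rw [← hF.contDiffAt.iteratedFDeriv_comp_perm v (finRotate (n + 1)), h₁,
    iteratedFDeriv_succ_apply_right, Fin.init_snoc, Fin.snoc_last]
  have h₂ := (ContinuousLinearMap.apply K Z (v 0)).iteratedFDeriv_comp_left
    (f := fderiv K F) (x := x) hF.fderiv.contDiffAt (i := n) (n := ω) (by simp)
  exact (congrArg (fun M => M (Fin.tail v)) h₂).symm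

end MixedDerivatives

/-! ### Agreement of `total` with the alternating sum of mixed derivatives -/

section TotalForm

open Filter Topology

variable {K : Type*} [NontriviallyNormedField K] [CompleteSpace K]
  {E : Type*} [NormedAddCommGroup E] [NormedSpace K E] [FiniteDimensional K E]
  {V : Type*} [TopologicalSpace V] [Group V]
  {Z : Type*} [NormedAddCommGroup Z] [NormedSpace K Z] [CompleteSpace Z]

/-- Evaluation of forms of degree zero. -/
def evalForm : Form K E 0 →L[K] K :=
  LinearMap.toContinuousLinearMap
    { toFun := fun η => η Fin.elim0
      map_add' := fun _ _ => rfl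
      map_smul' := fun _ _ => rfl }

namespace GroupChart

variable (S : GroupChart K E V)

/-- The mixed derivative of a function of `n` variables at the identity. -/
def mixedDeriv {n : ℕ} (f : (Fin n → V) → Z) (v : Fin n → E) : Z :=
  iteratedFDeriv K n (fun y : Fin n → E => f fun i => S.s (y i)) (fun _ => S.o)
    fun i => Pi.single i (v i)

/-- Differentiate in the first variable, then restrict to the affine slice on which that variable
stays at the identity; the other directions are tangent to it. -/
theorem mixedDeriv_succ {n : ℕ} (f : S.Cochain (n + 1) Z) (v : Fin (n + 1) → E) :
    S.mixedDeriv f.1 v = S.mixedDeriv (S.slice (S.firstDeriv f) (v 0)).1 (Fin.tail v) := by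
  let F : (Fin (n + 1) → E) → Z := fun y => f.1 fun i => S.s (y i)
  have hF : AnalyticAt K F fun _ => S.o := f.2 fun _ => 1
  let J : (Fin n → E) →L[K] Fin (n + 1) → E := ContinuousLinearMap.pi
    (Fin.cons 0 fun i => ContinuousLinearMap.proj i)
  have hJ : ∀ y, J y = Fin.cons 0 y := fun y => by
    funext i
    refine Fin.cases ?_ (fun i => ?_) i <;> rfl
  let c : Fin (n + 1) → E := Fin.cons S.o 0
  have hc : ∀ y, c + J y = Fin.cons S.o y := fun y => by
    funext i
    rw [hJ]
    refine Fin.cases ?_ (fun i => ?_) i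
    · exact add_zero _
    · exact zero_add _
  have ho : c + J (fun _ => S.o) = fun _ => S.o := by
    rw [hc]
    funext i
    refine Fin.cases ?_ (fun i => ?_) i <;> rfl
  have hH : AnalyticAt K (fun y => fderiv K F y (Pi.single 0 (v 0))) fun _ => S.o :=
    ((ContinuousLinearMap.apply K Z (Pi.single 0 (v 0) : Fin (n + 1) → E)).analyticAt _).comp
      hF.fderiv
  have h₁ := iteratedFDeriv_comp_add_clm (c := c) (J := J) (x := fun _ => S.o)
    (F := fun y => fderiv K F y (Pi.single 0 (v 0))) (by rwa [ho]) n
  rw [mixedDeriv, iteratedFDeriv_succ_apply_first hF]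
  have h₂ : Fin.tail (fun i => (Pi.single i (v i) : Fin (n + 1) → E)) =
      fun i => J (Pi.single i (Fin.tail v i)) := by
    funext i k
    rw [hJ]
    refine Fin.cases ?_ (fun k => ?_) k
    · exact Pi.single_eq_of_ne (Fin.succ_ne_zero i).symm _
    · change (Pi.single i.succ (v i.succ) : Fin (n + 1) → E) k.succ =
        (Pi.single i (v i.succ) : Fin n → E) k
      by_cases hk : k = i
      · subst hk
        rw [Pi.single_eq_same, Pi.single_eq_same]
      · rw [Pi.single_eq_of_ne hk, Pi.single_eq_of_ne (fun h => hk (Fin.succ_injective _ h))]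
  rw [ho] at h₁
  rw [h₂]
  refine (congrArg (fun M => M fun i => Pi.single i (Fin.tail v i)) h₁).symm.trans ?_
  refine congrArg (fun M : ContinuousMultilinearMap K (fun _ : Fin n => Fin n → E) Z =>
    M fun i => Pi.single i (Fin.tail v i)) ?_
  refine (Filter.EventuallyEq.iteratedFDeriv (𝕜 := K) ?_ n).eq_of_nhds
  have ht : Tendsto (fun y : Fin n → E => c + J y) (𝓝 fun _ => S.o) (𝓝 fun _ => S.o) := by
    have : Continuous fun y : Fin n → E => c + J y := by fun_prop
    simpa only [ho] using this.tendsto fun _ => S.o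
  filter_upwards [ht.eventually hF.eventually_analyticAt] with y hy
  rw [hc] at hy ⊢
  have h₃ : HasFDerivAt (fun u : E => (Fin.cons u y : Fin (n + 1) → E))
      (ContinuousLinearMap.single K (fun _ : Fin (n + 1) => E) 0) S.o := by
    have h₄ : (fun u : E => (Fin.cons u y : Fin (n + 1) → E)) =
        fun u => ContinuousLinearMap.single K (fun _ : Fin (n + 1) => E) 0 u + Fin.cons 0 y := by
      funext u i
      refine Fin.cases ?_ (fun i => ?_) i
      · change u = (Pi.single 0 u : Fin (n + 1) → E) 0 + 0
        rw [Pi.single_eq_same, add_zero]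
      · change y i = (Pi.single 0 u : Fin (n + 1) → E) i.succ + y i
        rw [Pi.single_eq_of_ne (Fin.succ_ne_zero i), zero_add]
    rw [h₄]
    exact (ContinuousLinearMap.hasFDerivAt _).add_const _
  have h₅ := HasFDerivAt.comp S.o (g := F) hy.differentiableAt.hasFDerivAt h₃
  have h₆ : (F ∘ fun u : E => (Fin.cons u y : Fin (n + 1) → E)) =
      fun u => f.1 (Fin.cons (S.s u) fun i => S.s (y i)) := by
    funext u
    refine congrArg f.1 ?_
    funext i
    refine Fin.cases ?_ (fun i => ?_) i <;> rfl
  rw [h₆] at h₅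
  exact congrArg (fun M : E →L[K] Z => M (v 0))
    (h₅.unique (S.hasFDerivAt_firstDeriv f fun i => S.s (y i)))

/-- This identifies the recursive `total` with the explicit formula for φ: each wedge is one
expansion along the first variable. -/
theorem castForm_total_apply : {n : ℕ} → (f : S.Cochain n (Form K E 0)) → (v : Fin n → E) →
    castForm (Nat.zero_add n) (S.total n f) v = ∑ σ : Equiv.Perm (Fin n),
      Equiv.Perm.sign σ • S.mixedDeriv (S.post evalForm f).1 (v ∘ σ)
  | 0, f, v => by
    rw [Fintype.sum_unique, castForm_rfl, total_zero]
    have h : Equiv.Perm.sign (default : Equiv.Perm (Fin 0)) = 1 := rfl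
    rw [h, one_smul, mixedDeriv, iteratedFDeriv_zero_apply]
    exact congrArg₂ (fun (η : Form K E 0) u => η u)
      (congrArg f.1 (Subsingleton.elim _ _)) (Subsingleton.elim _ _)
  | n + 1, f, v => by
    rw [total_succ, ← wedge_castForm (Nat.zero_add n), wedge_apply, sum_perm_succ]
    refine Finset.sum_congr rfl fun i _ => ?_
    rw [LinearMap.comp_apply, LinearMap.comp_apply, castForm_total_apply, Finset.mul_sum]
    refine Finset.sum_congr rfl fun τ _ => ?_
    have h₁ : (v ∘ permCons (i, τ)) 0 = v i := congrArg v (permCons_zero (i, τ))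
    have h₂ : Fin.tail (v ∘ permCons (i, τ)) = i.removeNth v ∘ τ :=
      funext fun l => congrArg v (permCons_succ (i, τ) l)
    rw [mixedDeriv_succ, h₁, h₂, slice_firstDeriv_post, sign_permCons, Units.smul_def,
      Units.smul_def, zsmul_eq_mul, zsmul_eq_mul, ← mul_assoc]
    push_cast
    rfl

end GroupChart

end TotalForm

/-! ### Lie groups covered by the preferred chart at the identity -/

section LieGroupChart

open Filter Topology

variable {K : Type*} [NontriviallyNormedField K] [CompleteSpace K]
  {E : Type*} [NormedAddCommGroup E] [NormedSpace K E] [FiniteDimensional K E]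
  {V : Type*} [TopologicalSpace V] [ChartedSpace E V] [Group V] [LieGroup 𝓘(K, E) ω V]

theorem contDiffAt_iff_analyticAt {X Y : Type*} [NormedAddCommGroup X] [NormedSpace K X]
    [NormedAddCommGroup Y] [NormedSpace K Y] [CompleteSpace Y] {f : X → Y} {x : X} :
    ContDiffAt K ω f x ↔ AnalyticAt K f x := by
  rw [← contDiffWithinAt_univ, contDiffWithinAt_omega_iff_analyticWithinAt, analyticWithinAt_univ]

theorem contMDiffAt_chartAt_symm {y : E} (hy : y ∈ (chartAt E (1 : V)).target) :
    ContMDiffAt 𝓘(K, E) 𝓘(K, E) ω (chartAt E (1 : V)).symm y :=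
  (contMDiffOn_chart_symm (I := 𝓘(K, E)) (n := ω) (x := (1 : V))).contMDiffAt
    ((chartAt E (1 : V)).open_target.mem_nhds hy)

theorem contMDiffAt_chartAt {x : V} (hx : x ∈ (chartAt E (1 : V)).source) :
    ContMDiffAt 𝓘(K, E) 𝓘(K, E) ω (chartAt E (1 : V)) x :=
  (contMDiffOn_chart (I := 𝓘(K, E)) (n := ω) (x := (1 : V))).contMDiffAt
    ((chartAt E (1 : V)).open_source.mem_nhds hx)

variable (K) in
/-- The chart of a Lie group covered by the preferred chart at the identity. -/
def GroupChart.ofLieGroup (h : (chartAt E (1 : V)).source = Set.univ) : GroupChart K E V where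
  c := chartAt E (1 : V)
  s := (chartAt E (1 : V)).symm
  isOpenEmbedding := (chartAt E (1 : V)).isOpenEmbedding h
  left_inv x := (chartAt E (1 : V)).left_inv (h ▸ Set.mem_univ x)
  analyticAt_mul a b := by
    have : CompleteSpace E := FiniteDimensional.complete K E
    have hs : ∀ x, x ∈ (chartAt E (1 : V)).source := fun x => h ▸ Set.mem_univ x
    have h₁ : ∀ x, ContMDiffAt 𝓘(K, E) 𝓘(K, E) ω (chartAt E (1 : V)).symm (chartAt E (1 : V) x) :=
      fun x => contMDiffAt_chartAt_symm ((chartAt E (1 : V)).map_source (hs x))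
    have h₂ : ContMDiffAt 𝓘(K, E × E) 𝓘(K, E) ω (Prod.fst : E × E → E)
      (chartAt E (1 : V) a, chartAt E (1 : V) b) := contDiff_fst.contMDiff.contMDiffAt
    have h₃ : ContMDiffAt 𝓘(K, E × E) 𝓘(K, E) ω (Prod.snd : E × E → E)
      (chartAt E (1 : V) a, chartAt E (1 : V) b) := contDiff_snd.contMDiff.contMDiffAt
    have h₄ := ((h₁ a).comp_of_eq h₂ rfl).mul ((h₁ b).comp_of_eq h₃ rfl)
    have h₅ := (contMDiffAt_chartAt (K := K) (hs _)).comp_of_eq h₄ rfl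
    exact contDiffAt_iff_analyticAt.1 h₅.contDiffAt
  analyticAt_inv a := by
    have : CompleteSpace E := FiniteDimensional.complete K E
    have hs : ∀ x, x ∈ (chartAt E (1 : V)).source := fun x => h ▸ Set.mem_univ x
    have h₁ : ContMDiffAt 𝓘(K, E) 𝓘(K, E) ω (chartAt E (1 : V)).symm (chartAt E (1 : V) a) :=
      contMDiffAt_chartAt_symm ((chartAt E (1 : V)).map_source (hs a))
    have h₅ := (contMDiffAt_chartAt (K := K) (hs _)).comp_of_eq h₁.inv rfl
    exact contDiffAt_iff_analyticAt.1 h₅.contDiffAt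

variable (h : (chartAt E (1 : V)).source = Set.univ)

theorem contMDiff_pi_apply {n : ℕ} (i : Fin n) :
    ContMDiff (ModelWithCorners.pi fun _ : Fin n => 𝓘(K, E)) 𝓘(K, E) ω
      (fun g : Fin n → V => g i) := by
  intro g
  rw [contMDiffAt_iff]
  refine ⟨(continuous_apply i).continuousAt, ?_⟩
  have h₁ : ContDiffWithinAt K ω (fun y : Fin n → E => y i)
      (Set.range (ModelWithCorners.pi fun _ : Fin n => 𝓘(K, E)))
      (extChartAt (ModelWithCorners.pi fun _ : Fin n => 𝓘(K, E)) g g) :=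
    (ContinuousLinearMap.proj (R := K) (φ := fun _ : Fin n => E) i).contDiff.contDiffWithinAt
  refine h₁.congr_of_eventuallyEq ?_ ?_
  · have h₂ : (fun y : Fin n → E => y i) ⁻¹' (chartAt E (g i)).target ∈
        𝓝 (extChartAt (ModelWithCorners.pi fun _ : Fin n => 𝓘(K, E)) g g) :=
      ((chartAt E (g i)).open_target.preimage (continuous_apply i)).mem_nhds
        ((chartAt E (g i)).map_source (mem_chart_source E (g i)))
    filter_upwards [mem_nhdsWithin_of_mem_nhds h₂] with y hy
    exact (chartAt E (g i)).right_inv hy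
  · exact (chartAt E (g i)).right_inv ((chartAt E (g i)).map_source (mem_chart_source E (g i)))

theorem contMDiffAt_pi_chartAt_symm {n : ℕ} {y : Fin n → E}
    (hy : ∀ i, y i ∈ (chartAt E (1 : V)).target) :
    ContMDiffAt 𝓘(K, Fin n → E) (ModelWithCorners.pi fun _ : Fin n => 𝓘(K, E)) ω
      (fun (y : Fin n → E) i => (chartAt E (1 : V)).symm (y i)) y := by
  have h₁ : ∀ i, ContMDiffAt 𝓘(K, Fin n → E) 𝓘(K, E) ω
      (fun y : Fin n → E => (chartAt E (1 : V)).symm (y i)) y := fun i =>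
    (contMDiffAt_chartAt_symm (K := K) (hy i)).comp y
      (ContinuousLinearMap.proj (R := K) (φ := fun _ : Fin n => E) i).contDiff.contMDiff.contMDiffAt
  rw [contMDiffAt_iff]
  refine ⟨continuousAt_pi.2 fun i => (h₁ i).continuousAt, ?_⟩
  refine contDiffWithinAt_pi.2 fun i => ?_
  exact (contMDiffAt_iff.1 (h₁ i)).2

/-- The chart is global, so smoothness of class ω on the product manifold is analyticity in the
coordinates. -/
theorem contMDiff_iff_isAn {n : ℕ} {f : (Fin n → V) → K} :
    ContMDiff (ModelWithCorners.pi fun _ : Fin n => 𝓘(K, E)) 𝓘(K, K) ω f ↔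
      (GroupChart.ofLieGroup K h).IsAn f := by
  have hs : ∀ x, x ∈ (chartAt E (1 : V)).source := fun x => h ▸ Set.mem_univ x
  constructor
  · intro hf g
    have h₁ := contMDiffAt_pi_chartAt_symm (K := K) (y := fun i => chartAt E (1 : V) (g i))
      fun i => (chartAt E (1 : V)).map_source (hs (g i))
    exact contDiffAt_iff_analyticAt.1 ((hf _).comp _ h₁).contDiffAt
  · intro hf g
    have h₁ : ContMDiffAt (ModelWithCorners.pi fun _ : Fin n => 𝓘(K, E)) 𝓘(K, Fin n → E) ω
        (fun (g : Fin n → V) i => chartAt E (1 : V) (g i)) g :=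
      contMDiffAt_pi_space.2 fun i =>
        (contMDiffAt_chartAt (K := K) (hs (g i))).comp g (contMDiff_pi_apply i g)
    have h₂ : ContMDiffAt 𝓘(K, Fin n → E) 𝓘(K, K) ω _ fun i => chartAt E (1 : V) (g i) :=
      (contDiffAt_iff_analyticAt.2 (hf g)).contMDiffAt
    refine (h₂.comp g h₁).congr_of_eventuallyEq (Eventually.of_forall fun g => ?_)
    exact congrArg f (funext fun i => ((GroupChart.ofLieGroup K h).left_inv (g i)).symm)

/-- Its value at a is the derivative of left multiplication by a at the identity, applied to v; read
in the chart, this is the frame. -/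
theorem mpullbackWithin_mulInvariantVectorField (v : E) {y : E}
    (hy : y ∈ (chartAt E (1 : V)).target) :
    VectorField.mpullbackWithin 𝓘(K, E) 𝓘(K, E) (extChartAt 𝓘(K, E) (1 : V)).symm
      (mulInvariantVectorField (I := 𝓘(K, E)) (G := V) v) (Set.range 𝓘(K, E)) y =
        (GroupChart.ofLieGroup K h).frame y v := by
  have hs : ∀ x, x ∈ (chartAt E (1 : V)).source := fun x => h ▸ Set.mem_univ x
  have hy' : y ∈ (extChartAt 𝓘(K, E) (1 : V)).target := by
    rwa [extChartAt_target, modelWithCornersSelf_coe_symm, Set.preimage_id,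
      ModelWithCorners.range_eq_univ, Set.inter_univ]
  have : IsManifold 𝓘(K, E) 1 V := IsManifold.of_le (n := ω) le_top
  have h₁ := mfderiv_extChartAt_comp_mfderivWithin_extChartAt_symm (I := 𝓘(K, E)) hy'
  have h₂ := mfderivWithin_extChartAt_symm_comp_mfderiv_extChartAt (I := 𝓘(K, E)) hy'
  rw [VectorField.mpullbackWithin_apply, ContinuousLinearMap.inverse_eq h₂ h₁]
  let a : V := (chartAt E (1 : V)).symm y
  have hd : ∀ b : V, MDifferentiableAt 𝓘(K, E) 𝓘(K, E) (extChartAt 𝓘(K, E) (1 : V)) b := fun b =>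
    (contMDiffAt_chartAt (K := K) (hs b)).mdifferentiableAt (by simp)
  have hd' : MDifferentiableAt 𝓘(K, E) 𝓘(K, E) (fun b : V => a * b) 1 :=
    (contMDiffAt_mul_left (I := 𝓘(K, E)) (n := ω)).mdifferentiableAt (by simp)
  have h₃ : ∀ b, a * 1 = b → (mfderiv 𝓘(K, E) 𝓘(K, E) (extChartAt 𝓘(K, E) (1 : V)) b : E →L[K] E)
      ((mfderiv 𝓘(K, E) 𝓘(K, E) (fun b : V => a * b) 1 : E →L[K] E) v) =
      (mfderiv 𝓘(K, E) 𝓘(K, E) (extChartAt 𝓘(K, E) (1 : V) ∘ fun b : V => a * b) 1 :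
        E →L[K] E) v := by
    rintro _ rfl
    exact (mfderiv_comp_apply (1 : V) (hd _) hd' v).symm
  refine (h₃ a (mul_one a)).trans ?_
  rw [((hd (a * 1)).comp (1 : V) hd').mfderiv]
  change fderivWithin K (fun z => chartAt E (1 : V) (a * (chartAt E (1 : V)).symm z))
    (Set.range (𝓘(K, E) : E → E)) (chartAt E (1 : V) 1) v = _
  rw [ModelWithCorners.range_eq_univ, fderivWithin_univ]
  rfl

/-- In the chart the bracket at the identity is DY(X) - DX(Y) for two frame fields. The frame is the
identity there, and its derivative is `mulDeriv`. -/
theorem lieCoord_bracket [CompleteSpace E] (v w : GroupLieAlgebra 𝓘(K, E) V) :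
    lieCoord K E V ⁅v, w⁆ =
      (GroupChart.ofLieGroup K h).bracket (lieCoord K E V v) (lieCoord K E V w) := by
  let S := GroupChart.ofLieGroup K h
  have hf : ∀ u : E, VectorField.mpullbackWithin 𝓘(K, E) 𝓘(K, E) (extChartAt 𝓘(K, E) (1 : V)).symm
      (mulInvariantVectorField (I := 𝓘(K, E)) (G := V) u) (Set.range 𝓘(K, E)) =ᶠ[𝓝 S.o]
        fun y => S.frame y u := fun u => by
    filter_upwards [(chartAt E (1 : V)).open_target.mem_nhds (mem_chart_target E (1 : V))] with y hy
    exact mpullbackWithin_mulInvariantVectorField h u hy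
  have hf' : ∀ u : E, HasFDerivAt (fun y => S.frame y u) (S.mulDeriv.flip u) S.o := fun u => 
    (ContinuousLinearMap.apply K E u).hasFDerivAt.comp S.o
      (S.analyticAt_frame 1).differentiableAt.hasFDerivAt
  have : IsManifold 𝓘(K, E) 1 V := IsManifold.of_le (n := ω) le_top
  -- The fields, the derivative of the chart and the domain are made arbitrary, so that each can be
  -- replaced by its description in the chart.
  have key : ∀ (L : E →L[K] E) (X Y : E → E) (t : Set E), L = ContinuousLinearMap.id K E →
      X =ᶠ[𝓝 S.o] (fun y => S.frame y (lieCoord K E V v)) →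
      Y =ᶠ[𝓝 S.o] (fun y => S.frame y (lieCoord K E V w)) → t = Set.univ →
      L.inverse (VectorField.lieBracketWithin K X Y t S.o) =
        S.bracket (lieCoord K E V v) (lieCoord K E V w) := by
    rintro _ X Y _ rfl hX hY rfl
    rw [ContinuousLinearMap.inverse_id, VectorField.lieBracketWithin_univ,
      VectorField.lieBracket_eq]
    change fderiv K Y S.o (X S.o) - fderiv K X S.o (Y S.o) = _
    rw [hX.fderiv_eq, hY.fderiv_eq, (hf' _).fderiv, (hf' _).fderiv, hX.eq_of_nhds, hY.eq_of_nhds,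
      S.frame_o, S.bracket_apply]
    rfl
  have ht : (extChartAt 𝓘(K, E) (1 : V)).symm ⁻¹' Set.univ ∩ Set.range (𝓘(K, E) : E → E) =
      Set.univ := by
    rw [ModelWithCorners.range_eq_univ, Set.preimage_univ, Set.univ_inter]
  exact key _ _ _ _ mfderiv_extChartAt_self (hf v) (hf w) ht

end LieGroupChart

/-! ### The Lazard morphism in the chart -/

section LazardMorphism

variable {K : Type*} [NontriviallyNormedField K] [CompleteSpace K]
  {E : Type*} [NormedAddCommGroup E] [NormedSpace K E] [FiniteDimensional K E]

variable (K E) in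
/-- Constants as forms of degree zero. -/
def zeroForm : K →L[K] Form K E 0 :=
  LinearMap.toContinuousLinearMap
    { toFun := fun a => ContinuousAlternatingMap.constOfIsEmpty K E (Fin 0) a
      map_add' := fun _ _ => rfl
      map_smul' := fun _ _ => rfl }

theorem evalForm_zeroForm (a : K) : evalForm (zeroForm K E a) = a := rfl

theorem zeroForm_evalForm (η : Form K E 0) : zeroForm K E (evalForm η) = η := by
  ext v
  exact congrArg η (Subsingleton.elim _ _)

variable {V : Type*} [TopologicalSpace V] [ChartedSpace E V] [Group V] [LieGroup 𝓘(K, E) ω V]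
  [CompleteSpace E] (h : (chartAt E (1 : V)).source = Set.univ)

variable (K E V) in
/-- The identification of the Lie algebra with the model space. -/
def lieCoordEquiv : GroupLieAlgebra 𝓘(K, E) V ≃ₗ[K] E where
  __ := lieCoord K E V
  invFun v := v
  left_inv _ := rfl
  right_inv _ := rfl

/-- Locally analytic functions as analytic functions in the chart. -/
def cochainEquiv (n : ℕ) :
    laCochains K E V n ≃ₗ[K] (GroupChart.ofLieGroup K h).Cochain n (Form K E 0) where
  toFun f := (GroupChart.ofLieGroup K h).post (zeroForm K E) ⟨f.1, (contMDiff_iff_isAn h).1 f.2⟩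
  map_add' _ _ := Subtype.ext (funext fun _ => map_add (zeroForm K E) _ _)
  map_smul' _ _ := Subtype.ext (funext fun _ => map_smul (zeroForm K E) _ _)
  invFun f :=
    let F : (GroupChart.ofLieGroup K h).Cochain n K :=
      (GroupChart.ofLieGroup K h).post (evalForm (K := K) (E := E)) f
    ⟨F.1, (contMDiff_iff_isAn h).2 F.2⟩
  left_inv _ := rfl
  right_inv f := Subtype.ext (funext fun g => zeroForm_evalForm (f.1 g))

theorem groupDiff_cochainEquiv {n : ℕ} (f : laCochains K E V n) (g : Fin (n + 1) → V) :
    ((GroupChart.ofLieGroup K h).groupDiff n (cochainEquiv h n f)).1 g =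
      zeroForm K E (groupDifferential K V n f.1 g) := by
  have h₁ : groupDifferential K V n f.1 g = f.1 (Fin.tail g)
    + ∑ i : Fin n, (-1) ^ ((i : ℕ) + 1) * f.1 (Fin.contractNth i.castSucc (· * ·) g)
    + (-1) ^ (n + 1) * f.1 (Fin.init g) := rfl
  rw [h₁, map_add, map_add, map_sum]
  refine congrArg₂ (fun a b : Form K E 0 => a + b)
    (((GroupChart.ofLieGroup K h).cobar_apply _ g).trans ?_) ?_
  · refine congrArg₂ (fun a b : Form K E 0 => a + b) rfl (Finset.sum_congr rfl fun i _ => ?_)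
    exact (map_smul (zeroForm K E) _ _).symm
  · exact (map_smul (zeroForm K E) _ _).symm

theorem groupDiff_cochainEquiv_eq_zero {n : ℕ} (f : laCochains K E V n) :
    (GroupChart.ofLieGroup K h).groupDiff n (cochainEquiv h n f) = 0 ↔
      groupDifferential K V n f.1 = 0 := by
  constructor
  · intro hf
    funext g
    have := groupDiff_cochainEquiv h f g
    rw [hf] at this
    exact (congrArg evalForm this).symm
  · intro hf
    refine Subtype.ext (funext fun g => ?_)
    rw [groupDiff_cochainEquiv, hf]
    exact map_zero (zeroForm K E)

theorem lazardCochain_eq {n : ℕ} (f : laCochains K E V n) :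
    lazardCochain K E V f.1 = formEquiv (lieCoordEquiv K E V) n
      (castForm (Nat.zero_add n) ((GroupChart.ofLieGroup K h).total n (cochainEquiv h n f))) := by
  refine AlternatingMap.ext fun v => ?_
  refine Eq.trans ?_ ((GroupChart.ofLieGroup K h).castForm_total_apply (cochainEquiv h n f)
    fun i => lieCoordEquiv K E V (v i)).symm
  exact MultilinearMap.alternatization_apply _ v

theorem lieCoordEquiv_bracket (v w : GroupLieAlgebra 𝓘(K, E) V) :
    lieCoordEquiv K E V ⁅v, w⁆ = (GroupChart.ofLieGroup K h).bracket
      (lieCoordEquiv K E V v) (lieCoordEquiv K E V w) :=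
  lieCoord_bracket h v w

/-- For coefficients of degree zero the correction term in `total_groupDiff` vanishes, so φ is a
chain map. -/
theorem ceDifferential_castForm_total [CharZero K] {n : ℕ} (f : laCochains K E V n) :
    ceDifferential (GroupChart.ofLieGroup K h).bracket n (castForm (Nat.zero_add n)
      ((GroupChart.ofLieGroup K h).total n (cochainEquiv h n f))) =
      castForm (Nat.zero_add (n + 1)) ((GroupChart.ofLieGroup K h).total (n + 1)
        ((GroupChart.ofLieGroup K h).groupDiff n (cochainEquiv h n f))) := by
  let S := GroupChart.ofLieGroup K h
  have h₁ : S.post (S.ceDiff 0) (cochainEquiv h n f) = 0 := rfl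
  rw [ceDifferential_castForm, GroupChart.total_groupDiff, h₁, map_zero, map_zero, smul_zero,
    sub_zero]

theorem lazardCochain_mem_lieCocycles [CharZero K] (h : (chartAt E (1 : V)).source = Set.univ)
    {n : ℕ} (f : laCocycles K E V n) :
    lazardCochain K E V f.1 ∈ lieCocycles K (GroupLieAlgebra 𝓘(K, E) V) n := by
  rw [lazardCochain_eq h ⟨f.1, f.2.1⟩, formEquiv_mem_lieCocycles _ (lieCoordEquiv_bracket h),
    ceDifferential_castForm_total, (groupDiff_cochainEquiv_eq_zero h ⟨f.1, f.2.1⟩).2 f.2.2,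
    map_zero, map_zero]

/-- The Lazard morphism on cocycles. -/
def lazardMap [CharZero K] (n : ℕ) :
    laCocycles K E V n →ₗ[K] lieCocycles K (GroupLieAlgebra 𝓘(K, E) V) n :=
  LinearMap.codRestrict _ ((formEquiv (lieCoordEquiv K E V) n).toLinearMap ∘ₗ
    castForm (Nat.zero_add n) ∘ₗ (GroupChart.ofLieGroup K h).total n ∘ₗ
      (cochainEquiv h n).toLinearMap ∘ₗ Submodule.inclusion inf_le_left) fun f => by
    have := lazardCochain_mem_lieCocycles h f
    rwa [lazardCochain_eq h ⟨f.1, f.2.1⟩] at this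

theorem lazardMap_apply [CharZero K] {n : ℕ} (f : laCocycles K E V n) :
    lazardMap h n f = ⟨lazardCochain K E V f.1, lazardCochain_mem_lieCocycles h f⟩ :=
  Subtype.ext (lazardCochain_eq h ⟨f.1, f.2.1⟩).symm

theorem lazardMap_mem_lieCoboundaries_of_mem [CharZero K] {n : ℕ} (f : laCocycles K E V n)
    (hf : f.1 ∈ laCoboundaries K E V n) :
    (lazardMap h n f).1 ∈ lieCoboundaries K (GroupLieAlgebra 𝓘(K, E) V) n := by
  cases n with
  | zero =>
    have : f = 0 := Subtype.ext ((Submodule.mem_bot K).1 hf)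
    rw [this, map_zero]
    exact Submodule.zero_mem _
  | succ n =>
    obtain ⟨k, hk, hkf⟩ := hf
    rw [lazardMap_apply]
    change lazardCochain K E V f.1 ∈ _
    rw [lazardCochain_eq h ⟨f.1, f.2.1⟩, formEquiv_mem_lieCoboundaries _ (lieCoordEquiv_bracket h)]
    refine ⟨_, (ceDifferential_castForm_total h ⟨k, hk⟩).trans ?_⟩
    refine congrArg (fun F => castForm (Nat.zero_add (n + 1))
      ((GroupChart.ofLieGroup K h).total (n + 1) F)) (Subtype.ext (funext fun g => ?_))
    rw [groupDiff_cochainEquiv]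
    exact congrArg (fun F => zeroForm K E (F g)) hkf

theorem mem_laCoboundaries_of_lazardMap_mem [CharZero K] [CompactSpace V] [IsTopologicalGroup V]
    (hS : (GroupChart.ofLieGroup K h).ColumnsExact) (hK : InvNatBounded K) {n : ℕ}
    (f : laCocycles K E V n)
    (hf : (lazardMap h n f).1 ∈ lieCoboundaries K (GroupLieAlgebra 𝓘(K, E) V) n) :
    f.1 ∈ laCoboundaries K E V n := by
  rw [lazardMap_apply] at hf
  change lazardCochain K E V f.1 ∈ _ at hf
  rw [lazardCochain_eq h ⟨f.1, f.2.1⟩, formEquiv_mem_lieCoboundaries _ (lieCoordEquiv_bracket h),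
    castForm_mem_ceRange] at hf
  cases n with
  | zero =>
    refine (Submodule.mem_bot K).2 (funext fun g => ?_)
    have h₁ : zeroForm K E (f.1 Fin.elim0) = 0 := (Submodule.mem_bot K).1 hf
    rw [Subsingleton.elim g Fin.elim0]
    exact congrArg evalForm h₁
  | succ n =>
    obtain ⟨k, hk⟩ := hS.exists_groupDiff_eq hK _
      ((groupDiff_cochainEquiv_eq_zero h ⟨f.1, f.2.1⟩).2 f.2.2) hf
    obtain ⟨k, rfl⟩ := (cochainEquiv h n).surjective k
    refine ⟨k.1, k.2, funext fun g => ?_⟩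
    have h₁ := congrArg (fun F => evalForm (F.1 g)) hk
    simp only [groupDiff_cochainEquiv, evalForm_zeroForm] at h₁
    exact h₁

theorem exists_lazardMap_sub_mem [CharZero K] {n : ℕ}
    (hS : ∀ η : Form K E n, ceDifferential (GroupChart.ofLieGroup K h).bracket n η = 0 →
      ∃ f : (GroupChart.ofLieGroup K h).Cochain n (Form K E 0),
        (GroupChart.ofLieGroup K h).groupDiff n f = 0 ∧
        castForm (Nat.zero_add n) ((GroupChart.ofLieGroup K h).total n f) - η ∈
          ceRange (GroupChart.ofLieGroup K h).bracket n)
    (θ : lieCocycles K (GroupLieAlgebra 𝓘(K, E) V) n) :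
    ∃ f : laCocycles K E V n, (lazardMap h n f).1 - θ.1 ∈
      lieCoboundaries K (GroupLieAlgebra 𝓘(K, E) V) n := by
  obtain ⟨θ, hθ⟩ := θ
  obtain ⟨η, rfl⟩ := (formEquiv (lieCoordEquiv K E V) n).surjective θ
  rw [formEquiv_mem_lieCocycles _ (lieCoordEquiv_bracket h)] at hθ
  obtain ⟨f, hf, hf'⟩ := hS η hθ
  obtain ⟨f, rfl⟩ := (cochainEquiv h n).surjective f
  refine ⟨⟨f.1, f.2, (groupDiff_cochainEquiv_eq_zero h f).1 hf⟩, ?_⟩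
  rw [← formEquiv_mem_lieCoboundaries (lieCoordEquiv K E V) (lieCoordEquiv_bracket h),
    map_sub] at hf'
  exact hf'

/-- The Lazard isomorphism for a compact group covered by a chart. -/
theorem exists_lazardEquiv [CharZero K] [CompactSpace V] [IsTopologicalGroup V]
    (hS : (GroupChart.ofLieGroup K h).ColumnsExact) (hK : InvNatBounded K) {n : ℕ}
    (hS' : ∀ η : Form K E n, ceDifferential (GroupChart.ofLieGroup K h).bracket n η = 0 →
      ∃ f : (GroupChart.ofLieGroup K h).Cochain n (Form K E 0),
        (GroupChart.ofLieGroup K h).groupDiff n f = 0 ∧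
        castForm (Nat.zero_add n) ((GroupChart.ofLieGroup K h).total n f) - η ∈
          ceRange (GroupChart.ofLieGroup K h).bracket n) :
    ∃ Φ : LaCohomology K E V n ≃ₗ[K] LieCohomology K (GroupLieAlgebra 𝓘(K, E) V) n,
      ∀ c : laCocycles K E V n,
        ∃ hc : lazardCochain K E V c.1 ∈ lieCocycles K (GroupLieAlgebra 𝓘(K, E) V) n,
          Φ (laClass K E V n c) =
            lieClass K (GroupLieAlgebra 𝓘(K, E) V) n ⟨lazardCochain K E V c.1, hc⟩ := by
  let ψ := lieClass K (GroupLieAlgebra 𝓘(K, E) V) n ∘ₗ lazardMap h n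
  have hψ : Function.Surjective ψ := fun x => by
    obtain ⟨θ, rfl⟩ := Submodule.mkQ_surjective _ x
    obtain ⟨f, hf⟩ := exists_lazardMap_sub_mem h hS' θ
    exact ⟨f, (Submodule.Quotient.eq _).2 hf⟩
  have hψ' : (laCoboundaries K E V n).submoduleOf (laCocycles K E V n) = LinearMap.ker ψ := by
    ext f
    refine ⟨fun hf => (Submodule.Quotient.mk_eq_zero _).2
      (lazardMap_mem_lieCoboundaries_of_mem h f hf), fun hf => ?_⟩
    have hf' : lazardMap h n f ∈ (lieCoboundaries K (GroupLieAlgebra 𝓘(K, E) V) n).submoduleOf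
      (lieCocycles K (GroupLieAlgebra 𝓘(K, E) V) n) := (Submodule.Quotient.mk_eq_zero _).1 hf
    exact mem_laCoboundaries_of_lazardMap_mem h hS hK f hf'
  refine ⟨(Submodule.quotEquivOfEq _ _ hψ').trans (ψ.quotKerEquivOfSurjective hψ), fun c =>
    ⟨lazardCochain_mem_lieCocycles h c, ?_⟩⟩
  exact congrArg (lieClass K (GroupLieAlgebra 𝓘(K, E) V) n) (lazardMap_apply h c)

end LazardMorphism

/-! ### Finite extensions of the `p`-adic numbers -/

section Padic

open Topology

/-- The norm of 1/n is the power of p dividing n, and a divisor of n is at most n. -/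
theorem invNatBounded_of_normedAlgebra_padic (p : ℕ) [Fact p.Prime] (K : Type*)
    [NontriviallyNormedField K] [NormedAlgebra ℚ_[p] K] : InvNatBounded K := by
  intro n hn
  have h₁ : ‖(n : K)‖ = ((p : ℝ) ^ padicValNat p n)⁻¹ := by
    have h₂ : ‖(n : K)‖ = ‖((n : ℚ) : ℚ_[p])‖ := by
      rw [← norm_algebraMap' K ((n : ℚ) : ℚ_[p]), Rat.cast_natCast, map_natCast]
    rw [h₂, Padic.eq_padicNorm, padicNorm.eq_zpow_of_nonzero (Nat.cast_ne_zero.2 hn),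
      padicValRat.of_nat, zpow_neg, zpow_natCast]
    push_cast
    rfl
  have hp : (0 : ℝ) < (p : ℝ) ^ padicValNat p n :=
    pow_pos (Nat.cast_pos.2 (Fact.out : p.Prime).pos) _
  refine ⟨norm_ne_zero_iff.1 (h₁ ▸ (inv_pos.2 hp).ne'), ?_⟩
  rw [norm_inv, h₁, inv_inv]
  exact_mod_cast Nat.le_of_dvd (Nat.pos_of_ne_zero hn) pow_padicValNat_dvd

theorem exists_isClopen_subset {X : Type*} [PseudoMetricSpace X] [IsUltrametricDist X] (x : X)
    {s : Set X} (hs : s ∈ 𝓝 x) : ∃ t ⊆ s, IsClopen t ∧ x ∈ t := by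
  obtain ⟨r, hr, hrs⟩ := Metric.nhds_basis_closedBall.mem_iff.1 hs
  exact ⟨Metric.closedBall x r, hrs, IsUltrametricDist.isClopen_closedBall x hr.ne',
    Metric.mem_closedBall_self hr.le⟩

end Padic

/-! ### Compact open subgroups -/

section CompactOpen

open Filter Topology Pointwise

theorem exists_openSubgroup_subset_isCompact {G : Type*} [TopologicalSpace G] [Group G]
    [IsTopologicalGroup G] {C : Set G} (hC : IsCompact C) (hC' : IsOpen C) (h1 : (1 : G) ∈ C) :
    ∃ U : OpenSubgroup G, (U : Set G) ⊆ C := by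
  have h₁ : ∀ᶠ g in 𝓝 (1 : G), ∀ x ∈ C, g * x ∈ C :=
    hC.eventually_forall_of_forall_eventually fun x hx => by
      have : Tendsto (fun z : G × G => z.1 * z.2) (𝓝 (1, x)) (𝓝 (1 * x)) :=
        continuous_mul.tendsto (1, x)
      rw [one_mul] at this
      exact this.eventually (hC'.mem_nhds hx)
  have h₂ : ∀ᶠ g in 𝓝 (1 : G), ∀ x ∈ C, g⁻¹ * x ∈ C := by
    have : Tendsto (fun g : G => g⁻¹) (𝓝 1) (𝓝 1) := by
      simpa only [inv_one] using (continuous_inv (G := G)).tendsto 1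
    exact this.eventually h₁
  -- The stabilizer of C under left translation lies in C because 1 ∈ C, and compactness of C makes
  -- it a neighbourhood of 1.
  refine ⟨⟨MulAction.stabilizer G C, Subgroup.isOpen_of_mem_nhds _ (g := 1) ?_⟩, fun g hg => ?_⟩
  · filter_upwards [h₁, h₂] with g hg hg'
    refine MulAction.mem_stabilizer_iff.2 (Set.Subset.antisymm ?_ fun x hx => ?_)
    · rintro _ ⟨x, hx, rfl⟩
      exact hg x hx
    · exact Set.mem_smul_set_iff_inv_smul_mem.2 (hg' x hx)
  · have h₃ : g • C = C := hg
    rw [← h₃]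
    exact ⟨1, h1, mul_one g⟩

theorem isCompact_openSubgroup {G : Type*} [TopologicalSpace G] [Group G]
    [IsTopologicalGroup G] {C : Set G} (hC : IsCompact C) (U : OpenSubgroup G)
    (hU : (U : Set G) ⊆ C) : CompactSpace U :=
  isCompact_iff_compactSpace.1 (hC.of_isClosed_subset U.isClosed hU)

/-- Take a small closed ball in the chart: properness makes it compact, the ultrametric inequality
makes it open. -/
theorem exists_isCompact_isOpen_subset_source {E : Type*} [PseudoMetricSpace E] [ProperSpace E]
    [IsUltrametricDist E] {G : Type*} [TopologicalSpace G] [ChartedSpace E G] (x : G) :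
    ∃ C ⊆ (chartAt E x).source, IsCompact C ∧ IsOpen C ∧ x ∈ C := by
  obtain ⟨r, hr, hrs⟩ := Metric.nhds_basis_closedBall.mem_iff.1
    ((chartAt E x).open_target.mem_nhds (mem_chart_target E x))
  refine ⟨(chartAt E x).symm '' Metric.closedBall (chartAt E x x) r, ?_,
    (isCompact_closedBall _ _).image_of_continuousOn ((chartAt E x).continuousOn_symm.mono hrs),
    (chartAt E x).isOpen_image_symm_of_subset_target
      (IsUltrametricDist.isOpen_closedBall _ hr.ne') hrs,
    ⟨chartAt E x x, Metric.mem_closedBall_self hr.le,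
      (chartAt E x).left_inv (mem_chart_source E x)⟩⟩
  rintro _ ⟨y, hy, rfl⟩
  exact (chartAt E x).map_target (hrs hy)

theorem chartAt_openSubgroup_source {E : Type*} [NormedAddCommGroup E] {G : Type*}
    [TopologicalSpace G] [ChartedSpace E G] [Group G] (U : OpenSubgroup G)
    (hU : (U : Set G) ⊆ (chartAt E (1 : G)).source) :
    (chartAt E (1 : U)).source = Set.univ := by
  have h₁ : (chartAt E (1 : U)).source =
      ((chartAt E (1 : G)).subtypeRestr (s := U.toOpens) ⟨(1 : U)⟩).source := rfl
  rw [h₁, OpenPartialHomeomorph.subtypeRestr_source]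
  exact Set.eq_univ_of_forall fun x => hU x.2

end CompactOpen

/-! ### The Lazard isomorphism -/

section Main

open Topology

variable {K : Type*} [NontriviallyNormedField K] [CompleteSpace K] [CharZero K] [ProperSpace K]
  [IsUltrametricDist K] {m : ℕ} {G : Type*} [TopologicalSpace G] [ChartedSpace (Fin m → K) G]
  [Group G] [LieGroup 𝓘(K, Fin m → K) ω G]

/-- Two nested subgroups occur: Lie cocycles are integrated on V, but satisfy the group cocycle
identity only on the smaller U. Column exactness holds on every open subgroup inside C, so
injectivity can be proved on U directly. -/
theorem exists_openSubgroup_lazardEquiv (hK : InvNatBounded K) :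
    ∃ U : OpenSubgroup G, ∀ n : ℕ,
      ∃ Φ : LaCohomology K (Fin m → K) U n ≃ₗ[K]
          LieCohomology K (GroupLieAlgebra 𝓘(K, Fin m → K) U) n,
        ∀ c : laCocycles K (Fin m → K) U n,
          ∃ hc : lazardCochain K (Fin m → K) U c.1 ∈
              lieCocycles K (GroupLieAlgebra 𝓘(K, Fin m → K) U) n,
            Φ (laClass K (Fin m → K) U n c) =
              lieClass K (GroupLieAlgebra 𝓘(K, Fin m → K) U) n
                ⟨lazardCochain K (Fin m → K) U c.1, hc⟩ := by
  have : IsTopologicalGroup G := topologicalGroup_of_lieGroup 𝓘(K, Fin m → K) ω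
  obtain ⟨C, hCs, hC, hC', h1⟩ := exists_isCompact_isOpen_subset_source (E := Fin m → K) (1 : G)
  obtain ⟨V, hV⟩ := exists_openSubgroup_subset_isCompact hC hC' h1
  have hc : ∀ U : OpenSubgroup G, (U : Set G) ⊆ C →
      (chartAt (Fin m → K) (1 : U)).source = Set.univ := fun U hU =>
    chartAt_openSubgroup_source U (hU.trans hCs)
  have hexact : ∀ (U : OpenSubgroup G) (hU : (U : Set G) ⊆ C),
      (GroupChart.ofLieGroup K (hc U hU)).ColumnsExact := fun U hU n q f hf => by
    have := isCompact_openSubgroup hC U hU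
    exact GroupChart.exists_extDeriv_eq _ hK (fun _ z _ hs => exists_isClopen_subset z hs) f hf
  have hT : ∀ U : OpenSubgroup G, IsTopologicalGroup U := fun U =>
    topologicalGroup_of_lieGroup 𝓘(K, Fin m → K) ω
  have := hT V
  have := isCompact_openSubgroup hC V hV
  obtain ⟨W, hW⟩ := (hexact V hV).exists_openSubgroup_comparison hK
  let U : OpenSubgroup G := ⟨(W : Subgroup V).map (V : Subgroup G).subtype,
    V.isOpen.isOpenMap_subtype_val _ W.isOpen⟩
  have hUV : ∀ x : U, ∃ y : V, y ∈ W ∧ (y : G) = x := fun x => x.2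
  have hU : (U : Set G) ⊆ C := by
    rintro _ ⟨y, -, rfl⟩
    exact hV y.2
  let j : U →* V :=
    { toFun := fun x => ⟨x.1, by
        obtain ⟨y, -, hy⟩ := hUV x
        exact hy ▸ y.2⟩
      map_one' := rfl
      map_mul' := fun _ _ => rfl }
  have := hT U
  have := isCompact_openSubgroup hC U hU
  refine ⟨U, fun n => exists_lazardEquiv (hc U hU) (hexact U hU) hK ?_⟩
  -- The preferred charts of U and V are restrictions of one chart of G, so the inclusion preserves
  -- coordinates by definition.
  refine hW U (GroupChart.ofLieGroup K (hc U hU)) j (fun _ => rfl) (fun x => ?_) n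
  obtain ⟨y, hy, hyx⟩ := hUV x
  have : j x = y := Subtype.ext hyx.symm
  rwa [this]

end Main

end LazardComparison

end

theorem mainTheorem2 (p : ℕ) [Fact p.Prime]
    (K : Type*) [NontriviallyNormedField K] [NormedAlgebra ℚ_[p] K] [FiniteDimensional ℚ_[p] K]
    (m : ℕ) (G : Type*) [TopologicalSpace G] [ChartedSpace (Fin m → K) G] [Group G]
    [LieGroup 𝓘(K, Fin m → K) ω G] :
    haveI : CompleteSpace K := FiniteDimensional.complete ℚ_[p] K
    ∃ U : OpenSubgroup G, ∀ n : ℕ,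
      ∃ Φ : LazardComparison.LaCohomology K (Fin m → K) U n ≃ₗ[K]
          LazardComparison.LieCohomology K (GroupLieAlgebra 𝓘(K, Fin m → K) U) n,
        ∀ c : LazardComparison.laCocycles K (Fin m → K) U n,
          ∃ hc : LazardComparison.lazardCochain K (Fin m → K) U c.1 ∈
              LazardComparison.lieCocycles K (GroupLieAlgebra 𝓘(K, Fin m → K) U) n,
            Φ (LazardComparison.laClass K (Fin m → K) U n c) =
              LazardComparison.lieClass K (GroupLieAlgebra 𝓘(K, Fin m → K) U) n
                ⟨LazardComparison.lazardCochain K (Fin m → K) U c.1, hc⟩ := by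
  have : CompleteSpace K := FiniteDimensional.complete ℚ_[p] K
  have : ProperSpace K := FiniteDimensional.proper ℚ_[p] K
  have : CharZero K := charZero_of_injective_algebraMap (algebraMap ℚ_[p] K).injective
  have : IsUltrametricDist K := IsUltrametricDist.of_normedAlgebra ℚ_[p]
  exact LazardComparison.exists_openSubgroup_lazardEquiv
    (LazardComparison.invNatBounded_of_normedAlgebra_padic p K)
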